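/- Greek indices run over $1,2$, repeated indices are summed, a comma denotes partial differentiation, $\delta^{\alpha\beta}$ is the Kronecker delta and $e^{\alpha\beta}$ the alternating symbol. Let $D,E,h>0$ be constants, $\Omega\subset\mathbb R^2$ open, and $f,p:\Omega\to\mathbb R$ smooth ($C^\infty$). Put $$b_{\alpha\beta}=f_{,\alpha\beta},\quad H=\tfrac12\delta^{\alpha\beta}f_{,\alpha\beta},\quad K=\tfrac12 e^{\alpha\mu}e^{\beta\nu}f_{,\alpha\beta}f_{,\mu\nu},\quad P=2D\,\delta^{\mu\nu}H_{,\mu\nu}+p .$$ Marguerre's equations for $(w,\Phi)$ are $$D\delta^{\alpha\beta}\delta^{\mu\nu}w_{,\alpha\beta\mu\nu}-e^{\alpha\mu}e^{\beta\nu}w_{,\alpha\beta}\Phi_{,\mu\nu}-e^{\alpha\mu}e^{\beta\nu}b_{\alpha\beta}\Phi_{,\mu\nu}=p,$$ $$\tfrac1{Eh}\delta^{\alpha\beta}\delta^{\mu\nu}\Phi_{,\alpha\beta\mu\nu}+\tfrac12e^{\alpha\mu}e^{\beta\nu}w_{,\alpha\beta}w_{,\mu\nu}+e^{\alpha\mu}e^{\beta\nu}b_{\alpha\beta}w_{,\mu\nu}=0,\tag{M}$$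 and in the variable $\tilde w=w+f$ they become $$D\delta^{\alpha\beta}\delta^{\mu\nu}\tilde w_{,\alpha\beta\mu\nu}-e^{\alpha\mu}e^{\beta\nu}\tilde w_{,\alpha\beta}\Phi_{,\mu\nu}=P,\qquad \tfrac1{Eh}\delta^{\alpha\beta}\delta^{\mu\nu}\Phi_{,\alpha\beta\mu\nu}+\tfrac12e^{\alpha\mu}e^{\beta\nu}\tilde w_{,\alpha\beta}\tilde w_{,\mu\nu}=K.\tag{N}$$ A system of fourth-order equations $F=0$ is said to admit a vector field $X=\xi^\mu\partial_{x^\mu}+\eta\,\partial_w+\varphi\,\partial_\Phi$ (with $\xi^\mu,\eta,\varphi$ functions of $x^1,x^2,w,\Phi$ on a set $M\subset\mathbb R^4$) if the prolongation of $X$ to jets annihilates $F$ at every jet over $M$ with $F=0$; it admits the local one-parameter group generated by $X$ if the set of jets over $M$ with $F=0$ is invariant under the prolonged group. For constants $C_1,\dots,C_4$ let $$\xi^1=C_1x^1+C_2x^2+C_3,\qquad \xi^2=-C_2x^1+C_1x^2+C_4, \tag{1}$$ and consider the conditions $$2P\,\xi^\mu_{,\mu}+\xi^\mu P_{,\mu}=0,\qquad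 2K\,\xi^\mu_{,\mu}+\xi^\mu K_{,\mu}=0. \tag{2}$$ (i) Let $M\subset\Omega\times\mathbb R^2$ be open and connected. A smooth vector field $X$ on $M$ is admitted by (M) if and only if there are constants $C_i,A_i,B_i$ such that, on $M$, $$X=\xi^\mu\partial_{x^\mu}-\xi^\mu f_{,\mu}\,\partial_w+(A_1x^1+A_2x^2+A_3)\,\partial_w+(B_1x^1+B_2x^2+B_3)\,\partial_\Phi$$ with $\xi$ given by (1), and (2) holds on the projection of $M$ to the $(x^1,x^2)$-plane. Thus, beyond the Lie algebra $L_0$ spanned by $\partial_w,x^1\partial_w,x^2\partial_w,\partial_\Phi,x^1\partial_\Phi,x^2\partial_\Phi$, which is always admitted, the generators admitted are the fields $Y=\xi^\mu\partial_{x^\mu}-\xi^\mu f_{,\mu}\partial_w$ for which (2) holds. (ii) For every $\xi$ of the form (1) the following are equivalent: (a) (M) admits $Y=\xi^\mu\partial_{x^\mu}-\xi^\mu f_{,\mu}\partial_w$ on $\Omega\times\mathbb R^2$; (b) (M) admits the local one-parameter group generated by $Y$ on $\Omega\times\mathbb R^2$; (c) (N) admits $\xi^\mu\partial_{x^\mu}$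 on $\Omega\times\mathbb R^2$; (d) (N) admits the local one-parameter group $G$ of homothetic motions generated by $\xi^\mu\partial_{x^\mu}$ on $\Omega\times\mathbb R^2$; (e) the conditions (2) hold on $\Omega$; (f) if $C_1=0$, then $P$ and $K$ are invariants of $G$ on $\Omega$ (constant along the orbit segments in $\Omega$); if $C_1\ne0$, then $P$ and $K$ are eigenfunctions on $\Omega$ (the zero function being allowed) of the operator $\xi^\mu\partial_{x^\mu}$ for the eigenvalue $-4C_1$. -/

import Mathlib

open Set Filter Topology
open scoped ContDiff

namespace Marguerre

/-! ### Partial derivatives in the plane -/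

/-- The plane of the independent variables `(x¹, x²)`; indices run over `Fin 2`. -/
abbrev Plane := Fin 2 → ℝ

/-- The space `ℝ⁴` of the independent and dependent variables: a point is `(x, u)` with
`u 0 = w` (transversal displacement) and `u 1 = Φ` (Airy's stress function). -/
abbrev Total := Plane × (Fin 2 → ℝ)

/-- The partial derivative `g_{,i}`. -/
noncomputable def pd (i : Fin 2) (g : Plane → ℝ) : Plane → ℝ :=
  fun x => fderiv ℝ g x (Pi.single i 1)

/-- The iterated partial derivative `g_{,i j k …}` along a word of indices. -/
noncomputable def iterPd : List (Fin 2) → (Plane → ℝ) → Plane → ℝ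
  | [], g => g
  | i :: J, g => pd i (iterPd J g)

/-- The alternating symbol. -/
def alt : Matrix (Fin 2) (Fin 2) ℝ := !![0, 1; -1, 0]

/-- `e^{αμ} e^{βν} a_{αβ} b_{μν}`. -/
def bracket (a b : Fin 2 → Fin 2 → ℝ) : ℝ :=
  ∑ α, ∑ β, ∑ μ, ∑ ν, alt α μ * alt β ν * a α β * b μ ν

/-! ### Geometry of the shallow shell `x³ = f(x¹, x²)` -/

/-- The curvature tensor `b_{αβ} = f_{,αβ}`. -/
noncomputable def curvTensor (f : Plane → ℝ) (x : Plane) (α β : Fin 2) : ℝ :=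
  iterPd [α, β] f x

/-- The mean curvature `H = (1/2) δ^{αβ} f_{,αβ}`. -/
noncomputable def meanCurv (f : Plane → ℝ) (x : Plane) : ℝ :=
  (1 / 2) * ∑ α, curvTensor f x α α

/-- The Gaussian curvature `K = (1/2) e^{αμ} e^{βν} f_{,αβ} f_{,μν}`. -/
noncomputable def gaussCurv (f : Plane → ℝ) (x : Plane) : ℝ :=
  (1 / 2) * bracket (curvTensor f x) (curvTensor f x)

/-- `P = 2 D Δ H + p`. -/
noncomputable def effLoad (D : ℝ) (f p : Plane → ℝ) (x : Plane) : ℝ :=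
  2 * D * ∑ μ, iterPd [μ, μ] (meanCurv f) x + p x

/-! ### Jets and systems of differential equations -/

/-- Jet coordinates `(x, u^a_J)`: the base point and, for each dependent variable `a` and each
word `J` of indices, the value of the derivative `u^a_{,J}`. -/
abbrev Jet := Plane × (Fin 2 → List (Fin 2) → ℝ)

/-- The jet at `x` of the pair of functions `u = (w, Φ)`. -/
noncomputable def jet (u : Plane → Fin 2 → ℝ) (x : Plane) : Jet :=
  (x, fun a J => iterPd J (fun y => u y a) x)

/-- A system of two differential equations `F = 0`, given by its left-hand sides as functions of
the jet coordinates. -/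
abbrev DiffSystem := Jet → Fin 2 → ℝ

/-- The second derivatives `u^a_{,αβ}` in a jet. -/
def hess (j : Jet) (a : Fin 2) (α β : Fin 2) : ℝ := j.2 a [α, β]

/-- `δ^{αβ} δ^{μν} u^a_{,αβμν}` in a jet. -/
def bilap (j : Jet) (a : Fin 2) : ℝ := ∑ α, ∑ μ, j.2 a [α, α, μ, μ]

/-- Marguerre's equations with curvature tensor `f_{,αβ}` and load `p`. -/
noncomputable def marguerreSystem (D E h : ℝ) (f p : Plane → ℝ) : DiffSystem := fun j =>
  ![D * bilap j 0 - bracket (hess j 0) (hess j 1) - bracket (curvTensor f j.1) (hess j 1) - p j.1,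
    1 / (E * h) * bilap j 1 + 1 / 2 * bracket (hess j 0) (hess j 0)
      + bracket (curvTensor f j.1) (hess j 0)]

/-- The nonhomogeneous von Kármán equations with right-hand sides `P` and `K`. -/
noncomputable def karmanSystem (D E h : ℝ) (P K : Plane → ℝ) : DiffSystem := fun j =>
  ![D * bilap j 0 - bracket (hess j 0) (hess j 1) - P j.1,
    1 / (E * h) * bilap j 1 + 1 / 2 * bracket (hess j 0) (hess j 0) - K j.1]

/-! ### Point symmetries

A vector field on a subset of `ℝ⁴` is a map `X : Total → Total`; `(X z).1 = (ξ¹, ξ²)` and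
`(X z).2 = (η, φ)` are its components at `z = (x, w, Φ)`. -/

/-- The characteristic `Q^a = η^a - ξ^i u^a_{,i}` of `X`, evaluated along `u`. -/
noncomputable def characteristic (X : Total → Total) (u : Plane → Fin 2 → ℝ) (a : Fin 2) :
    Plane → ℝ :=
  fun x => (X (x, u x)).2 a - ∑ i, (X (x, u x)).1 i * pd i (fun y => u y a) x

/-- The prolongation of `X` at the jet of `u` at `x`. Its component in the direction of the
coordinate `u^a_J` is `D_J Q^a + ξ^i u^a_{,Ji}`; the total derivative `D_J Q^a`, evaluated on the
jet of `u`, is the partial derivative of `Q^a` evaluated along `u`. -/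
noncomputable def prolongation (X : Total → Total) (u : Plane → Fin 2 → ℝ) (x : Plane) : Jet :=
  ((X (x, u x)).1, fun a J => iterPd J (characteristic X u a) x
    + ∑ i, (X (x, u x)).1 i * iterPd (i :: J) (fun y => u y a) x)

/-- The system `F = 0` admits the vector field `X` on `M`: the derivative of `F` along the
prolongation of `X` vanishes at each jet over `M` that satisfies `F = 0`. Jets are represented by
smooth functions, which need not solve the system away from the point `x`. -/
def AdmitsField (F : DiffSystem) (M : Set Total) (X : Total → Total) : Prop :=
  ∀ (u : Plane → Fin 2 → ℝ) (x : Plane), ContDiff ℝ ∞ u → (x, u x) ∈ M → F (jet u x) = 0 →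
    ∀ k, HasDerivAt (fun ε : ℝ => F (jet u x + ε • prolongation X u x) k) 0 0

/-- The local one-parameter group generated by `X` on `M` takes `z` to `z'` at the parameter
value `t`: an integral curve of `X` inside `M` leads from `z` to `z'`. -/
def FlowsTo {V : Type*} [NormedAddCommGroup V] [NormedSpace ℝ V] (X : V → V) (M : Set V)
    (t : ℝ) (z z' : V) : Prop :=
  ∃ γ : ℝ → V, γ 0 = z ∧ γ t = z' ∧
    ∀ s ∈ uIcc 0 t, γ s ∈ M ∧ HasDerivWithinAt γ (X (γ s)) (uIcc 0 t) s

/-- The system `F = 0` admits the local one-parameter group generated by `X` on `M`: the set of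
jets satisfying `F = 0` is invariant under the prolonged group. The prolonged group takes the jet
of `u` at `x` to the jet of `v` at `y` if the transformation takes the point of the graph of `u`
over `x` to the point of the graph of `v` over `y` and the points of the graph of `u` near the
former to points of the graph of `v`. -/
def AdmitsGroup (F : DiffSystem) (M : Set Total) (X : Total → Total) : Prop :=
  ∀ (t : ℝ) (u v : Plane → Fin 2 → ℝ) (x y : Plane), ContDiff ℝ ∞ u → ContDiffAt ℝ ∞ v y →
    FlowsTo X M t (x, u x) (y, v y) →
    (∀ᶠ x' in 𝓝 x, ∃ y', FlowsTo X M t (x', u x') (y', v y')) →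
    F (jet u x) = 0 → F (jet v y) = 0

/-! ### Infinitesimal homotheties and the fields of the classification -/

/-- The infinitesimal homothety with components `C₁x¹ + C₂x² + C₃` and `-C₂x¹ + C₁x² + C₄`. -/
def homothety (C : Fin 4 → ℝ) (x : Plane) : Plane :=
  ![C 0 * x 0 + C 1 * x 1 + C 2, -C 1 * x 0 + C 0 * x 1 + C 3]

/-- A field of vectors `ξ` of the plane acting as the operator `ξ^μ ∂/∂x^μ` on functions. -/
noncomputable def fieldDeriv (ξ : Plane → Plane) (g : Plane → ℝ) (x : Plane) : ℝ :=
  ∑ μ, ξ x μ * pd μ g x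

/-- The divergence `ξ^μ_{,μ}`. -/
noncomputable def divergence (ξ : Plane → Plane) (x : Plane) : ℝ :=
  ∑ μ, pd μ (fun y => ξ y μ) x

/-- `2 g ξ^μ_{,μ} + ξ^μ g_{,μ} = 0` at the points of `S`. -/
def InvarianceCondition (ξ : Plane → Plane) (g : Plane → ℝ) (S : Set Plane) : Prop :=
  ∀ x ∈ S, 2 * g x * divergence ξ x + fieldDeriv ξ g x = 0

/-- The function `g` on `S` is an invariant of the local one-parameter group generated by `ξ`. -/
def IsInvariantOn (ξ : Plane → Plane) (g : Plane → ℝ) (S : Set Plane) : Prop :=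
  ∀ (t : ℝ) (x y : Plane), FlowsTo ξ S t x y → g y = g x

/-- The function `g` on `S` satisfies `ξ^μ g_{,μ} = c g`: it is an eigenfunction for the eigenvalue
`c` of the operator `ξ^μ ∂/∂x^μ` (or identically zero). -/
def IsEigenfunctionOn (ξ : Plane → Plane) (c : ℝ) (g : Plane → ℝ) (S : Set Plane) : Prop :=
  ∀ x ∈ S, fieldDeriv ξ g x = c * g x

/-- The vector field `ξ^μ ∂/∂x^μ` on `ℝ⁴`. -/
def planeField (ξ : Plane → Plane) : Total → Total := fun z => (ξ z.1, 0)

/-- The vector field `ξ^μ ∂/∂x^μ - ξ^μ f_{,μ} ∂/∂w`. -/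
noncomputable def shellField (f : Plane → ℝ) (ξ : Plane → Plane) : Total → Total :=
  fun z => (ξ z.1, ![-fieldDeriv ξ f z.1, 0])

/-- The element `(A₁x¹ + A₂x² + A₃) ∂/∂w + (B₁x¹ + B₂x² + B₃) ∂/∂Φ` of the Lie algebra `L₀` of the
kernel `G₀`. -/
def kernelField (A B : Fin 3 → ℝ) : Total → Total :=
  fun z => (0, ![A 0 * z.1 0 + A 1 * z.1 1 + A 2, B 0 * z.1 0 + B 1 * z.1 1 + B 2])

end Marguerre

namespace Marguerre

/-! ### The algebra of smooth functions and its derivations -/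

section SmoothFn

variable {V : Type*} [NormedAddCommGroup V] [NormedSpace ℝ V]

/-! The translation w + f turns Marguerre's equations into the von Kármán equations with right-hand
sides P and K (`marguerreSystem_eq`). It does not change characteristics, so a field is admitted by
one system exactly when its image is admitted by the other (`admitsFieldAt_marguerreSystem_iff`).
What remains is the symmetry analysis of the von Kármán system.

There, admission is a pointwise statement about jets: the linearized equations hold at every jet
over a point that solves the system (`LinAdmits`). Derivatives are free apart from two scalar
constraints, so polynomials can be inserted and determining equations read off by decreasing order.
Quartic perturbations with zero bilaplacian show that ξ is independent of w, Φ and satisfies the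
Cauchy-Riemann equations (`LinAdmits.conformalAt`). Cubic ones show that η is affine in w, Φ, with
mixed derivatives given by second derivatives of ξ (`LinAdmits.quasilinearAt`). Jets with chosen
gradients and Hessians then annihilate the second derivatives of ξ, the dependence of η on w, Φ, and
the second x-derivatives of η (`eq_zero_of_determining`). Hence the field is locally affine, and
connectedness makes its coefficients global (`exists_affine_field`).

For such an affine field both left-hand sides have weight -4 `C 0`, so admission reduces to ξ·∇P =
-4 `C 0` P and the same for K (`linAdmits_homothety_iff`). These are the invariance conditions, the
divergence of ξ being 2 `C 0`.

For groups, the flow of ξ is explicit, and pulling back along it multiplies the bilaplacian and the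
bracket by exp (4 `C 0` t) (`karmanSystem_pullS`). Invariance of the solution jets therefore amounts
to the integrated form of the same conditions (`InvarianceCondition.eq_exp`). The flow of the shell
field preserves w + f and Φ (`flowsTo_shellField_iff`), so the Marguerre case is conjugate to the
von Kármán case. -/

/-- The algebra of smooth real functions on `V`. -/
def SmoothFn (V : Type*) [NormedAddCommGroup V] [NormedSpace ℝ V] : Subalgebra ℝ (V → ℝ) where
  carrier := {g | ContDiff ℝ ∞ g}
  mul_mem' := fun {a b} (ha : ContDiff ℝ ∞ a) (hb : ContDiff ℝ ∞ b) => ha.mul hb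
  add_mem' := fun {a b} (ha : ContDiff ℝ ∞ a) (hb : ContDiff ℝ ∞ b) => ha.add hb
  algebraMap_mem' := fun c => (contDiff_const : ContDiff ℝ ∞ fun _ : V => c)

theorem contDiff_coe (g : SmoothFn V) : ContDiff ℝ ∞ (g : V → ℝ) := g.2

theorem differentiable_coe (g : SmoothFn V) : Differentiable ℝ (g : V → ℝ) :=
  (contDiff_coe g).differentiable (by simp)

theorem contDiff_fderiv_apply {g : V → ℝ} (hg : ContDiff ℝ ∞ g) (e : V) :
    ContDiff ℝ ∞ (fun z => fderiv ℝ g z e) :=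
  (hg.fderiv_right (m := ∞) (by simp)).clm_apply contDiff_const

/-- The derivative in the direction `e`. -/
noncomputable def dirDeriv (e : V) : Derivation ℝ (SmoothFn V) (SmoothFn V) :=
  Derivation.mk'
    { toFun := fun g => ⟨fun z => fderiv ℝ (g : V → ℝ) z e,
        show ContDiff ℝ ∞ _ from contDiff_fderiv_apply g.2 e⟩
      map_add' := fun g k => by
        ext z
        change fderiv ℝ ((g : V → ℝ) + (k : V → ℝ)) z e = _
        rw [fderiv_add (differentiable_coe g z) (differentiable_coe k z)]; rfl
      map_smul' := fun c g => by
        ext z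
        change fderiv ℝ (c • (g : V → ℝ)) z e = _
        rw [fderiv_const_smul (differentiable_coe g z)]; rfl }
    (fun g k => by
      ext z
      change fderiv ℝ ((g : V → ℝ) * (k : V → ℝ)) z e = _
      rw [fderiv_mul (differentiable_coe g z) (differentiable_coe k z)]; rfl)

theorem dirDeriv_apply (e : V) (g : SmoothFn V) (z : V) :
    (dirDeriv e g : V → ℝ) z = fderiv ℝ (g : V → ℝ) z e := rfl

theorem dirDeriv_dirDeriv_apply (a b : V) (g : SmoothFn V) (z : V) :
    (dirDeriv a (dirDeriv b g) : V → ℝ) z = fderiv ℝ (fderiv ℝ (g : V → ℝ)) z a b := by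
  have h1 : DifferentiableAt ℝ (fderiv ℝ (g : V → ℝ)) z :=
    (((contDiff_coe g).fderiv_right (m := ∞) (by simp)).differentiable (by simp)) z
  change fderiv ℝ (fun y => fderiv ℝ (g : V → ℝ) y b) z a = _
  rw [fderiv_clm_apply h1 (differentiableAt_const b)]
  simp

theorem dirDeriv_comm (e e' : V) (g : SmoothFn V) :
    dirDeriv e (dirDeriv e' g) = dirDeriv e' (dirDeriv e g) := by
  ext z
  rw [dirDeriv_dirDeriv_apply, dirDeriv_dirDeriv_apply]
  exact ((contDiff_coe g).contDiffAt.isSymmSndFDerivAt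
    (by simp only [minSmoothness_of_isRCLikeNormedField]; exact WithTop.coe_le_coe.2 le_top)).eq _ _

/-- Evaluation at a point. -/
noncomputable def evalAt (z : V) : SmoothFn V →ₐ[ℝ] ℝ :=
  (Pi.evalAlgHom ℝ (fun _ : V => ℝ) z).comp (SmoothFn V).val

theorem evalAt_apply (z : V) (g : SmoothFn V) : evalAt z g = (g : V → ℝ) z := rfl

theorem dirDeriv_algebraMap (e : V) (c : ℝ) :
    dirDeriv e (algebraMap ℝ (SmoothFn V) c) = 0 := Derivation.map_algebraMap _ _

theorem evalAt_dirDeriv_congr {g k : SmoothFn V} {z : V}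
    (h : (g : V → ℝ) =ᶠ[𝓝 z] (k : V → ℝ)) (e : V) :
    (dirDeriv e g : V → ℝ) =ᶠ[𝓝 z] (dirDeriv e k : V → ℝ) := by
  filter_upwards [h.eventuallyEq_nhds] with y hy
  rw [dirDeriv_apply, dirDeriv_apply, hy.fderiv_eq]

/-- Cutting off: a function smooth on an open set is near each point of it the restriction of a
smooth function. -/
theorem exists_contDiff_eventuallyEq [FiniteDimensional ℝ V] {W : Type*} [NormedAddCommGroup W]
    [NormedSpace ℝ W] {M : Set V} (hM : IsOpen M) {g : V → W} (hg : ContDiffOn ℝ ∞ g M) {z : V}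
    (hz : z ∈ M) : ∃ k : V → W, ContDiff ℝ ∞ k ∧ k =ᶠ[𝓝 z] g := by
  obtain ⟨r, hr, hrM⟩ := Metric.nhds_basis_closedBall.mem_iff.1 (hM.mem_nhds hz)
  let b : ContDiffBump z := ⟨r / 2, r, by positivity, by linarith⟩
  refine ⟨fun y => b y • g y, ?_, ?_⟩
  · rw [contDiff_iff_contDiffAt]
    intro y
    -- Off `M` nothing is known about `g`, but there the bump vanishes on a whole neighbourhood, the
    -- complement of a closed ball inside `M`.
    by_cases hy : y ∈ M
    · exact b.contDiff.contDiffAt.smul (hg.contDiffAt (hM.mem_nhds hy))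
    · have hy' : y ∈ (Metric.closedBall z r)ᶜ := fun h => hy (hrM h)
      have : (fun y => b y • g y) =ᶠ[𝓝 y] fun _ => 0 := by
        filter_upwards [Metric.isClosed_closedBall.isOpen_compl.mem_nhds hy'] with y' hy'
        have : b y' = 0 := b.zero_of_le_dist (by
          simp only [mem_compl_iff, Metric.mem_closedBall, not_le] at hy'
          exact hy'.le)
        simp [this]
      exact contDiffAt_const.congr_of_eventuallyEq this
  · filter_upwards [b.eventuallyEq_one] with y hy
    simp [hy]

end SmoothFn

/-! ### Smooth functions on the plane -/

/-- The partial derivative as a derivation. -/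
noncomputable abbrev pdS (i : Fin 2) : Derivation ℝ (SmoothFn Plane) (SmoothFn Plane) :=
  dirDeriv (Pi.single i 1)

/-- The iterated partial derivative of a smooth function. -/
noncomputable def iterPdS : List (Fin 2) → SmoothFn Plane → SmoothFn Plane
  | [], g => g
  | i :: J, g => pdS i (iterPdS J g)

@[simp] theorem iterPdS_nil (g : SmoothFn Plane) : iterPdS [] g = g := rfl

@[simp] theorem iterPdS_cons (i : Fin 2) (J : List (Fin 2)) (g : SmoothFn Plane) :
    iterPdS (i :: J) g = pdS i (iterPdS J g) := rfl

theorem iterPd_coe (J : List (Fin 2)) (g : SmoothFn Plane) :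
    iterPd J (g : Plane → ℝ) = (iterPdS J g : Plane → ℝ) := by
  induction J with
  | nil => rfl
  | cons i J ih => funext x; simp only [iterPd, ih]; rfl

theorem iterPd_congr {g k : Plane → ℝ} {x : Plane} (h : g =ᶠ[𝓝 x] k) (J : List (Fin 2)) :
    iterPd J g =ᶠ[𝓝 x] iterPd J k := by
  induction J with
  | nil => exact h
  | cons i J ih =>
    filter_upwards [ih.eventuallyEq_nhds] with y hy
    simp only [iterPd, pd, hy.fderiv_eq]

@[simp] theorem pdS_comm (g : SmoothFn Plane) : pdS 1 (pdS 0 g) = pdS 0 (pdS 1 g) :=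
  dirDeriv_comm _ _ _

theorem iterPdS_pdS (i : Fin 2) (J : List (Fin 2)) (g : SmoothFn Plane) :
    iterPdS J (pdS i g) = pdS i (iterPdS J g) := by
  induction J with
  | nil => rfl
  | cons j J ih => rw [iterPdS_cons, ih, iterPdS_cons, dirDeriv_comm]

/-- The bilaplacian of a smooth function. -/
noncomputable def bilapS : SmoothFn Plane →ₗ[ℝ] SmoothFn Plane :=
  (pdS 0).toLinearMap ∘ₗ (pdS 0).toLinearMap ∘ₗ (pdS 0).toLinearMap ∘ₗ (pdS 0).toLinearMap
  + (2 : ℝ) • (pdS 0).toLinearMap ∘ₗ (pdS 0).toLinearMap ∘ₗ (pdS 1).toLinearMap ∘ₗ (pdS 1).toLinearMap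
  + (pdS 1).toLinearMap ∘ₗ (pdS 1).toLinearMap ∘ₗ (pdS 1).toLinearMap ∘ₗ (pdS 1).toLinearMap

theorem bilapS_apply (g : SmoothFn Plane) : bilapS g = pdS 0 (pdS 0 (pdS 0 (pdS 0 g)))
    + (2 : ℝ) • pdS 0 (pdS 0 (pdS 1 (pdS 1 g))) + pdS 1 (pdS 1 (pdS 1 (pdS 1 g))) := by
  simp [bilapS]

/-- The second derivatives of a smooth function at a point. -/
noncomputable def hessS (x : Plane) (g : SmoothFn Plane) (α β : Fin 2) : ℝ :=
  evalAt x (pdS α (pdS β g))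

theorem bracket_eq (a b : Fin 2 → Fin 2 → ℝ) :
    bracket a b = a 0 0 * b 1 1 + a 1 1 * b 0 0 - a 0 1 * b 1 0 - a 1 0 * b 0 1 := by
  simp [bracket, alt, Fin.sum_univ_two]; ring

/-- The coordinates centred at a point. -/
noncomputable def coordS (a : Plane) (k : Fin 2) : SmoothFn Plane :=
  ⟨fun x => x k - a k, by change ContDiff ℝ ∞ _; fun_prop⟩

theorem pdS_coordS (a : Plane) (i k : Fin 2) :
    pdS i (coordS a k) = if i = k then 1 else 0 := by
  ext x
  rw [dirDeriv_apply]
  have : fderiv ℝ (coordS a k : Plane → ℝ) x = ContinuousLinearMap.proj k :=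
    ((ContinuousLinearMap.proj (R := ℝ) (φ := fun _ : Fin 2 => ℝ) k).hasFDerivAt.sub_const _).fderiv
  simp only [this, ContinuousLinearMap.proj_apply]
  by_cases h : i = k
  · subst h; simp
  · simp [h, Ne.symm h]

@[simp] theorem evalAt_coordS (a : Plane) (k : Fin 2) : evalAt a (coordS a k) = 0 := by
  simp [evalAt_apply, coordS]

/-- The normalized monomials `(x¹ - a¹)^i (x² - a²)^j / (i! j!)`. -/
noncomputable def monoS (a : Plane) (i j : ℕ) : SmoothFn Plane :=
  ((i.factorial * j.factorial : ℝ)⁻¹) • (coordS a 0 ^ i * coordS a 1 ^ j)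

theorem inv_succ_factorial_mul (i : ℕ) :
    ((i + 1).factorial : ℝ)⁻¹ * (i + 1) = (i.factorial : ℝ)⁻¹ := by
  rw [Nat.factorial_succ]; push_cast; field_simp

@[simp] theorem pdS_zero_monoS_succ (a : Plane) (i j : ℕ) :
    pdS 0 (monoS a (i + 1) j) = monoS a i j := by
  have h : pdS 0 (coordS a 0 ^ (i + 1) * coordS a 1 ^ j)
      = (i + 1 : ℝ) • (coordS a 0 ^ i * coordS a 1 ^ j) := by
    rw [Derivation.leibniz, Derivation.leibniz_pow, Derivation.leibniz_pow, pdS_coordS, pdS_coordS]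
    simp only [smul_eq_mul, if_true, zero_ne_one, if_false, mul_zero, zero_add,
      Nat.add_sub_cancel, mul_one, nsmul_eq_mul]
    rw [Algebra.smul_def, map_add, map_natCast, map_one]
    push_cast; ring
  rw [monoS, Derivation.map_smul, h, smul_smul, monoS, mul_inv, mul_right_comm,
    inv_succ_factorial_mul, mul_inv]

@[simp] theorem pdS_one_monoS_succ (a : Plane) (i j : ℕ) :
    pdS 1 (monoS a i (j + 1)) = monoS a i j := by
  have h : pdS 1 (coordS a 0 ^ i * coordS a 1 ^ (j + 1))
      = (j + 1 : ℝ) • (coordS a 0 ^ i * coordS a 1 ^ j) := by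
    rw [Derivation.leibniz, Derivation.leibniz_pow, Derivation.leibniz_pow, pdS_coordS, pdS_coordS]
    simp only [smul_eq_mul, if_true, one_ne_zero, if_false, mul_zero, add_zero,
      Nat.add_sub_cancel, mul_one, nsmul_eq_mul]
    rw [Algebra.smul_def, map_add, map_natCast, map_one]
    push_cast; ring
  rw [monoS, Derivation.map_smul, h, smul_smul, monoS, mul_inv, mul_assoc,
    inv_succ_factorial_mul, mul_inv]

@[simp] theorem pdS_zero_monoS (a : Plane) (j : ℕ) : pdS 0 (monoS a 0 j) = 0 := by
  rw [monoS, Derivation.map_smul, pow_zero, one_mul, Derivation.leibniz_pow, pdS_coordS]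
  simp

@[simp] theorem pdS_one_monoS (a : Plane) (i : ℕ) : pdS 1 (monoS a i 0) = 0 := by
  rw [monoS, Derivation.map_smul, pow_zero, mul_one, Derivation.leibniz_pow, pdS_coordS]
  simp

@[simp] theorem evalAt_monoS_zero (a : Plane) : evalAt a (monoS a 0 0) = 1 := by
  rw [monoS]; simp

@[simp] theorem evalAt_monoS_succ_left (a : Plane) (i j : ℕ) :
    evalAt a (monoS a (i + 1) j) = 0 := by
  rw [monoS, map_smul, map_mul, map_pow, map_pow, evalAt_coordS]; simp

@[simp] theorem evalAt_monoS_succ_right (a : Plane) (i j : ℕ) :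
    evalAt a (monoS a i (j + 1)) = 0 := by
  rw [monoS, map_smul, map_mul, map_pow, map_pow, evalAt_coordS]; simp

/-! ### Order of vanishing -/

/-- All derivatives of `g` of order less than `k` vanish at `x`. -/
def VanishesTo (x : Plane) : ℕ → SmoothFn Plane → Prop
  | 0, _ => True
  | k + 1, g => evalAt x g = 0 ∧ ∀ i, VanishesTo x k (pdS i g)

namespace VanishesTo

variable {x : Plane} {j k n : ℕ} {g g' : SmoothFn Plane}

theorem evalAt_eq_zero (h : VanishesTo x k g) (hk : 0 < k) : evalAt x g = 0 := by
  cases k with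
  | zero => exact absurd hk (lt_irrefl 0)
  | succ k => exact h.1

theorem pdS (h : VanishesTo x k g) (i : Fin 2) : VanishesTo x (k - 1) (pdS i g) := by
  cases k with
  | zero => trivial
  | succ k => exact h.2 i

theorem of_le (h : VanishesTo x k g) (hn : n ≤ k) : VanishesTo x n g := by
  induction n generalizing k g with
  | zero => trivial
  | succ n ih =>
    exact ⟨h.evalAt_eq_zero (by omega), fun i => ih (h.pdS i) (by omega)⟩

theorem zero : VanishesTo x k 0 := by
  induction k with
  | zero => trivial
  | succ k ih => exact ⟨map_zero _, fun i => by rw [map_zero]; exact ih⟩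

theorem add (h : VanishesTo x k g) (h' : VanishesTo x k g') : VanishesTo x k (g + g') := by
  induction k generalizing g g' with
  | zero => trivial
  | succ k ih =>
    exact ⟨by rw [map_add, h.1, h'.1, add_zero], fun i => by
      rw [map_add]; exact ih (h.2 i) (h'.2 i)⟩

theorem mul (h : VanishesTo x j g) (h' : VanishesTo x k g') (hn : n ≤ j + k) :
    VanishesTo x n (g * g') := by
  induction n generalizing j k g g' with
  | zero => trivial
  | succ n ih =>
    refine ⟨?_, fun i => ?_⟩
    · rw [map_mul]
      rcases Nat.eq_zero_or_pos j with hj | hj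
      · rw [h'.evalAt_eq_zero (by omega), mul_zero]
      · rw [h.evalAt_eq_zero hj, zero_mul]
    · rw [Derivation.leibniz, smul_eq_mul, smul_eq_mul]
      -- Each Leibniz term loses one order. Truncated subtraction does no harm: if one factor has
      -- order zero, the other carries the whole order.
      exact (ih h (h'.pdS i) (by omega)).add (ih h' (h.pdS i) (by omega))

theorem mul_left (h : VanishesTo x k g) (a : SmoothFn Plane) : VanishesTo x k (a * g) :=
  mul (j := 0) (g := a) trivial h (by omega)

theorem sum {ι : Type*} (s : Finset ι) {a : ι → SmoothFn Plane}
    (h : ∀ i ∈ s, VanishesTo x k (a i)) : VanishesTo x k (∑ i ∈ s, a i) :=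
  Finset.sum_induction _ (VanishesTo x k) (fun _ _ h h' => h.add h') zero h

theorem neg (h : VanishesTo x k g) : VanishesTo x k (-g) := by
  induction k generalizing g with
  | zero => trivial
  | succ k ih =>
    exact ⟨by rw [map_neg, h.1, neg_zero], fun i => by rw [map_neg]; exact ih (h.2 i)⟩

theorem sub (h : VanishesTo x k g) (h' : VanishesTo x k g') : VanishesTo x k (g - g') := by
  rw [sub_eq_add_neg]; exact h.add h'.neg

/-- Order 5 covers the derivatives through the fourth, all that the bilaplacian sees; hence
characteristics are expanded modulo order 5. -/
theorem evalAt_bilapS (h : VanishesTo x 5 g) : evalAt x (bilapS g) = 0 := by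
  have key : ∀ i j k l, evalAt x (Marguerre.pdS i (Marguerre.pdS j (Marguerre.pdS k
      (Marguerre.pdS l g)))) = 0 := fun i j k l =>
    ((((h.pdS l).pdS k).pdS j).pdS i).evalAt_eq_zero (by norm_num)
  rw [bilapS_apply, map_add, map_add, map_smul, key, key, key]; simp

end VanishesTo

/-! ### Composition with a graph -/

/-- The function `x ↦ G (x, u x)`. -/
noncomputable def compS (G : SmoothFn Total) (u : Fin 2 → SmoothFn Plane) : SmoothFn Plane :=
  ⟨fun x => (G : Total → ℝ) (x, fun a => (u a : Plane → ℝ) x),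
    show ContDiff ℝ ∞ _ from (contDiff_coe G).comp
      (contDiff_id.prodMk (contDiff_pi.2 fun a => contDiff_coe (u a)))⟩

/-- The partial derivative with respect to `xⁱ` of a function of `(x, u)`. -/
noncomputable abbrev tdx (i : Fin 2) : Derivation ℝ (SmoothFn Total) (SmoothFn Total) :=
  dirDeriv ((Pi.single i 1, 0) : Total)

/-- The partial derivative with respect to `uᵇ` of a function of `(x, u)`. -/
noncomputable abbrev tdu (b : Fin 2) : Derivation ℝ (SmoothFn Total) (SmoothFn Total) :=
  dirDeriv ((0, Pi.single b 1) : Total)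

/-- The total derivative D_i: the chain rule along the graph of u. -/
theorem pdS_compS (i : Fin 2) (G : SmoothFn Total) (u : Fin 2 → SmoothFn Plane) :
    pdS i (compS G u) = compS (tdx i G) u + ∑ b, compS (tdu b G) u * pdS i (u b) := by
  ext x
  have hu : HasFDerivAt (fun x : Plane => ((x, fun a => (u a : Plane → ℝ) x) : Total))
      ((ContinuousLinearMap.id ℝ Plane).prod
        (ContinuousLinearMap.pi fun a => fderiv ℝ (u a : Plane → ℝ) x)) x :=
    (hasFDerivAt_id x).prodMk
      (hasFDerivAt_pi.2 fun a => (differentiable_coe (u a) x).hasFDerivAt)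
  have h := ((differentiable_coe G _).hasFDerivAt.comp x hu).fderiv
  have h1 : (pdS i (compS G u) : Plane → ℝ) x
      = fderiv ℝ ((G : Total → ℝ) ∘ fun x : Plane => ((x, fun a => (u a : Plane → ℝ) x) : Total)) x
        (Pi.single i 1) := rfl
  rw [h1, h]
  simp only [ContinuousLinearMap.comp_apply, ContinuousLinearMap.prod_apply,
    ContinuousLinearMap.id_apply, Fin.sum_univ_two]
  have h2 : ((Pi.single i 1, (ContinuousLinearMap.pi fun a => fderiv ℝ (u a : Plane → ℝ) x)
      (Pi.single i 1)) : Total) = (Pi.single i 1, 0)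
        + ((fderiv ℝ (u 0 : Plane → ℝ) x (Pi.single i 1)) • ((0, Pi.single 0 1) : Total)
        + (fderiv ℝ (u 1 : Plane → ℝ) x (Pi.single i 1)) • ((0, Pi.single 1 1) : Total)) := by
    refine Prod.ext ?_ ?_
    · simp
    · ext a; fin_cases a <;> simp
  rw [h2, map_add, map_add, map_smul, map_smul, smul_eq_mul, smul_eq_mul, mul_comm,
    mul_comm (fderiv ℝ (u 1 : Plane → ℝ) x (Pi.single i 1))]
  rfl

theorem evalAt_compS (x : Plane) (G : SmoothFn Total) (u : Fin 2 → SmoothFn Plane) :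
    evalAt x (compS G u) = evalAt ((x, fun a => evalAt x (u a)) : Total) G := rfl

/-- A perturbation vanishing to order `k` changes the composite to order `k` only. -/
theorem vanishesTo_compS_sub {x : Plane} {k : ℕ} (G : SmoothFn Total)
    (u d : Fin 2 → SmoothFn Plane) (hd : ∀ a, VanishesTo x k (d a)) :
    VanishesTo x k (compS G (u + d) - compS G u) := by
  induction k generalizing G with
  | zero => trivial
  | succ k ih =>
    have ih' := fun G => ih G fun a => (hd a).of_le (Nat.le_succ k)
    refine ⟨?_, fun i => ?_⟩
    · have : ∀ a, evalAt x ((u + d) a) = evalAt x (u a) := fun a => by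
        rw [Pi.add_apply, map_add, (hd a).1, add_zero]
      rw [map_sub, evalAt_compS, evalAt_compS]; simp only [this, sub_self]
    · have e : pdS i (compS G (u + d) - compS G u)
          = (compS (tdx i G) (u + d) - compS (tdx i G) u)
            + ∑ b, (pdS i (u b) * (compS (tdu b G) (u + d) - compS (tdu b G) u)
              + compS (tdu b G) (u + d) * pdS i (d b)) := by
        rw [map_sub, pdS_compS, pdS_compS]
        simp only [Fin.sum_univ_two, Pi.add_apply, map_add]; ring
      rw [e]
      exact (ih' _).add (VanishesTo.sum _ fun b _ =>
        ((ih' _).mul_left _).add (((hd b).2 i).mul_left _))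

/-- The linearization of the composite at a perturbation vanishing to order `k` is correct to
order `2 k`. -/
theorem vanishesTo_compS_sub_sub {x : Plane} {k n : ℕ} (hn : n ≤ 2 * k) (G : SmoothFn Total)
    (u d : Fin 2 → SmoothFn Plane) (hd : ∀ a, VanishesTo x k (d a)) :
    VanishesTo x n (compS G (u + d) - compS G u - ∑ b, compS (tdu b G) u * d b) := by
  induction n generalizing G with
  | zero => trivial
  | succ n ih =>
    have ih' := ih (by omega)
    refine ⟨?_, fun i => ?_⟩
    · have h0 := fun a => (hd a).evalAt_eq_zero (by omega)
      have h1 := (vanishesTo_compS_sub G u d hd).evalAt_eq_zero (by omega)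
      rw [map_sub, h1, map_sum]
      simp [h0]
    -- Differentiation reproduces the same remainder for the first derivatives of `G`, plus products
    -- of factors of orders k and k - 1; so order 2k is reached.
    · have e : pdS i (compS G (u + d) - compS G u - ∑ b, compS (tdu b G) u * d b)
          = (compS (tdx i G) (u + d) - compS (tdx i G) u - ∑ b, compS (tdu b (tdx i G)) u * d b)
            + ∑ b, (pdS i (u b) * (compS (tdu b G) (u + d) - compS (tdu b G) u
                - ∑ c, compS (tdu c (tdu b G)) u * d c)
              + (compS (tdu b G) (u + d) - compS (tdu b G) u) * pdS i (d b)) := by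
        rw [map_sub, map_sub, pdS_compS, pdS_compS, map_sum]
        simp only [Fin.sum_univ_two, Pi.add_apply, map_add, Derivation.leibniz, pdS_compS,
          smul_eq_mul, dirDeriv_comm (0, Pi.single _ 1) (Pi.single i 1, 0),
          dirDeriv_comm ((0, Pi.single 1 1) : Total) (0, Pi.single 0 1)]
        ring
      rw [e]
      exact (ih' _).add (VanishesTo.sum _ fun b _ => ((ih' _).mul_left _).add
        ((vanishesTo_compS_sub _ u d hd).mul ((hd b).pdS i) (by omega)))

/-- Coordinate form of Δ²(ag) = gΔ²a + aΔ²g + 4∇a·∇Δg + 4∇Δa·∇g + 2ΔaΔg + 4∇²a:∇²g. -/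
theorem evalAt_bilapS_mul (x : Plane) (a g : SmoothFn Plane) :
    evalAt x (bilapS (a * g)) = evalAt x (bilapS a) * evalAt x g + evalAt x a * evalAt x (bilapS g)
      + 4 * (evalAt x (pdS 0 a) * (evalAt x (pdS 0 (pdS 0 (pdS 0 g)))
            + evalAt x (pdS 0 (pdS 1 (pdS 1 g))))
          + evalAt x (pdS 1 a) * (evalAt x (pdS 0 (pdS 0 (pdS 1 g)))
            + evalAt x (pdS 1 (pdS 1 (pdS 1 g))))
          + (evalAt x (pdS 0 (pdS 0 (pdS 0 a))) + evalAt x (pdS 0 (pdS 1 (pdS 1 a))))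
            * evalAt x (pdS 0 g)
          + (evalAt x (pdS 0 (pdS 0 (pdS 1 a))) + evalAt x (pdS 1 (pdS 1 (pdS 1 a))))
            * evalAt x (pdS 1 g))
      + 2 * (evalAt x (pdS 0 (pdS 0 a)) + evalAt x (pdS 1 (pdS 1 a)))
          * (evalAt x (pdS 0 (pdS 0 g)) + evalAt x (pdS 1 (pdS 1 g)))
      + 4 * (evalAt x (pdS 0 (pdS 0 a)) * evalAt x (pdS 0 (pdS 0 g))
          + 2 * (evalAt x (pdS 0 (pdS 1 a)) * evalAt x (pdS 0 (pdS 1 g)))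
          + evalAt x (pdS 1 (pdS 1 a)) * evalAt x (pdS 1 (pdS 1 g))) := by
  simp only [bilapS_apply, Derivation.leibniz, map_add, map_mul, map_smul, smul_eq_mul]
  ring

theorem hessS_mul (x : Plane) (a g : SmoothFn Plane) (α β : Fin 2) :
    hessS x (a * g) α β = hessS x a α β * evalAt x g + evalAt x a * hessS x g α β
      + evalAt x (pdS α a) * evalAt x (pdS β g) + evalAt x (pdS β a) * evalAt x (pdS α g) := by
  simp only [hessS, Derivation.leibniz, map_add, map_mul, smul_eq_mul]
  ring

theorem hessS_add (x : Plane) (a g : SmoothFn Plane) :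
    hessS x (a + g) = hessS x a + hessS x g := by
  ext α β; simp [hessS]

theorem hessS_sub (x : Plane) (a g : SmoothFn Plane) :
    hessS x (a - g) = hessS x a - hessS x g := by
  ext α β; simp [hessS]

/-- The characteristic `η^a - (ξ^i - ξ^i(x₀)) u^a_{,i}` along `u`: its derivatives at `x₀` are the
components of the prolongation. -/
noncomputable def prolChar (x : Plane) (ξ η : Fin 2 → SmoothFn Total) (u : Fin 2 → SmoothFn Plane)
    (a : Fin 2) : SmoothFn Plane :=
  compS (η a) u
    - ∑ i, (compS (ξ i) u - algebraMap ℝ _ (evalAt x (compS (ξ i) u))) * pdS i (u a)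

/-- With d of order 3 the quadratic remainders have order 6, and the variation of ξ times a first
derivative of d has order 3 + 2 = 5. So the bilaplacian at x sees only the part linear in d. -/
theorem vanishesTo_prolChar_sub {x : Plane} (ξ η : Fin 2 → SmoothFn Total)
    (u d : Fin 2 → SmoothFn Plane) (hd : ∀ a, VanishesTo x 3 (d a)) (a : Fin 2) :
    VanishesTo x 5 (prolChar x ξ η (u + d) a - prolChar x ξ η u a
      - (∑ b, compS (tdu b (η a)) u * d b
        - ∑ i, ((compS (ξ i) u - algebraMap ℝ _ (evalAt x (compS (ξ i) u))) * pdS i (d a)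
          + pdS i (u a) * ∑ b, compS (tdu b (ξ i)) u * d b))) := by
  have h0 : ∀ i, evalAt x (compS (ξ i) (u + d)) = evalAt x (compS (ξ i) u) := fun i => by
    have := (vanishesTo_compS_sub (ξ i) u d hd).1
    rwa [map_sub, sub_eq_zero] at this
  have e : prolChar x ξ η (u + d) a - prolChar x ξ η u a
      - (∑ b, compS (tdu b (η a)) u * d b
        - ∑ i, ((compS (ξ i) u - algebraMap ℝ _ (evalAt x (compS (ξ i) u))) * pdS i (d a)
          + pdS i (u a) * ∑ b, compS (tdu b (ξ i)) u * d b))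
      = (compS (η a) (u + d) - compS (η a) u - ∑ b, compS (tdu b (η a)) u * d b)
        - ∑ i, (pdS i (u a) * (compS (ξ i) (u + d) - compS (ξ i) u
              - ∑ b, compS (tdu b (ξ i)) u * d b)
            + (compS (ξ i) (u + d) - compS (ξ i) u) * pdS i (d a)) := by
    simp only [prolChar, h0, Fin.sum_univ_two, Pi.add_apply, map_add]; ring
  rw [e]
  exact (vanishesTo_compS_sub_sub (by norm_num) _ u d hd).sub (VanishesTo.sum _ fun i _ =>
    ((vanishesTo_compS_sub_sub (by norm_num) _ u d hd).mul_left _).add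
      ((vanishesTo_compS_sub _ u d hd).mul ((hd a).pdS i) (by norm_num)))

/-! ### Pointwise determining equations and test polynomials -/

/-- The linearized von Kármán equations hold for the prolongation of `(ξ, η)` at each jet over
`(x, u₀)` that satisfies the von Kármán equations. -/
def LinAdmits (D k P₀ K₀ p' k' : ℝ) (ξ η : Fin 2 → SmoothFn Total) (x : Plane)
    (u₀ : Fin 2 → ℝ) : Prop :=
  ∀ u : Fin 2 → SmoothFn Plane, (∀ a, evalAt x (u a) = u₀ a) →
    D * evalAt x (bilapS (u 0)) - bracket (hessS x (u 0)) (hessS x (u 1)) = P₀ →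
    k * evalAt x (bilapS (u 1)) + 1 / 2 * bracket (hessS x (u 0)) (hessS x (u 0)) = K₀ →
    D * evalAt x (bilapS (prolChar x ξ η u 0))
        - bracket (hessS x (prolChar x ξ η u 0)) (hessS x (u 1))
        - bracket (hessS x (u 0)) (hessS x (prolChar x ξ η u 1)) = p' ∧
      k * evalAt x (bilapS (prolChar x ξ η u 1))
        + bracket (hessS x (u 0)) (hessS x (prolChar x ξ η u 0)) = k'

/-- The polynomial with given value, gradient, Hessian and bilaplacian at `x`. -/
noncomputable def polyS (x : Plane) (c : ℝ) (l : Fin 2 → ℝ) (q : Fin 3 → ℝ) (κ : ℝ) :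
    SmoothFn Plane :=
  c • monoS x 0 0 + l 0 • monoS x 1 0 + l 1 • monoS x 0 1 + q 0 • monoS x 2 0 + q 1 • monoS x 1 1
    + q 2 • monoS x 0 2 + κ • monoS x 4 0

section polyS

variable (x : Plane) (c : ℝ) (l : Fin 2 → ℝ) (q : Fin 3 → ℝ) (κ : ℝ)

theorem evalAt_polyS : evalAt x (polyS x c l q κ) = c := by
  simp [polyS]

theorem evalAt_pdS_polyS (i : Fin 2) : evalAt x (pdS i (polyS x c l q κ)) = l i := by
  fin_cases i <;> simp [polyS]

theorem hessS_polyS : hessS x (polyS x c l q κ) = ![![q 0, q 1], ![q 1, q 2]] := by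
  ext i j
  fin_cases i <;> fin_cases j <;> simp [polyS, hessS]

theorem evalAt_pdS_pdS_pdS_polyS (i j k : Fin 2) :
    evalAt x (pdS i (pdS j (pdS k (polyS x c l q κ)))) = 0 := by
  fin_cases i <;> fin_cases j <;> fin_cases k <;> simp [polyS]

theorem evalAt_bilapS_polyS : evalAt x (bilapS (polyS x c l q κ)) = κ := by
  simp [polyS, bilapS_apply]

end polyS

/-! ### Leading determining equations: conformality of ξ -/

section DeterminingEquations

variable {D k P₀ K₀ p' k' : ℝ} {ξ η : Fin 2 → SmoothFn Total} {x : Plane} {u₀ : Fin 2 → ℝ}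

theorem bracket_zero_left (b : Fin 2 → Fin 2 → ℝ) : bracket 0 b = 0 := by simp [bracket]

theorem bracket_zero_right (a : Fin 2 → Fin 2 → ℝ) : bracket a 0 = 0 := by simp [bracket]

theorem VanishesTo.hessS_eq_zero {d : SmoothFn Plane} (hd : VanishesTo x 3 d) : hessS x d = 0 := by
  ext α β
  exact ((hd.pdS β).pdS α).evalAt_eq_zero (by norm_num)

/-- An affine function plus a quartic with prescribed bilaplacian. -/
noncomputable def flatS (x : Plane) (u₀ : Fin 2 → ℝ) (l : Fin 2 → Fin 2 → ℝ) (κ : Fin 2 → ℝ) :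
    Fin 2 → SmoothFn Plane :=
  fun a => polyS x (u₀ a) (l a) 0 (κ a)

theorem hessS_flatS (l : Fin 2 → Fin 2 → ℝ) (κ : Fin 2 → ℝ) (a : Fin 2) :
    hessS x (flatS x u₀ l κ a) = 0 := by
  rw [flatS, hessS_polyS]
  ext i j; fin_cases i <;> fin_cases j <;> rfl

/-- Perturbations of third order do not contribute to the linearized equations. -/
theorem LinAdmits.variation (hD : D ≠ 0) (hk : k ≠ 0)
    (h : LinAdmits D k P₀ K₀ p' k' ξ η x u₀) (l : Fin 2 → Fin 2 → ℝ) {d : Fin 2 → SmoothFn Plane}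
    (hd : ∀ a, VanishesTo x 3 (d a)) (hb : ∀ a, evalAt x (bilapS (d a)) = 0) {u}
    (hu : u = flatS x u₀ l ![P₀ / D, K₀ / k]) (a : Fin 2) :
    evalAt x (bilapS (∑ b, compS (tdu b (η a)) u * d b
        - ∑ i, ((compS (ξ i) u - algebraMap ℝ _ (evalAt x (compS (ξ i) u))) * pdS i (d a)
          + pdS i (u a) * ∑ b, compS (tdu b (ξ i)) u * d b))) = 0 := by
  have v0 : ∀ a, evalAt x (u a) = u₀ a := fun a => by rw [hu, flatS, evalAt_polyS]
  have h0 : ∀ a, hessS x (u a) = 0 := fun a => by rw [hu, hessS_flatS]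
  have b0 : D * evalAt x (bilapS (u 0)) = P₀ := by
    rw [hu, flatS, evalAt_bilapS_polyS]; simp; field_simp
  have b1 : k * evalAt x (bilapS (u 1)) = K₀ := by
    rw [hu, flatS, evalAt_bilapS_polyS]; simp; field_simp
  -- Both u and u + d solve the system at x, with the same right-hand sides of the linearized
  -- equations. All Hessians of u and u + d vanish, so the brackets drop out and only the
  -- bilaplacians of the two characteristics are compared.
  have A := h u v0 (by rw [h0, bracket_zero_left, b0, sub_zero])
    (by rw [h0, bracket_zero_left, b1, mul_zero, add_zero])
  have hd0 : ∀ a, evalAt x (d a) = 0 := fun a => (hd a).1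
  have B := h (u + d) (fun a => by rw [Pi.add_apply, map_add, hd0, v0, add_zero])
    (by simp only [Pi.add_apply, hessS_add, h0, (hd _).hessS_eq_zero, add_zero, bracket_zero_left,
          map_add, hb, b0, sub_zero])
    (by simp only [Pi.add_apply, hessS_add, h0, (hd _).hessS_eq_zero, add_zero, bracket_zero_left,
          map_add, hb, b1, mul_zero])
  simp only [Pi.add_apply, hessS_add, h0, (hd _).hessS_eq_zero, add_zero, bracket_zero_left,
    bracket_zero_right, sub_zero] at A B
  have V := (vanishesTo_prolChar_sub ξ η u d hd a).evalAt_bilapS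
  rw [map_sub, map_sub, sub_eq_zero] at V
  rw [← V, map_sub, map_sub, sub_eq_zero]
  fin_cases a
  · exact mul_left_cancel₀ hD (B.1.trans A.1.symm)
  · exact mul_left_cancel₀ hk (B.2.trans A.2.symm)

theorem evalAt_bilapS_mul_of_vanishesTo {d : SmoothFn Plane} (hd : VanishesTo x 3 d)
    (hb : evalAt x (bilapS d) = 0) (a : SmoothFn Plane) :
    evalAt x (bilapS (a * d)) = 4 *
      (evalAt x (pdS 0 a) * (evalAt x (pdS 0 (pdS 0 (pdS 0 d)))
          + evalAt x (pdS 0 (pdS 1 (pdS 1 d))))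
        + evalAt x (pdS 1 a) * (evalAt x (pdS 0 (pdS 0 (pdS 1 d)))
          + evalAt x (pdS 1 (pdS 1 (pdS 1 d))))) := by
  have h1 : ∀ i, evalAt x (pdS i d) = 0 := fun i => (hd.2 i).1
  have h2 : ∀ i j, evalAt x (pdS i (pdS j d)) = 0 := fun i j => ((hd.2 j).2 i).1
  rw [evalAt_bilapS_mul, hb, hd.1, h1, h1, h2, h2, h2]
  ring

theorem evalAt_bilapS_mul_pdS_of_vanishesTo {d : SmoothFn Plane} (hd : VanishesTo x 3 d)
    {a : SmoothFn Plane} (ha : evalAt x a = 0) (i : Fin 2) :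
    evalAt x (bilapS (a * pdS i d))
      = 4 * (evalAt x (pdS 0 a)
            * (evalAt x (pdS 0 (pdS 0 (pdS 0 (pdS i d))))
              + evalAt x (pdS 0 (pdS 1 (pdS 1 (pdS i d)))))
          + evalAt x (pdS 1 a)
            * (evalAt x (pdS 0 (pdS 0 (pdS 1 (pdS i d))))
              + evalAt x (pdS 1 (pdS 1 (pdS 1 (pdS i d))))))
        + 2 * (hessS x a 0 0 + hessS x a 1 1)
          * (hessS x (pdS i d) 0 0 + hessS x (pdS i d) 1 1)
        + 4 * (hessS x a 0 0 * hessS x (pdS i d) 0 0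
          + 2 * (hessS x a 0 1 * hessS x (pdS i d) 0 1)
          + hessS x a 1 1 * hessS x (pdS i d) 1 1) := by
  have h1 : ∀ i, evalAt x (pdS i d) = 0 := fun i => (hd.2 i).1
  have h2 : ∀ i j, evalAt x (pdS i (pdS j d)) = 0 := fun i j => ((hd.2 j).2 i).1
  rw [evalAt_bilapS_mul, ha, h1, h2, h2]
  simp only [hessS]
  ring

/-- The terms of the variation with derivatives of `ξ` along the independent and the dependent
variables, separated. -/
theorem LinAdmits.variation_mul (hD : D ≠ 0) (hk : k ≠ 0)
    (h : LinAdmits D k P₀ K₀ p' k' ξ η x u₀) (l : Fin 2 → Fin 2 → ℝ) {d : Fin 2 → SmoothFn Plane}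
    (hd : ∀ a, VanishesTo x 3 (d a)) (hb : ∀ a, evalAt x (bilapS (d a)) = 0) {u}
    (hu : u = flatS x u₀ l ![P₀ / D, K₀ / k]) (a : Fin 2) :
    ∑ b, evalAt x (bilapS ((compS (tdu b (η a)) u
          - ∑ i, pdS i (u a) * compS (tdu b (ξ i)) u) * d b))
      = ∑ i, evalAt x (bilapS ((compS (ξ i) u - algebraMap ℝ _ (evalAt x (compS (ξ i) u)))
          * pdS i (d a))) := by
  rw [← map_sum, ← map_sum, ← map_sum, ← map_sum, ← sub_eq_zero, ← map_sub, ← map_sub,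
    ← h.variation hD hk l hd hb hu a]
  congr 2
  simp only [Fin.sum_univ_two]
  ring

/-- For a perturbation g of order 4 with Δ²g = 0 at x, the only surviving terms are D_jξ^i ∂_i∂_jΔg:
all others carry Δ²g itself or derivatives of g of order at most three. Since ∂_i∂_jΔg is an
arbitrary trace-free symmetric matrix, the symmetric part of D_jξ^i is a multiple of the identity.
-/
theorem LinAdmits.conformal (hD : D ≠ 0) (hk : k ≠ 0)
    (h : LinAdmits D k P₀ K₀ p' k' ξ η x u₀) (l : Fin 2 → Fin 2 → ℝ) {u}
    (hu : u = flatS x u₀ l ![P₀ / D, K₀ / k]) :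
    evalAt x (pdS 0 (compS (ξ 0) u)) = evalAt x (pdS 1 (compS (ξ 1) u)) ∧
      evalAt x (pdS 1 (compS (ξ 0) u)) = -evalAt x (pdS 0 (compS (ξ 1) u)) := by
  have key : ∀ g : SmoothFn Plane, VanishesTo x 4 g → evalAt x (bilapS g) = 0 →
      ∑ i, (evalAt x (pdS 0 (compS (ξ i) u))
            * (evalAt x (pdS 0 (pdS 0 (pdS 0 (pdS i g))))
              + evalAt x (pdS 0 (pdS 1 (pdS 1 (pdS i g)))))
          + evalAt x (pdS 1 (compS (ξ i) u))
            * (evalAt x (pdS 0 (pdS 0 (pdS 1 (pdS i g))))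
              + evalAt x (pdS 1 (pdS 1 (pdS 1 (pdS i g)))))) = 0 := by
    intro g hg hb
    have hg3 := hg.of_le (show 3 ≤ 4 by norm_num)
    have hd : ∀ a, VanishesTo x 3 (![g, 0] a) := by
      intro a; fin_cases a; exacts [hg3, VanishesTo.zero]
    have hb' : ∀ a, evalAt x (bilapS (![g, 0] a)) = 0 := by
      intro a; fin_cases a; exacts [hb, by simp]
    have A := h.variation_mul hD hk l hd hb' hu 0
    have h3 : ∀ i j m, evalAt x (pdS i (pdS j (pdS m g))) = 0 := fun i j m =>
      (((hg.2 m).2 j).2 i).1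
    have hX : ∀ i, evalAt x (compS (ξ i) u - algebraMap ℝ _ (evalAt x (compS (ξ i) u))) = 0 :=
      fun i => by rw [map_sub, AlgHom.commutes]; exact sub_self _
    simp only [evalAt_bilapS_mul_of_vanishesTo (hd _) (hb' _), evalAt_bilapS_mul_pdS_of_vanishesTo (hd _) (hX _)] at A
    simp only [Fin.sum_univ_two, Matrix.cons_val_zero, Matrix.cons_val_one, h3, map_zero, hessS,
      map_sub, dirDeriv_algebraMap, sub_zero] at A
    simp only [Fin.sum_univ_two]
    linarith
  constructor
  -- Here the matrix ∂_i∂_jΔg is diag(1, -1); for the other test function it is purely off-diagonal.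
  · have A := key (monoS x 4 0 - monoS x 0 4) (by simp [VanishesTo]) (by simp [bilapS_apply])
    simp [Fin.sum_univ_two] at A
    linarith
  · have A := key (monoS x 3 1 + monoS x 1 3) (by simp [VanishesTo]) (by simp [bilapS_apply])
    simp [Fin.sum_univ_two] at A
    linarith

/-- The components `ξ` do not depend on the dependent variables and satisfy the Cauchy-Riemann
equations at `z`. -/
structure ConformalAt (ξ : Fin 2 → SmoothFn Total) (z : Total) : Prop where
  tdu : ∀ i b, evalAt z (tdu b (ξ i)) = 0
  diag : evalAt z (tdx 0 (ξ 0)) = evalAt z (tdx 1 (ξ 1))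
  skew : evalAt z (tdx 1 (ξ 0)) = -evalAt z (tdx 0 (ξ 1))

/-- The total derivatives in `LinAdmits.conformal` are affine in the gradient `l`, which is free.
Comparing `l = 0` with gradients having a single unit entry isolates the u-derivatives one by one,
since each such entry affects only one side of each relation. -/
theorem LinAdmits.conformalAt (hD : D ≠ 0) (hk : k ≠ 0)
    (h : LinAdmits D k P₀ K₀ p' k' ξ η x u₀) : ConformalAt ξ (x, u₀) := by
  have key := fun l => h.conformal hD hk l rfl
  have e0 : ∀ l a, evalAt x (flatS x u₀ l ![P₀ / D, K₀ / k] a) = u₀ a := fun l a => by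
    rw [flatS, evalAt_polyS]
  have e1 : ∀ l a i, evalAt x (pdS i (flatS x u₀ l ![P₀ / D, K₀ / k] a)) = l a i := fun l a i => by
    rw [flatS, evalAt_pdS_polyS]
  simp only [pdS_compS, map_add, map_mul, evalAt_compS, e0, e1, Fin.sum_univ_two] at key
  have k0 := key 0
  have k1 := fun b => key (Pi.single b ![1, 0])
  have k2 := fun b => key (Pi.single b ![0, 1])
  simp only [Pi.zero_apply, mul_zero, add_zero] at k0
  refine ⟨fun i b => ?_, k0.1, k0.2⟩
  have k1 := k1 b
  have k2 := k2 b
  fin_cases b <;> simp at k1 k2 <;> fin_cases i <;> simp <;> linarith [k0.1, k0.2]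

end DeterminingEquations

theorem eventually_evalAt_dirDeriv_congr {V : Type*} [NormedAddCommGroup V] [NormedSpace ℝ V]
    {g k : SmoothFn V} {z : V} (h : ∀ᶠ y in 𝓝 z, evalAt y g = evalAt y k) (e : V) :
    ∀ᶠ y in 𝓝 z, evalAt y (dirDeriv e g) = evalAt y (dirDeriv e k) :=
  evalAt_dirDeriv_congr h e

/-! ### Next order: η is affine in the dependent variables -/

section DeterminingEquations

variable {D k P₀ K₀ p' k' : ℝ} {ξ η : Fin 2 → SmoothFn Total} {x : Plane} {u₀ : Fin 2 → ℝ}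

/-- The relations satisfied at `z` by the second derivatives of the components of a vector field
that fulfils the Cauchy-Riemann equations near `z`. -/
structure ConformalNear (ξ : Fin 2 → SmoothFn Total) (z : Total) : Prop where
  tdu : ∀ i b, evalAt z (tdu b (ξ i)) = 0
  tdx_tdu : ∀ i b j, evalAt z (tdx j (Marguerre.tdu b (ξ i))) = 0
  tdu_tdu : ∀ i b c, evalAt z (Marguerre.tdu c (Marguerre.tdu b (ξ i))) = 0
  laplace : ∀ i, evalAt z (tdx 0 (tdx 0 (ξ i))) + evalAt z (tdx 1 (tdx 1 (ξ i))) = 0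
  diag : evalAt z (tdx 0 (ξ 0)) = evalAt z (tdx 1 (ξ 1))
  skew : evalAt z (tdx 1 (ξ 0)) = -evalAt z (tdx 0 (ξ 1))
  tdx_diag : ∀ i, evalAt z (tdx i (tdx 0 (ξ 0))) = evalAt z (tdx i (tdx 1 (ξ 1)))
  tdx_skew : ∀ i, evalAt z (tdx i (tdx 1 (ξ 0))) = -evalAt z (tdx i (tdx 0 (ξ 1)))

/-- Identities valid on a neighbourhood may be differentiated; harmonicity follows from the
Cauchy-Riemann equations and the symmetry of second derivatives. -/
theorem conformalNear {z : Total} (h : ∀ᶠ y in 𝓝 z, ConformalAt ξ y) : ConformalNear ξ z := by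
  have h0 : ∀ i b, ∀ᶠ y in 𝓝 z, evalAt y (tdu b (ξ i)) = evalAt y 0 := fun i b =>
    h.mono fun y hy => by rw [hy.tdu, map_zero]
  have hd : ∀ᶠ y in 𝓝 z, evalAt y (tdx 0 (ξ 0)) = evalAt y (tdx 1 (ξ 1)) :=
    h.mono fun y hy => hy.diag
  have hs : ∀ᶠ y in 𝓝 z, evalAt y (tdx 1 (ξ 0)) = evalAt y (-tdx 0 (ξ 1)) :=
    h.mono fun y hy => by rw [hy.skew, map_neg]
  have hd' := fun i => (eventually_evalAt_dirDeriv_congr hd ((Pi.single i 1, 0) : Total)).self_of_nhds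
  have hs' := fun i => (eventually_evalAt_dirDeriv_congr hs ((Pi.single i 1, 0) : Total)).self_of_nhds
  simp only [map_neg] at hs'
  have hc : ∀ i, tdx 1 (tdx 0 (ξ i)) = tdx 0 (tdx 1 (ξ i)) := fun i => dirDeriv_comm _ _ _
  refine ⟨h.self_of_nhds.tdu, fun i b j => ?_, fun i b c => ?_, fun i => ?_, h.self_of_nhds.diag,
    h.self_of_nhds.skew, hd', hs'⟩
  · rw [(eventually_evalAt_dirDeriv_congr (h0 i b) _).self_of_nhds, map_zero, map_zero]
  · rw [(eventually_evalAt_dirDeriv_congr (h0 i b) _).self_of_nhds, map_zero, map_zero]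
  · fin_cases i
    · have := hd' 0; have := hs' 1; rw [hc] at this; simp; linarith
    · have := hd' 1; have := hs' 0; rw [hc] at *; simp; linarith

theorem hessS_compS_of_conformalNear {u : Fin 2 → SmoothFn Plane} (hu : ∀ a, evalAt x (u a) = u₀ a)
    (h : ConformalNear ξ (x, u₀)) (i j m : Fin 2) :
    hessS x (compS (ξ i) u) j m = evalAt ((x, u₀) : Total) (tdx j (tdx m (ξ i))) := by
  have hc : ∀ b, tdu b (tdx m (ξ i)) = tdx m (tdu b (ξ i)) := fun b => dirDeriv_comm _ _ _
  simp only [hessS, pdS_compS, map_add, Fin.sum_univ_two, Derivation.leibniz, smul_eq_mul, map_mul,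
    evalAt_compS, hu, hc, h.tdu, h.tdx_tdu, h.tdu_tdu]
  ring

/-- The components `η` are affine in the dependent variables, with coefficients determined up to
constants by `ξ`. -/
structure QuasilinearAt (ξ η : Fin 2 → SmoothFn Total) (z : Total) : Prop where
  tdu_tdu : ∀ a b c, evalAt z (tdu c (tdu b (η a))) = 0
  tdx_tdu : ∀ a b i, evalAt z (tdx i (tdu b (η a)))
    = if a = b then evalAt z (tdx i (tdx 0 (ξ 0))) else 0

/-- A cubic perturbation of u^b gives 4 D_i(∂η^a/∂u^b) on one side and, for a = b, 4 ∂_i∂_iξ^i (no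
sum) on the other, the Laplacian of ξ being zero. The Cauchy-Riemann equations turn the latter into
4 ∂_i∂_0ξ^0. The relation is affine in the free gradient, whose coefficients are the second
u-derivatives of η. -/
theorem LinAdmits.quasilinearAt (hD : D ≠ 0) (hk : k ≠ 0)
    (h : LinAdmits D k P₀ K₀ p' k' ξ η x u₀) (hξ : ConformalNear ξ (x, u₀)) :
    QuasilinearAt ξ η (x, u₀) := by
  have e0 : ∀ l a, evalAt x (flatS x u₀ l ![P₀ / D, K₀ / k] a) = u₀ a := fun l a => by
    rw [flatS, evalAt_polyS]
  have e1 : ∀ l a i, evalAt x (pdS i (flatS x u₀ l ![P₀ / D, K₀ / k] a)) = l a i := fun l a i => by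
    rw [flatS, evalAt_pdS_polyS]
  have key : ∀ (l : Fin 2 → Fin 2 → ℝ) (a b i : Fin 2), evalAt ((x, u₀) : Total) (tdx i (tdu b (η a)))
      + ∑ c, evalAt ((x, u₀) : Total) (tdu c (tdu b (η a))) * l c i
      = if a = b then evalAt ((x, u₀) : Total) (tdx i (tdx 0 (ξ 0))) else 0 := by
    intro l a b i
    -- The normalized cubic in x^i alone: ∇Δg is the i-th unit vector, which picks out D_i.
    obtain ⟨g, hg3, hgb, hg⟩ : ∃ g, VanishesTo x 3 g ∧ evalAt x (bilapS g) = 0 ∧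
        g = if i = 0 then monoS x 3 0 else monoS x 0 3 := by
      refine ⟨_, ?_, ?_, rfl⟩ <;> fin_cases i <;> simp [VanishesTo, bilapS_apply]
    have hd : ∀ a, VanishesTo x 3 ((Pi.single b g : Fin 2 → SmoothFn Plane) a) := by
      intro a
      by_cases hab : a = b
      · subst hab; simpa using hg3
      · simpa [hab] using VanishesTo.zero
    have hb' : ∀ a, evalAt x (bilapS ((Pi.single b g : Fin 2 → SmoothFn Plane) a)) = 0 := by
      intro a
      by_cases hab : a = b
      · subst hab; simpa using hgb
      · simp [hab]
    obtain ⟨u, hu⟩ : ∃ u, u = flatS x u₀ l ![P₀ / D, K₀ / k] := ⟨_, rfl⟩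
    have A := h.variation_mul hD hk l hd hb' hu a
    have e0 : ∀ a, evalAt x (u a) = u₀ a := by rw [hu]; exact e0 l
    have e1 : ∀ a i, evalAt x (pdS i (u a)) = l a i := by rw [hu]; exact e1 l
    have hX : ∀ i, evalAt x (compS (ξ i) u - algebraMap ℝ _ (evalAt x (compS (ξ i) u))) = 0 :=
      fun i => by rw [map_sub, AlgHom.commutes]; exact sub_self _
    have hXh : ∀ i, hessS x (compS (ξ i) u - algebraMap ℝ _ (evalAt x (compS (ξ i) u)))
        = hessS x (compS (ξ i) u) := by
      intro i; rw [hessS_sub, sub_eq_self]; ext; simp [hessS]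
    simp only [evalAt_bilapS_mul_of_vanishesTo (hd _) (hb' _),
      evalAt_bilapS_mul_pdS_of_vanishesTo (hd _) (hX _), hXh, hessS_compS_of_conformalNear e0 hξ] at A
    simp only [Fin.sum_univ_two, map_sub, map_add, Derivation.leibniz, pdS_compS, map_mul,
      evalAt_compS, smul_eq_mul, e0, e1, hξ.tdu, hξ.tdx_tdu, hξ.tdu_tdu] at A
    have L0 := hξ.laplace 0
    have L1 := hξ.laplace 1
    have M1 := hξ.tdx_diag 1
    subst hg
    simp only [Fin.sum_univ_two]
    fin_cases i <;> fin_cases b <;> fin_cases a <;>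
      simp [hessS] at A ⊢ <;> linarith
  have k0 := key 0
  simp only [Pi.zero_apply, mul_zero, Finset.sum_const_zero, add_zero] at k0
  refine ⟨fun a b c => ?_, k0⟩
  have := key (Pi.single c ![1, 0]) a b 0
  rw [← k0, add_eq_left, Fin.sum_univ_two] at this
  fin_cases c <;> simpa using this

end DeterminingEquations

/-! ### Normal form of a quasilinear field -/

theorem hasFDerivAt_comp_prodMk (G : SmoothFn Total) (x : Plane) (w : Fin 2 → ℝ) :
    HasFDerivAt (fun w : Fin 2 → ℝ => evalAt ((x, w) : Total) G)
      ((fderiv ℝ (G : Total → ℝ) (x, w)).comp (ContinuousLinearMap.inr ℝ Plane (Fin 2 → ℝ))) w :=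
  (differentiable_coe G _).hasFDerivAt.comp w (hasFDerivAt_prodMk_right x w)

theorem fderiv_comp_inr_eq_zero {G : SmoothFn Total} {z : Total}
    (h : ∀ b, evalAt z (tdu b G) = 0) :
    (fderiv ℝ (G : Total → ℝ) z).comp (ContinuousLinearMap.inr ℝ Plane (Fin 2 → ℝ)) = 0 := by
  ext w
  have e : ((0, w) : Total) = w 0 • ((0, Pi.single 0 1) : Total)
      + w 1 • ((0, Pi.single 1 1) : Total) := by
    refine Prod.ext (by simp) ?_
    ext a; fin_cases a <;> simp
  have h0 : fderiv ℝ (G : Total → ℝ) z (0, Pi.single 0 1) = 0 := h 0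
  have h1 : fderiv ℝ (G : Total → ℝ) z (0, Pi.single 1 1) = 0 := h 1
  rw [ContinuousLinearMap.comp_apply, ContinuousLinearMap.inr_apply, e, map_add, map_smul, map_smul,
    h0, h1]
  simp

/-- In the sup norm a ball is a product, so its slice over a fixed x is convex and the mean value
theorem applies along the fibre. -/
theorem eventually_eq_of_tdu_eq_zero {G : SmoothFn Total} {x : Plane} {u₀ : Fin 2 → ℝ}
    (h : ∀ᶠ z in 𝓝 ((x, u₀) : Total), ∀ b, evalAt z (tdu b G) = 0) :
    ∀ᶠ z in 𝓝 ((x, u₀) : Total), evalAt z G = evalAt ((z.1, u₀) : Total) G := by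
  obtain ⟨r, hr, hB⟩ := Metric.eventually_nhds_iff_ball.1 h
  filter_upwards [Metric.ball_mem_nhds _ hr] with z hz
  have hz' : z.1 ∈ Metric.ball x r ∧ z.2 ∈ Metric.ball u₀ r := by
    rw [← ball_prod_same] at hz; exact hz
  refine (convex_ball u₀ r).is_const_of_fderivWithin_eq_zero (𝕜 := ℝ)
    (f := fun w : Fin 2 → ℝ => evalAt ((z.1, w) : Total) G)
    (fun w _ => (hasFDerivAt_comp_prodMk G z.1 w).differentiableAt.differentiableWithinAt)
    (fun w hw => by
      rw [fderivWithin_of_isOpen Metric.isOpen_ball hw, (hasFDerivAt_comp_prodMk G z.1 w).fderiv]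
      exact fderiv_comp_inr_eq_zero (hB _ (by rw [← ball_prod_same]; exact ⟨hz'.1, hw⟩))) hz'.2
    (Metric.mem_ball_self hr)

/-- The restriction of a function of `(x, u)` to the plane `u = u₀`. -/
noncomputable def sliceS (u₀ : Fin 2 → ℝ) (G : SmoothFn Total) : SmoothFn Plane :=
  compS G fun a => algebraMap ℝ _ (u₀ a)

theorem pdS_sliceS (u₀ : Fin 2 → ℝ) (i : Fin 2) (G : SmoothFn Total) :
    pdS i (sliceS u₀ G) = sliceS u₀ (tdx i G) := by
  simp only [sliceS, pdS_compS, dirDeriv_algebraMap, mul_zero, Finset.sum_const_zero, add_zero]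

theorem evalAt_sliceS (u₀ : Fin 2 → ℝ) (x : Plane) (G : SmoothFn Total) :
    evalAt x (sliceS u₀ G) = evalAt ((x, u₀) : Total) G := rfl

/-- The function `(x, u) ↦ g x`. -/
noncomputable def liftS (g : SmoothFn Plane) : SmoothFn Total :=
  ⟨fun z => (g : Plane → ℝ) z.1,
    show ContDiff ℝ ∞ _ from (contDiff_coe g).comp contDiff_fst⟩

theorem tdu_liftS (g : SmoothFn Plane) (b : Fin 2) : tdu b (liftS g) = 0 := by
  ext z
  have : HasFDerivAt (liftS g : Total → ℝ) _ z :=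
    (differentiable_coe g z.1).hasFDerivAt.comp z hasFDerivAt_fst
  rw [dirDeriv_apply, this.fderiv]; simp

/-- The function `(x, u) ↦ u^b - u₀^b`. -/
noncomputable def fibreCoordS (u₀ : Fin 2 → ℝ) (b : Fin 2) : SmoothFn Total :=
  ⟨fun z => z.2 b - u₀ b, by change ContDiff ℝ ∞ _; fun_prop⟩

theorem tdu_fibreCoordS (u₀ : Fin 2 → ℝ) (b c : Fin 2) :
    tdu c (fibreCoordS u₀ b) = if c = b then 1 else 0 := by
  ext z
  have : HasFDerivAt (fibreCoordS u₀ b : Total → ℝ)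
      ((ContinuousLinearMap.proj b).comp (ContinuousLinearMap.snd ℝ Plane (Fin 2 → ℝ))) z :=
    (((ContinuousLinearMap.proj (R := ℝ) (φ := fun _ : Fin 2 => ℝ) b).comp
      (ContinuousLinearMap.snd ℝ Plane (Fin 2 → ℝ))).hasFDerivAt (x := z)).sub_const (u₀ b)
  rw [dirDeriv_apply, this.fderiv]
  by_cases h : c = b
  · subst h; simp
  · simp [h, Ne.symm h]

/-- The first u-derivatives depend on x only. Subtracting the affine function they define leaves a
function without u-derivatives, and the previous fact applies again. -/
theorem eventually_eq_of_tdu_tdu_eq_zero {G : SmoothFn Total} {x : Plane} {u₀ : Fin 2 → ℝ}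
    (h : ∀ᶠ z in 𝓝 ((x, u₀) : Total), ∀ b c, evalAt z (tdu c (tdu b G)) = 0) :
    ∀ᶠ z in 𝓝 ((x, u₀) : Total), evalAt z G = evalAt z.1 (sliceS u₀ G)
      + ∑ b, evalAt z.1 (sliceS u₀ (tdu b G)) * (z.2 b - u₀ b) := by
  have h1 : ∀ᶠ z in 𝓝 ((x, u₀) : Total), ∀ b, evalAt z (tdu b G) = evalAt ((z.1, u₀) : Total) (tdu b G) :=
    eventually_all.2 fun b => eventually_eq_of_tdu_eq_zero (h.mono fun z hz => hz b)
  have h2 : ∀ᶠ z in 𝓝 ((x, u₀) : Total), ∀ c, evalAt z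
      (tdu c (G - ∑ b, liftS (sliceS u₀ (tdu b G)) * fibreCoordS u₀ b)) = 0 := by
    filter_upwards [h1] with z hz c
    rw [map_sub, map_sub, hz, map_sum]
    simp only [Derivation.leibniz, tdu_liftS, tdu_fibreCoordS, add_zero, smul_eq_mul,
      mul_ite, mul_one, mul_zero, Finset.sum_ite_eq, Finset.mem_univ, if_true]
    exact sub_self _
  filter_upwards [eventually_eq_of_tdu_eq_zero h2] with z hz
  simp only [map_sub, map_sum, map_mul] at hz
  have e : ∀ b, evalAt ((z.1, u₀) : Total) (fibreCoordS u₀ b) = 0 := fun b => sub_self _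
  simp only [e, mul_zero, Finset.sum_const_zero, sub_zero] at hz
  exact sub_eq_iff_eq_add.1 hz

/-- The characteristic of a quasilinear field, with coefficients depending on `x` only. -/
noncomputable def normalChar (x : Plane) (u₀ : Fin 2 → ℝ) (ξ η : Fin 2 → SmoothFn Total)
    (v : Fin 2 → SmoothFn Plane) (a : Fin 2) : SmoothFn Plane :=
  sliceS u₀ (η a) + ∑ b, sliceS u₀ (tdu b (η a)) * v b
    - ∑ i, (sliceS u₀ (ξ i) - algebraMap ℝ _ (evalAt ((x, u₀) : Total) (ξ i))) * pdS i (v a)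

/-- Near the base point the graph of u stays where ξ is constant and η affine along the fibres, so
their coefficients may be frozen at u₀. An identity of germs is needed because it will be
differentiated four times. -/
theorem prolChar_eventuallyEq {x : Plane} {u₀ : Fin 2 → ℝ} {ξ η : Fin 2 → SmoothFn Total}
    (hξ : ∀ᶠ z in 𝓝 ((x, u₀) : Total), ConformalAt ξ z)
    (hη : ∀ᶠ z in 𝓝 ((x, u₀) : Total), QuasilinearAt ξ η z)
    {v : Fin 2 → SmoothFn Plane} (hv : ∀ a, evalAt x (v a) = 0) (a : Fin 2) :
    ∀ᶠ y in 𝓝 x, evalAt y (prolChar x ξ η (fun a => v a + algebraMap ℝ _ (u₀ a)) a)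
      = evalAt y (normalChar x u₀ ξ η v a) := by
  set u : Fin 2 → SmoothFn Plane := fun a => v a + algebraMap ℝ _ (u₀ a) with hu
  have hval : ∀ y a, evalAt y (u a) = evalAt y (v a) + u₀ a := fun y a => by
    rw [hu, map_add, AlgHom.commutes]; rfl
  have hT : Tendsto (fun y : Plane => ((y, fun a => evalAt y (u a)) : Total)) (𝓝 x) (𝓝 (x, u₀)) := by
    have hc : Continuous (fun y : Plane => ((y, fun a => evalAt y (u a)) : Total)) :=
      continuous_id.prodMk (continuous_pi fun a => (contDiff_coe (u a)).continuous)
    have := hc.tendsto x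
    simpa only [hval, hv, zero_add] using this
  have e1 := hT.eventually (eventually_all.2 fun i =>
    eventually_eq_of_tdu_eq_zero (hξ.mono fun z hz => hz.tdu i))
  have e2 := hT.eventually (eventually_eq_of_tdu_tdu_eq_zero (hη.mono fun z hz => hz.tdu_tdu a))
  filter_upwards [e1, e2] with y h1 h2
  have hx : ∀ i, evalAt x (compS (ξ i) u) = evalAt ((x, u₀) : Total) (ξ i) := fun i => by
    rw [evalAt_compS]; simp only [hval, hv, zero_add]
  have hp : ∀ i, pdS i (u a) = pdS i (v a) := fun i => by
    rw [hu, map_add, dirDeriv_algebraMap, add_zero]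
  simp only [prolChar, normalChar, map_add, map_sub, map_sum, map_mul, hx, hp, AlgHom.commutes,
    evalAt_compS, h1, h2, evalAt_sliceS]
  simp only [hval, add_sub_cancel_right]

theorem evalAt_bilapS_congr {g k : SmoothFn Plane} {x : Plane}
    (h : ∀ᶠ y in 𝓝 x, evalAt y g = evalAt y k) : evalAt x (bilapS g) = evalAt x (bilapS k) := by
  have h4 : ∀ i j l m, evalAt x (pdS i (pdS j (pdS l (pdS m g))))
      = evalAt x (pdS i (pdS j (pdS l (pdS m k)))) := fun i j l m =>
    (eventually_evalAt_dirDeriv_congr (eventually_evalAt_dirDeriv_congr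
      (eventually_evalAt_dirDeriv_congr (eventually_evalAt_dirDeriv_congr h _) _) _) _).self_of_nhds
  simp only [bilapS_apply, map_add, map_smul, h4]

theorem hessS_congr {g k : SmoothFn Plane} {x : Plane}
    (h : ∀ᶠ y in 𝓝 x, evalAt y g = evalAt y k) : hessS x g = hessS x k := by
  ext i j
  exact (eventually_evalAt_dirDeriv_congr (eventually_evalAt_dirDeriv_congr h _) _).self_of_nhds

/-! ### Remaining determining equations: the field is affine -/

/-- The Hessian with entries `q 0, q 1, q 2`. -/
def symMat (q : Fin 3 → ℝ) : Fin 2 → Fin 2 → ℝ := ![![q 0, q 1], ![q 1, q 2]]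

set_option maxHeartbeats 800000 in
/-- The linear algebra of the determining equations at a point for a quasilinear conformal field:
`G`, `T` are the first and second derivatives of `ξ`, `M` the derivatives of `η` with respect to
the dependent variables, and `s`, `S` and `A` the remaining first and second derivatives. -/
theorem eq_zero_of_determining {D k P₀ K₀ p' k' : ℝ} (hD : D ≠ 0) (hk : k ≠ 0)
    {A : Fin 2 → Fin 2 → Fin 2 → ℝ} {M S G : Fin 2 → Fin 2 → ℝ} {s B : Fin 2 → ℝ}
    {T : Fin 2 → Fin 2 → Fin 2 → ℝ} (hA : ∀ a, A a 1 0 = A a 0 1)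
    (hG : G 0 0 = G 1 1) (hG' : G 0 1 = -G 1 0)
    (hT0 : T 0 0 0 = s 0) (hT1 : T 1 1 1 = s 1)
    (h : ∀ (l : Fin 2 → Fin 2 → ℝ) (q : Fin 2 → Fin 3 → ℝ) (κ : Fin 2 → ℝ),
      D * κ 0 - bracket (symMat (q 0)) (symMat (q 1)) = P₀ →
      k * κ 1 + 1 / 2 * bracket (symMat (q 0)) (symMat (q 0)) = K₀ →
      ∀ (zb : Fin 2 → ℝ) (zh : Fin 2 → Fin 2 → Fin 2 → ℝ),
      (∀ a, zb a = B a + ∑ b, M a b * κ b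
        + 4 * (S 0 0 * q a 0 + 2 * (S 0 1 * q a 1) + S 1 1 * q a 2) - 4 * (G 0 0 * κ a)) →
      (∀ a i j, zh a i j = A a i j + ∑ b, M a b * symMat (q b) i j + s i * l a j + s j * l a i
        - ∑ m, (T m i j * l a m + G m i * symMat (q a) j m + G m j * symMat (q a) i m)) →
      D * zb 0 - bracket (zh 0) (symMat (q 1)) - bracket (symMat (q 0)) (zh 1) = p' ∧
        k * zb 1 + bracket (symMat (q 0)) (zh 0) = k') :
    s = 0 ∧ M = 0 ∧ A = 0 := by
  have hDk : D * (P₀ / D) = P₀ := by field_simp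
  have hkk : k * (K₀ / k) = K₀ := by field_simp
  have hDk' : D * ((P₀ + 1) / D) = P₀ + 1 := by field_simp
  have hkk' : k * ((K₀ + 1) / k) = K₀ + 1 := by field_simp
  -- Jets with vanishing Hessian of w. The Hessian of Φ pairs with the second derivatives of the
  -- first characteristic and isolates `A 0`, `M 0 1` and, through the gradient of w, `s`; the
  -- second equation isolates `S`.
  have I0 := fun (q : Fin 3 → ℝ) (l : Fin 2 → ℝ) => h ![l, 0] ![0, q] ![P₀ / D, K₀ / k]
    (by simp [bracket_eq, symMat, hDk]) (by simp [bracket_eq, symMat, hkk]) _ _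
    (fun _ => rfl) (fun _ _ _ => rfl)
  have J0 := I0 0 0
  have J1 := I0 ![0, 0, 1] 0
  have J2 := I0 ![1, 0, 0] 0
  have J3 := I0 ![0, 1, 0] 0
  have J4 := I0 ![0, -1, 0] 0
  have J5 := I0 ![0, 0, 1] ![1, 0]
  have J6 := I0 ![1, 0, 0] ![0, 1]
  clear I0
  -- A degenerate Hessian of w, with that of Φ zero, leaves both bilaplacians unchanged; it yields
  -- the diagonal entries of `A 1`.
  have I1 := fun (q : Fin 3 → ℝ) (hq : q 0 * q 2 = q 1 * q 1) =>
    h 0 ![q, 0] ![P₀ / D, K₀ / k] (by simp [bracket_eq, symMat, hDk])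
      (by simp [bracket_eq, symMat, hkk]; linarith) _ _ (fun _ => rfl) (fun _ _ _ => rfl)
  have J7 := I1 ![0, 0, 1] (by simp)
  have J8 := I1 ![1, 0, 0] (by simp)
  clear I1
  -- The Hessian of w now has determinant -1, compensated by the bilaplacian of Φ. The two signs
  -- separate `A 1 0 1` from `M 1 0`.
  have I2 := fun (c : ℝ) (hc : c * c = 1) =>
    h 0 ![![0, c, 0], 0] ![P₀ / D, (K₀ + 1) / k] (by simp [bracket_eq, symMat, hDk])
      (by simp [bracket_eq, symMat, hkk']; linarith) _ _ (fun _ => rfl) (fun _ _ _ => rfl)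
  have J9 := I2 1 (by norm_num)
  have J10 := I2 (-1) (by norm_num)
  clear I2
  -- The mixed bracket is 1 while that of w with itself is 0: only the first equation needs
  -- compensation.
  have J11 := h 0 ![![1, 0, 0], ![0, 0, 1]] ![(P₀ + 1) / D, K₀ / k]
    (by simp [bracket_eq, symMat, hDk']) (by simp [bracket_eq, symMat, hkk]) _ _
    (fun _ => rfl) (fun _ _ _ => rfl)
  clear h
  simp [bracket_eq, symMat, Fin.sum_univ_two, hA, hG', hT0, hT1] at J0 J1 J2 J3 J4 J5 J6 J7 J8 J9 J10 J11
  have hs0 : s 0 = 0 := by linarith only [J5.1, J1.1]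
  have hs1 : s 1 = 0 := by linarith only [J6.1, J2.1]
  have hA00 : A 0 0 0 = 0 := by linarith only [J1.1, J0.1]
  have hA01 : A 0 1 1 = 0 := by linarith only [J2.1, J0.1]
  have hA0 : A 0 0 1 = 0 := by linarith only [J3.1, J4.1]
  have hM01 : M 0 1 = 0 := by linarith only [J3.1, J4.1, J0.1]
  have hS11 : S 1 1 = 0 := mul_left_cancel₀ hk (by linarith only [J1.2, J0.2])
  have hS00 : S 0 0 = 0 := mul_left_cancel₀ hk (by linarith only [J2.2, J0.2])
  have hS01 : S 0 1 = 0 := mul_left_cancel₀ hk (by linarith only [J3.2, J0.2])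
  simp only [hM01, hS00, hS01, hS11, hA00, hA01, hA0, zero_mul, mul_zero, add_zero, zero_add]
    at J0 J7 J8 J9 J10 J11
  have hA10 : A 1 0 0 = 0 := by linarith only [J7.1, J0.1]
  have hA11 : A 1 1 1 = 0 := by linarith only [J8.1, J0.1]
  have hA1 : A 1 0 1 = 0 := by linarith only [J9.1, J10.1]
  have hM10 : M 1 0 = 0 := by linarith only [J9.1, J10.1, J0.1]
  have hke : k * (1 / k) = 1 := by field_simp
  have hDe : D * (1 / D) = 1 := by field_simp
  -- Homogeneity: the second equation balances Φ against a quadratic term in w, the first w against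
  -- the mixed bracket, which forces `M 1 1 = 0`. The contributions of `G` cancel.
  have e1 : M 1 1 - 2 * M 0 0 = 0 := by
    have := J9.2
    rw [add_div] at this
    linear_combination this - J0.2 - (M 1 1 - 4 * G 0 0) * hke + 2 * hG
  have e2 : M 1 1 = 0 := by
    have := J11.1
    rw [add_div] at this
    linear_combination -this + J0.1 + (M 0 0 - 4 * G 0 0) * hDe - 2 * hG - hA11
  have e3 : M 0 0 = 0 := by linarith
  refine ⟨?_, ?_, ?_⟩
  · ext i; fin_cases i <;> assumption
  · ext i j; fin_cases i <;> fin_cases j <;> assumption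
  · ext a i j; fin_cases a <;> fin_cases i <;> fin_cases j <;> simp [*]

section NormalChar

variable {x : Plane} {u₀ : Fin 2 → ℝ} {ξ η : Fin 2 → SmoothFn Total}

/-- The second derivatives of the characteristic of a quasilinear conformal field. -/
theorem hessS_normalChar (hη : QuasilinearAt ξ η (x, u₀)) (l : Fin 2 → Fin 2 → ℝ)
    (q : Fin 2 → Fin 3 → ℝ) (κ : Fin 2 → ℝ) (a i j : Fin 2) :
    hessS x (normalChar x u₀ ξ η (fun b => polyS x 0 (l b) (q b) (κ b)) a) i j
      = evalAt ((x, u₀) : Total) (tdx i (tdx j (η a)))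
        + ∑ b, evalAt ((x, u₀) : Total) (tdu b (η a)) * symMat (q b) i j
        + evalAt ((x, u₀) : Total) (tdx i (tdx 0 (ξ 0))) * l a j
        + evalAt ((x, u₀) : Total) (tdx j (tdx 0 (ξ 0))) * l a i
        - ∑ m, (evalAt ((x, u₀) : Total) (tdx i (tdx j (ξ m))) * l a m
          + evalAt ((x, u₀) : Total) (tdx i (ξ m)) * symMat (q a) j m
          + evalAt ((x, u₀) : Total) (tdx j (ξ m)) * symMat (q a) i m) := by
  have e2 : ∀ a i j, evalAt x (pdS i (pdS j (polyS x 0 (l a) (q a) (κ a)))) = symMat (q a) i j :=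
    fun a i j => by
      have := congrFun (congrFun (hessS_polyS x 0 (l a) (q a) (κ a)) i) j
      exact this
  simp only [normalChar, hessS_sub, hessS_add, Fin.sum_univ_two, Pi.add_apply, Pi.sub_apply,
    hessS_mul, evalAt_polyS, evalAt_pdS_polyS, map_sub, AlgHom.commutes, dirDeriv_algebraMap]
  simp only [hessS, e2, evalAt_pdS_pdS_pdS_polyS, pdS_sliceS, evalAt_sliceS,
    dirDeriv_algebraMap, map_zero]
  simp only [hη.tdx_tdu, Algebra.algebraMap_self, RingHom.id_apply]
  fin_cases a <;> simp <;> ring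

/-- The bilaplacian of the characteristic of a quasilinear conformal field. -/
theorem bilapS_normalChar (hξ : ∀ᶠ z in 𝓝 ((x, u₀) : Total), ConformalAt ξ z)
    (hη : ∀ᶠ z in 𝓝 ((x, u₀) : Total), QuasilinearAt ξ η z) (l : Fin 2 → Fin 2 → ℝ)
    (q : Fin 2 → Fin 3 → ℝ) (κ : Fin 2 → ℝ) (a : Fin 2) :
    evalAt x (bilapS (normalChar x u₀ ξ η (fun b => polyS x 0 (l b) (q b) (κ b)) a))
      = evalAt x (bilapS (sliceS u₀ (η a)))
        + ∑ b, evalAt ((x, u₀) : Total) (tdu b (η a)) * κ b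
        + 4 * (evalAt ((x, u₀) : Total) (tdx 0 (tdx 0 (tdx 0 (ξ 0)))) * q a 0
          + 2 * (evalAt ((x, u₀) : Total) (tdx 0 (tdx 1 (tdx 0 (ξ 0)))) * q a 1)
          + evalAt ((x, u₀) : Total) (tdx 1 (tdx 1 (tdx 0 (ξ 0)))) * q a 2)
        - 4 * (evalAt ((x, u₀) : Total) (tdx 0 (ξ 0)) * κ a) := by
  -- Harmonicity of ξ and the relation between η and ξ are kept as identities near the point, so
  -- that they can be differentiated as often as the Leibniz formula for the bilaplacian requires.
  have lap : ∀ m, ∀ᶠ z in 𝓝 ((x, u₀) : Total),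
      evalAt z (tdx 0 (tdx 0 (ξ m)) + tdx 1 (tdx 1 (ξ m))) = evalAt z 0 := fun m =>
    hξ.eventually_nhds.mono fun z hz => by
      rw [map_add, (conformalNear hz).laplace, map_zero]
  have lap1 : ∀ m i, evalAt ((x, u₀) : Total) (tdx i (tdx 0 (tdx 0 (ξ m))))
      + evalAt ((x, u₀) : Total) (tdx i (tdx 1 (tdx 1 (ξ m)))) = 0 := fun m i => by
    have := (eventually_evalAt_dirDeriv_congr (lap m) ((Pi.single i 1, 0) : Total)).self_of_nhds
    rwa [map_add, map_add, map_zero, map_zero] at this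
  have lap2 : ∀ m i j, evalAt ((x, u₀) : Total) (tdx i (tdx j (tdx 0 (tdx 0 (ξ m)))))
      + evalAt ((x, u₀) : Total) (tdx i (tdx j (tdx 1 (tdx 1 (ξ m))))) = 0 := fun m i j => by
    have := (eventually_evalAt_dirDeriv_congr (eventually_evalAt_dirDeriv_congr (lap m)
      ((Pi.single j 1, 0) : Total)) ((Pi.single i 1, 0) : Total)).self_of_nhds
    rwa [map_add, map_add, map_add, map_zero, map_zero, map_zero] at this
  have M1 : ∀ b i, ∀ᶠ z in 𝓝 ((x, u₀) : Total), evalAt z (tdx i (tdu b (η a)))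
      = evalAt z (if a = b then tdx i (tdx 0 (ξ 0)) else 0) := fun b i =>
    hη.mono fun z hz => by rw [hz.tdx_tdu]; split_ifs <;> simp
  have M2 : ∀ b i j, ∀ᶠ z in 𝓝 ((x, u₀) : Total), evalAt z (tdx j (tdx i (tdu b (η a))))
      = evalAt z (if a = b then tdx j (tdx i (tdx 0 (ξ 0))) else 0) := fun b i j =>
    (eventually_evalAt_dirDeriv_congr (M1 b i) _).mono fun z hz => by
      rw [hz]; split_ifs <;> simp
  have M3 : ∀ b i j m, evalAt ((x, u₀) : Total) (tdx m (tdx j (tdx i (tdu b (η a)))))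
      = if a = b then evalAt ((x, u₀) : Total) (tdx m (tdx j (tdx i (tdx 0 (ξ 0))))) else 0 :=
    fun b i j m => by
      rw [(eventually_evalAt_dirDeriv_congr (M2 b i j) _).self_of_nhds]; split_ifs <;> simp
  have e2 : ∀ a i j, evalAt x (pdS i (pdS j (polyS x 0 (l a) (q a) (κ a)))) = symMat (q a) i j :=
    fun a i j => by
      have := congrFun (congrFun (hessS_polyS x 0 (l a) (q a) (κ a)) i) j
      exact this
  have e4 : ∀ i j m n, evalAt x (pdS i (pdS j (pdS m (pdS n (polyS x 0 (l a) (q a) (κ a))))))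
      = if i = 0 ∧ j = 0 ∧ m = 0 ∧ n = 0 then κ a else 0 := fun i j m n => by
    fin_cases i <;> fin_cases j <;> fin_cases m <;> fin_cases n <;> simp [polyS]
  have e5 : ∀ i, evalAt x (bilapS (pdS i (polyS x 0 (l a) (q a) (κ a)))) = 0 := fun i => by
    fin_cases i <;> simp [polyS, bilapS_apply]
  have hc : ∀ G, tdx 1 (tdx 0 G) = tdx 0 (tdx 1 G) := fun G => dirDeriv_comm _ _ _
  have c1 := fun m => lap1 m 0
  have c2 := fun m => lap1 m 1
  have c3 := fun m => lap2 m 0 0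
  have c4 := lap2 0 0 1
  have c5 := fun m => lap2 m 1 1
  simp only [hc] at c1 c2 c3 c4 c5
  have hM1 := fun b i => (M1 b i).self_of_nhds
  have hM2 := fun b i j => (M2 b i j).self_of_nhds
  simp only [normalChar, map_sub, map_add, Fin.sum_univ_two, evalAt_bilapS_mul,
    evalAt_polyS, evalAt_pdS_polyS, e2, e4, e5, evalAt_pdS_pdS_pdS_polyS, evalAt_bilapS_polyS,
    AlgHom.commutes, dirDeriv_algebraMap, map_zero, pdS_sliceS, evalAt_sliceS, hM1, hM2, M3]
  simp only [bilapS_apply, dirDeriv_algebraMap, map_zero, map_add, map_smul, pdS_sliceS,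
    evalAt_sliceS, smul_eq_mul]
  fin_cases a
  · simp [hc, symMat]
    linear_combination (4 * l 0 0) * c3 0 + (4 * l 0 1) * c4
      + 2 * (q 0 0 + q 0 2) * c1 0 - 4 * (q 0 0 * c1 0 + q 0 1 * c2 0) - 4 * (q 0 1 * c1 1 + q 0 2 * c2 1)
      - l 0 0 * (c3 0 + c5 0) - l 0 1 * (c3 1 + c5 1)
  · simp [hc, symMat]
    linear_combination (4 * l 1 0) * c3 0 + (4 * l 1 1) * c4
      + 2 * (q 1 0 + q 1 2) * c1 0 - 4 * (q 1 0 * c1 0 + q 1 1 * c2 0) - 4 * (q 1 1 * c1 1 + q 1 2 * c2 1)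
      - l 1 0 * (c3 0 + c5 0) - l 1 1 * (c3 1 + c5 1)

end NormalChar

/-- The vector field has vanishing second derivatives, and the dependence on the dependent
variables is trivial. -/
structure AffineAt (ξ η : Fin 2 → SmoothFn Total) (z : Total) : Prop where
  tdu_left : ∀ i b, evalAt z (tdu b (ξ i)) = 0
  tdu_right : ∀ a b, evalAt z (tdu b (η a)) = 0
  tdx_left : ∀ m i j, evalAt z (tdx i (tdx j (ξ m))) = 0
  tdx_right : ∀ a i j, evalAt z (tdx i (tdx j (η a))) = 0
  diag : evalAt z (tdx 0 (ξ 0)) = evalAt z (tdx 1 (ξ 1))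
  skew : evalAt z (tdx 1 (ξ 0)) = -evalAt z (tdx 0 (ξ 1))

/-- Evaluation on polynomial jets reduces the claim to `eq_zero_of_determining`. That controls only
the derivatives of ξ^0_{,0}; the Cauchy-Riemann equations and harmonicity supply the other second
derivatives of ξ. -/
theorem LinAdmits.affineAt {D k P₀ K₀ p' k' : ℝ} {ξ η : Fin 2 → SmoothFn Total} {x : Plane}
    {u₀ : Fin 2 → ℝ} (hD : D ≠ 0) (hk : k ≠ 0) (h : LinAdmits D k P₀ K₀ p' k' ξ η x u₀)
    (hξ : ∀ᶠ z in 𝓝 ((x, u₀) : Total), ConformalAt ξ z)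
    (hη : ∀ᶠ z in 𝓝 ((x, u₀) : Total), QuasilinearAt ξ η z) : AffineAt ξ η (x, u₀) := by
  have hc := conformalNear hξ
  have hcomm : ∀ i j G, tdx i (tdx j G) = tdx j (tdx i G) := fun i j G => dirDeriv_comm _ _ _
  obtain ⟨hs, hM, hA⟩ := eq_zero_of_determining hD hk
    (A := fun a i j => evalAt ((x, u₀) : Total) (tdx i (tdx j (η a))))
    (M := fun a b => evalAt ((x, u₀) : Total) (tdu b (η a)))
    (S := fun i j => evalAt ((x, u₀) : Total) (tdx i (tdx j (tdx 0 (ξ 0)))))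
    (G := fun m i => evalAt ((x, u₀) : Total) (tdx i (ξ m)))
    (s := fun i => evalAt ((x, u₀) : Total) (tdx i (tdx 0 (ξ 0))))
    (B := fun a => evalAt x (bilapS (sliceS u₀ (η a))))
    (T := fun m i j => evalAt ((x, u₀) : Total) (tdx i (tdx j (ξ m))))
    (P₀ := P₀) (K₀ := K₀) (p' := p') (k' := k')
    (fun a => congrArg _ (hcomm 1 0 _)) hc.diag hc.skew rfl (hc.tdx_diag 1).symm (by
      intro l q κ h1 h2 zb zh hzb hzh
      set v : Fin 2 → SmoothFn Plane := fun b => polyS x 0 (l b) (q b) (κ b) with hv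
      have hv0 : ∀ a, evalAt x (v a) = 0 := fun a => evalAt_polyS x _ _ _ _
      have hh : ∀ a, hessS x (v a + algebraMap ℝ _ (u₀ a)) = symMat (q a) := fun a => by
        rw [hessS_add, hv, hessS_polyS, symMat, add_eq_left]
        ext i j; simp only [hessS, dirDeriv_algebraMap, map_zero]; rfl
      have hb : ∀ a, evalAt x (bilapS (v a + algebraMap ℝ _ (u₀ a))) = κ a := fun a => by
        rw [map_add, map_add, hv, evalAt_bilapS_polyS, add_eq_left]
        simp only [bilapS_apply, dirDeriv_algebraMap, map_zero, smul_zero, add_zero]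
      have key := h (fun a => v a + algebraMap ℝ _ (u₀ a))
        (fun a => by rw [map_add, hv0, AlgHom.commutes, zero_add]; rfl)
        (by rw [hh, hh, hb]; exact h1) (by rw [hh, hb]; exact h2)
      have ez : ∀ a, evalAt x (bilapS (prolChar x ξ η (fun a => v a + algebraMap ℝ _ (u₀ a)) a))
          = zb a := fun a => by
        rw [evalAt_bilapS_congr (prolChar_eventuallyEq hξ hη hv0 a), hzb,
          bilapS_normalChar hξ hη]
      have eh : ∀ a, hessS x (prolChar x ξ η (fun a => v a + algebraMap ℝ _ (u₀ a)) a)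
          = zh a := fun a => by
        rw [hessS_congr (prolChar_eventuallyEq hξ hη hv0 a)]
        ext i j
        rw [hzh, hessS_normalChar hη.self_of_nhds]
      simpa only [ez, eh, hh] using key)
  have hs' : ∀ i, evalAt ((x, u₀) : Total) (tdx i (tdx 0 (ξ 0))) = 0 := fun i => congrFun hs i
  have h11 : ∀ i, evalAt ((x, u₀) : Total) (tdx i (tdx 1 (ξ 1))) = 0 := fun i => by
    rw [← hc.tdx_diag, hs']
  have L0 := hc.laplace 0
  have L1 := hc.laplace 1
  rw [hs', zero_add] at L0
  rw [h11, add_zero] at L1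
  refine ⟨hc.tdu, fun a b => congrFun (congrFun hM a) b, fun m i j => ?_,
    fun a i j => congrFun (congrFun (congrFun hA a) i) j, hc.diag, hc.skew⟩
  fin_cases m <;> fin_cases j <;> fin_cases i <;> simp only [Fin.zero_eta, Fin.mk_one] <;>
    first
    | exact hs' _
    | exact h11 _
    | exact L0
    | exact L1
    | (rw [hc.tdx_skew]; exact neg_eq_zero.2 L1)
    | (rw [hcomm]; first | exact hs' _ | exact h11 _)

/-! ### Linearization along the prolongation -/

theorem bracket_comm (a b : Fin 2 → Fin 2 → ℝ) : bracket a b = bracket b a := by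
  rw [bracket_eq, bracket_eq]; ring

/-- The linearization of the von Kármán equations at the jet `j` in the direction `v`. -/
noncomputable def karmanLin (D E h : ℝ) (P K : Plane → ℝ) (j v : Jet) : Fin 2 → ℝ :=
  ![D * bilap v 0 - bracket (hess v 0) (hess j 1) - bracket (hess j 0) (hess v 1)
      - fderiv ℝ P j.1 v.1,
    1 / (E * h) * bilap v 1 + bracket (hess j 0) (hess v 0) - fderiv ℝ K j.1 v.1]

theorem hasDerivAt_bracket {a b : ℝ → Fin 2 → Fin 2 → ℝ} {a' b' : Fin 2 → Fin 2 → ℝ} {t : ℝ}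
    (ha : ∀ i j, HasDerivAt (fun s => a s i j) (a' i j) t)
    (hb : ∀ i j, HasDerivAt (fun s => b s i j) (b' i j) t) :
    HasDerivAt (fun s => bracket (a s) (b s)) (bracket a' (b t) + bracket (a t) b') t := by
  simp only [bracket_eq]
  have := ((((ha 0 0).mul (hb 1 1)).add ((ha 1 1).mul (hb 0 0))).sub
    ((ha 0 1).mul (hb 1 0))).sub ((ha 1 0).mul (hb 0 1))
  exact this.congr_deriv (by ring)

/-- Curves are needed, not only lines: the translation by f bends the line of jets used to define
admission. -/
theorem hasDerivAt_karmanSystem {D E h : ℝ} {P K : Plane → ℝ} {c : ℝ → Jet} {v : Jet}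
    (hP : DifferentiableAt ℝ P (c 0).1) (hK : DifferentiableAt ℝ K (c 0).1)
    (h1 : HasDerivAt (fun ε => (c ε).1) v.1 0)
    (h2 : ∀ a J, HasDerivAt (fun ε => (c ε).2 a J) (v.2 a J) 0) (k : Fin 2) :
    HasDerivAt (fun ε => karmanSystem D E h P K (c ε) k) (karmanLin D E h P K (c 0) v k) 0 := by
  have hb : ∀ a, HasDerivAt (fun ε => bilap (c ε) a) (bilap v a) 0 := fun a =>
    HasDerivAt.fun_sum fun α _ => HasDerivAt.fun_sum fun μ _ => h2 a _
  have hh : ∀ a α β, HasDerivAt (fun ε => hess (c ε) a α β) (hess v a α β) 0 :=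
    fun a α β => h2 a _
  fin_cases k
  · exact (((hb 0).const_mul D).sub (hasDerivAt_bracket (hh 0) (hh 1))).sub
      (hP.hasFDerivAt.comp_hasDerivAt (0 : ℝ) h1) |>.congr_deriv (by simp [karmanLin]; ring)
  · exact (((hb 1).const_mul (1 / (E * h))).add
      ((hasDerivAt_bracket (hh 0) (hh 0)).const_mul (1 / 2))).sub
      (hK.hasFDerivAt.comp_hasDerivAt (0 : ℝ) h1) |>.congr_deriv (by
        rw [bracket_comm (hess v 0)]; simp [karmanLin]; ring)

theorem hasDerivAt_karmanSystem_line {D E h : ℝ} {P K : Plane → ℝ} {j : Jet} (v : Jet)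
    (hP : DifferentiableAt ℝ P j.1) (hK : DifferentiableAt ℝ K j.1) (k : Fin 2) :
    HasDerivAt (fun ε : ℝ => karmanSystem D E h P K (j + ε • v) k) (karmanLin D E h P K j v k) 0 := by
  have := hasDerivAt_karmanSystem (D := D) (E := E) (h := h) (P := P) (K := K)
    (c := fun ε : ℝ => j + ε • v) (v := v) (by simpa using hP) (by simpa using hK)
    (by simpa using ((hasDerivAt_id (0 : ℝ)).smul_const v.1).const_add j.1)
    (fun a J => by simpa using ((hasDerivAt_id (0 : ℝ)).smul_const (v.2 a J)).const_add (j.2 a J)) k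
  simpa using this

/-! ### Jets of smooth functions -/

theorem iterPdS_add (J : List (Fin 2)) (g k : SmoothFn Plane) :
    iterPdS J (g + k) = iterPdS J g + iterPdS J k := by
  induction J with
  | nil => rfl
  | cons i J ih => rw [iterPdS_cons, ih, map_add]; rfl

theorem iterPdS_smul (J : List (Fin 2)) (c : ℝ) (g : SmoothFn Plane) :
    iterPdS J (c • g) = c • iterPdS J g := by
  induction J with
  | nil => rfl
  | cons i J ih => rw [iterPdS_cons, ih, Derivation.map_smul]; rfl

/-- The components of a smooth map. -/
def compnt {V : Type*} [NormedAddCommGroup V] [NormedSpace ℝ V] {u : V → Fin 2 → ℝ}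
    (hu : ContDiff ℝ ∞ u) (a : Fin 2) : SmoothFn V :=
  ⟨fun y => u y a, show ContDiff ℝ ∞ _ from contDiff_pi.1 hu a⟩

theorem bilap_eq {j : Jet} {a : Fin 2} {x : Plane} {g : SmoothFn Plane}
    (h : ∀ J, j.2 a J = evalAt x (iterPdS J g)) : bilap j a = evalAt x (bilapS g) := by
  simp only [bilap, h, Fin.sum_univ_two, iterPdS_cons, iterPdS_nil, bilapS_apply, map_add, map_smul,
    smul_eq_mul, pdS_comm]
  ring

theorem hess_eq {j : Jet} {a : Fin 2} {x : Plane} {g : SmoothFn Plane}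
    (h : ∀ J, j.2 a J = evalAt x (iterPdS J g)) : hess j a = hessS x g := by
  ext α β; exact h _

theorem jet_snd (w : Fin 2 → SmoothFn Plane) (x : Plane) (a : Fin 2) (J : List (Fin 2)) :
    (jet (fun y b => evalAt y (w b)) x).2 a J = evalAt x (iterPdS J (w a)) :=
  congrFun (iterPd_coe J (w a)) x

theorem contDiff_evalAt (w : Fin 2 → SmoothFn Plane) :
    ContDiff ℝ ∞ fun y b => evalAt y (w b) :=
  contDiff_pi.2 fun a => contDiff_coe (w a)

/-- The vector field with components `ξ` and `η`. -/
noncomputable def fieldOf (ξ η : Fin 2 → SmoothFn Total) : Total → Total :=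
  fun z => (fun i => evalAt z (ξ i), fun a => evalAt z (η a))

/-- The constant subtracted from ξ in `prolChar` accounts for the terms ξ^i u_{,Ji}, so all
components are derivatives of one smooth function. Only the germ of `X` matters, which permits
cut-off components. -/
theorem prolongation_eq {X : Total → Total} {ξ η : Fin 2 → SmoothFn Total}
    {w : Fin 2 → SmoothFn Plane} {x : Plane}
    (hX : X =ᶠ[𝓝 ((x, fun b => evalAt x (w b)) : Total)] fieldOf ξ η) :
    (prolongation X (fun y b => evalAt y (w b)) x).1
        = (fun i => evalAt ((x, fun b => evalAt x (w b)) : Total) (ξ i)) ∧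
      ∀ a J, (prolongation X (fun y b => evalAt y (w b)) x).2 a J
        = evalAt x (iterPdS J (prolChar x ξ η w a)) := by
  have h0 := hX.self_of_nhds
  refine ⟨congrArg Prod.fst h0, fun a J => ?_⟩
  have hT : Tendsto (fun y : Plane => ((y, fun b => evalAt y (w b)) : Total)) (𝓝 x)
      (𝓝 (x, fun b => evalAt x (w b))) :=
    (continuous_id.prodMk (contDiff_evalAt w).continuous).tendsto x
  have hchar : characteristic X (fun y b => evalAt y (w b)) a
      =ᶠ[𝓝 x] (compS (η a) w - ∑ i, compS (ξ i) w * pdS i (w a) : SmoothFn Plane) := by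
    filter_upwards [hT.eventually hX] with y hy
    simp only [characteristic, hy]
    simp only [Fin.sum_univ_two]
    rfl
  have hQ : prolChar x ξ η w a = (compS (η a) w - ∑ i, compS (ξ i) w * pdS i (w a))
      + ∑ i, evalAt x (compS (ξ i) w) • pdS i (w a) := by
    simp only [prolChar, Fin.sum_univ_two, Algebra.smul_def]; ring
  rw [hQ, iterPdS_add, map_add]
  have h1 : iterPd J (characteristic X (fun y b => evalAt y (w b)) a) x
      = evalAt x (iterPdS J (compS (η a) w - ∑ i, compS (ξ i) w * pdS i (w a))) := by
    rw [(iterPd_congr hchar J).self_of_nhds, iterPd_coe]; rfl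
  have h2 : ∀ i, iterPd (i :: J) (fun y => evalAt y (w a)) x
      = evalAt x (iterPdS J (pdS i (w a))) := fun i => by
    rw [iterPdS_pdS]; exact congrFun (iterPd_coe (i :: J) (w a)) x
  simp only [prolongation, h1, h2, Fin.sum_univ_two, iterPdS_add, iterPdS_smul, map_add, map_smul,
    smul_eq_mul, h0]
  rfl

/-- The system `F = 0` admits `X` at the point `z`. -/
def AdmitsFieldAt (F : DiffSystem) (X : Total → Total) (z : Total) : Prop :=
  ∀ u : Plane → Fin 2 → ℝ, ContDiff ℝ ∞ u → u z.1 = z.2 → F (jet u z.1) = 0 →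
    ∀ k, HasDerivAt (fun ε : ℝ => F (jet u z.1 + ε • prolongation X u z.1) k) 0 0

theorem admitsField_iff {F : DiffSystem} {X : Total → Total} {M : Set Total} :
    AdmitsField F M X ↔ ∀ z ∈ M, AdmitsFieldAt F X z :=
  ⟨fun h z hz u hu e => h u z.1 hu (by rw [e]; exact hz),
    fun h u x hu hx => h _ hx u hu rfl⟩

theorem admitsFieldAt_karmanSystem_iff {D E h : ℝ} {P K : Plane → ℝ} {X : Total → Total}
    {ξ η : Fin 2 → SmoothFn Total} {z : Total} (hP : DifferentiableAt ℝ P z.1)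
    (hK : DifferentiableAt ℝ K z.1) (hX : X =ᶠ[𝓝 z] fieldOf ξ η) :
    AdmitsFieldAt (karmanSystem D E h P K) X z ↔
      LinAdmits D (1 / (E * h)) (P z.1) (K z.1) (fderiv ℝ P z.1 (fun i => evalAt z (ξ i)))
        (fderiv ℝ K z.1 (fun i => evalAt z (ξ i))) ξ η z.1 z.2 := by
  have key : ∀ w : Fin 2 → SmoothFn Plane, (fun b => evalAt z.1 (w b)) = z.2 →
      ((karmanSystem D E h P K (jet (fun y b => evalAt y (w b)) z.1) = 0 →
        ∀ k, HasDerivAt (fun ε : ℝ => karmanSystem D E h P K (jet (fun y b => evalAt y (w b)) z.1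
          + ε • prolongation X (fun y b => evalAt y (w b)) z.1) k) 0 0) ↔
      (D * evalAt z.1 (bilapS (w 0)) - bracket (hessS z.1 (w 0)) (hessS z.1 (w 1)) = P z.1 →
      1 / (E * h) * evalAt z.1 (bilapS (w 1))
        + 1 / 2 * bracket (hessS z.1 (w 0)) (hessS z.1 (w 0)) = K z.1 →
      D * evalAt z.1 (bilapS (prolChar z.1 ξ η w 0))
        - bracket (hessS z.1 (prolChar z.1 ξ η w 0)) (hessS z.1 (w 1))
        - bracket (hessS z.1 (w 0)) (hessS z.1 (prolChar z.1 ξ η w 1))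
          = fderiv ℝ P z.1 (fun i => evalAt z (ξ i)) ∧
      1 / (E * h) * evalAt z.1 (bilapS (prolChar z.1 ξ η w 1))
        + bracket (hessS z.1 (w 0)) (hessS z.1 (prolChar z.1 ξ η w 0))
          = fderiv ℝ K z.1 (fun i => evalAt z (ξ i)))) := by
    intro w hw
    have hz : ((z.1, fun b => evalAt z.1 (w b)) : Total) = z := Prod.ext rfl hw
    obtain ⟨p1, p2⟩ := prolongation_eq (X := X) (ξ := ξ) (η := η) (w := w) (x := z.1)
      (by rw [hz]; exact hX)
    rw [hz] at p1
    have hd := fun k => hasDerivAt_karmanSystem_line (D := D) (E := E) (h := h) (P := P) (K := K)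
      (j := jet (fun y b => evalAt y (w b)) z.1)
      (prolongation X (fun y b => evalAt y (w b)) z.1) hP hK k
    have e1 : (∀ k, HasDerivAt (fun ε : ℝ => karmanSystem D E h P K
        (jet (fun y b => evalAt y (w b)) z.1
          + ε • prolongation X (fun y b => evalAt y (w b)) z.1) k) 0 0) ↔
        ∀ k, karmanLin D E h P K (jet (fun y b => evalAt y (w b)) z.1)
          (prolongation X (fun y b => evalAt y (w b)) z.1) k = 0 :=
      forall_congr' fun k => ⟨fun H => (hd k).unique H, fun H => H ▸ hd k⟩
    rw [e1, funext_iff, Fin.forall_fin_two, Fin.forall_fin_two, ← and_imp]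
    simp only [karmanSystem, karmanLin, bilap_eq (p2 _), hess_eq (p2 _), bilap_eq (jet_snd w z.1 _),
      hess_eq (jet_snd w z.1 _), p1, Matrix.cons_val_zero, Matrix.cons_val_one, Pi.zero_apply,
      sub_eq_zero]
    rfl
  constructor
  · intro H w hw
    exact (key w (funext hw)).1 (H _ (contDiff_evalAt w) (funext hw))
  · intro H u hu e
    exact (key (compnt hu) e).2 (H (compnt hu) (congrFun e))

/-! ### Homotheties -/

theorem fieldDeriv_eq (ξ : Plane → Plane) (g : Plane → ℝ) (x : Plane) :
    fieldDeriv ξ g x = fderiv ℝ g x (ξ x) := by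
  have e : ξ x = ∑ i, ξ x i • (Pi.single i 1 : Plane) := by
    ext k; fin_cases k <;> simp [Fin.sum_univ_two]
  conv_rhs => rw [e, map_sum]
  simp only [fieldDeriv, pd, map_smul, smul_eq_mul]

/-- The components of an infinitesimal homothety. -/
noncomputable def homS (C : Fin 4 → ℝ) : Fin 2 → SmoothFn Plane :=
  ![C 0 • coordS 0 0 + C 1 • coordS 0 1 + algebraMap ℝ _ (C 2),
    -C 1 • coordS 0 0 + C 0 • coordS 0 1 + algebraMap ℝ _ (C 3)]

theorem evalAt_homS (C : Fin 4 → ℝ) (y : Plane) (i : Fin 2) :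
    evalAt y (homS C i) = homothety C y i := by
  fin_cases i <;> simp [homS, homothety, evalAt_apply, coordS]

theorem evalAt_pdS_homS (C : Fin 4 → ℝ) (y : Plane) (i j : Fin 2) :
    evalAt y (pdS j (homS C i)) = (![![C 0, C 1], ![-C 1, C 0]] : Fin 2 → Fin 2 → ℝ) i j := by
  fin_cases i <;> fin_cases j <;> simp [homS, pdS_coordS]

theorem pdS_pdS_homS (C : Fin 4 → ℝ) (i j k : Fin 2) : pdS k (pdS j (homS C i)) = 0 := by
  fin_cases i <;> fin_cases j <;> simp [homS, pdS_coordS]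

/-- An affine function. -/
noncomputable def affS (A : Fin 3 → ℝ) : SmoothFn Plane :=
  A 0 • coordS 0 0 + A 1 • coordS 0 1 + algebraMap ℝ _ (A 2)

theorem evalAt_affS (A : Fin 3 → ℝ) (y : Plane) :
    evalAt y (affS A) = A 0 * y 0 + A 1 * y 1 + A 2 := by
  simp [affS, evalAt_apply, coordS]

theorem pdS_pdS_affS (A : Fin 3 → ℝ) (j k : Fin 2) : pdS k (pdS j (affS A)) = 0 := by
  fin_cases j <;> simp [affS, pdS_coordS]

theorem divergence_homothety (C : Fin 4 → ℝ) (x : Plane) :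
    divergence (homothety C) x = 2 * C 0 := by
  have : ∀ μ, pd μ (fun y => homothety C y μ) x = C 0 := fun μ => by
    have e : (fun y => homothety C y μ) = (homS C μ : Plane → ℝ) :=
      funext fun y => (evalAt_homS C y μ).symm
    rw [e]
    refine (evalAt_pdS_homS C x μ μ).trans ?_
    fin_cases μ <;> simp
  rw [divergence, Fin.sum_univ_two, this, this]; ring

/-- Under an infinitesimal homothety the bilaplacian has weight -4 `C 0`. So has the bracket, a
polarized Hessian determinant on which the rotation has no effect; affine terms are invisible to
second derivatives. On a solving jet the linearized left-hand sides are thus -4 `C 0` times `P₀` and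
`K₀`, and one such jet suffices for the converse. -/
theorem linAdmits_homothety_iff {D k P₀ K₀ p' k' : ℝ} (hD : D ≠ 0) (hk : k ≠ 0) (C : Fin 4 → ℝ)
    (A : Fin 2 → Fin 3 → ℝ) (x : Plane) (u₀ : Fin 2 → ℝ) :
    LinAdmits D k P₀ K₀ p' k' (fun i => liftS (homS C i)) (fun a => liftS (affS (A a))) x u₀ ↔
      -4 * C 0 * P₀ = p' ∧ -4 * C 0 * K₀ = k' := by
  have hc : ∀ w : Fin 2 → SmoothFn Plane, ∀ a,
      prolChar x (fun i => liftS (homS C i)) (fun a => liftS (affS (A a))) w a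
        = affS (A a) - ∑ i, (homS C i - algebraMap ℝ _ (evalAt x (homS C i))) * pdS i (w a) :=
    fun w a => rfl
  have hb : ∀ w : Fin 2 → SmoothFn Plane, ∀ a,
      evalAt x (bilapS (prolChar x (fun i => liftS (homS C i)) (fun a => liftS (affS (A a))) w a))
        = -4 * C 0 * evalAt x (bilapS (w a)) := fun w a => by
    rw [hc]
    simp only [map_sub, Fin.sum_univ_two, map_add, evalAt_bilapS_mul, AlgHom.commutes,
      dirDeriv_algebraMap, map_zero, sub_zero, evalAt_pdS_homS, pdS_pdS_homS]
    simp only [bilapS_apply, pdS_pdS_homS, pdS_pdS_affS, dirDeriv_algebraMap, map_zero, map_add,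
      smul_zero, map_smul, smul_eq_mul, pdS_comm]
    simp
    ring
  have hh : ∀ w : Fin 2 → SmoothFn Plane, ∀ a i j,
      hessS x (prolChar x (fun i => liftS (homS C i)) (fun a => liftS (affS (A a))) w a) i j
        = -∑ m, ((![![C 0, C 1], ![-C 1, C 0]] : Fin 2 → Fin 2 → ℝ) m i * hessS x (w a) j m
          + (![![C 0, C 1], ![-C 1, C 0]] : Fin 2 → Fin 2 → ℝ) m j * hessS x (w a) i m) :=
    fun w a i j => by
    rw [hc, hessS_sub, Fin.sum_univ_two, hessS_add, Pi.sub_apply, Pi.sub_apply, Pi.add_apply,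
      Pi.add_apply, hessS_mul, hessS_mul]
    simp only [map_sub, AlgHom.commutes, dirDeriv_algebraMap, sub_zero, evalAt_pdS_homS]
    simp only [hessS, pdS_pdS_homS, pdS_pdS_affS, dirDeriv_algebraMap, map_zero, map_sub,
      Fin.sum_univ_two]
    simp
  have hs : ∀ g : SmoothFn Plane, hessS x g 1 0 = hessS x g 0 1 := fun g => by
    simp only [hessS, pdS_comm]
  constructor
  · intro h
    have h0 : ∀ a, hessS x (flatS x u₀ 0 ![P₀ / D, K₀ / k] a) = 0 := fun a => hessS_flatS _ _ a
    have b0 : ∀ a, evalAt x (bilapS (flatS x u₀ 0 ![P₀ / D, K₀ / k] a))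
      = (![P₀ / D, K₀ / k] : Fin 2 → ℝ) a := fun a => evalAt_bilapS_polyS _ _ _ _ _
    have e1 : D * (P₀ / D) = P₀ := by field_simp
    have e2 : k * (K₀ / k) = K₀ := by field_simp
    have := h (flatS x u₀ 0 ![P₀ / D, K₀ / k]) (fun a => evalAt_polyS _ _ _ _ _)
      (by rw [h0, bracket_zero_left, b0]; simp [e1]) (by rw [h0, bracket_zero_left, b0]; simp [e2])
    rw [hb, hb, h0, h0, bracket_zero_left, bracket_zero_left, bracket_zero_right, b0, b0] at this
    simp only [Matrix.cons_val_zero, Matrix.cons_val_one] at this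
    exact ⟨by linear_combination this.1 + 4 * C 0 * e1, by linear_combination this.2 + 4 * C 0 * e2⟩
  · rintro ⟨rfl, rfl⟩ w - h1 h2
    simp only [hb, bracket_eq, hh, Fin.sum_univ_two, hs] at h1 h2 ⊢
    simp
    constructor
    · linear_combination (-4 * C 0) * h1
    · linear_combination (-4 * C 0) * h2

theorem admitsFieldAt_homothety_iff {D E h : ℝ} (hD : 0 < D) (hE : 0 < E) (hh : 0 < h)
    {P K : Plane → ℝ} {X : Total → Total} {z : Total} (hP : DifferentiableAt ℝ P z.1)
    (hK : DifferentiableAt ℝ K z.1) (C : Fin 4 → ℝ) (A B : Fin 3 → ℝ)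
    (hX : X =ᶠ[𝓝 z] fun z => planeField (homothety C) z + kernelField A B z) :
    AdmitsFieldAt (karmanSystem D E h P K) X z ↔
      (2 * P z.1 * divergence (homothety C) z.1 + fieldDeriv (homothety C) P z.1 = 0 ∧
        2 * K z.1 * divergence (homothety C) z.1 + fieldDeriv (homothety C) K z.1 = 0) := by
  have e : (fun z => planeField (homothety C) z + kernelField A B z)
      = fieldOf (fun i => liftS (homS C i)) (fun a => liftS (affS (![A, B] a))) := by
    funext y
    refine Prod.ext (funext fun i => ?_) (funext fun a => ?_)
    · change homothety C y.1 i + 0 = _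
      rw [add_zero]; exact (evalAt_homS C y.1 i).symm
    · change (0 : ℝ) + _ = evalAt y.1 (affS (![A, B] a))
      rw [zero_add, evalAt_affS]; fin_cases a <;> rfl
  have hk : 1 / (E * h) ≠ 0 := by positivity
  have hv : (fun i => evalAt z (liftS (homS C i))) = homothety C z.1 :=
    funext fun i => evalAt_homS C z.1 i
  rw [e] at hX
  rw [admitsFieldAt_karmanSystem_iff hP hK hX, linAdmits_homothety_iff hD.ne' hk, hv,
    divergence_homothety, fieldDeriv_eq, fieldDeriv_eq]
  constructor <;> rintro ⟨h1, h2⟩ <;> constructor <;> linarith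

/-! ### The classification for the von Kármán equations -/

theorem total_decomp (z : Total) : z = z.1 0 • ((Pi.single 0 1, 0) : Total)
    + z.1 1 • ((Pi.single 1 1, 0) : Total) + z.2 0 • ((0, Pi.single 0 1) : Total)
    + z.2 1 • ((0, Pi.single 1 1) : Total) := by
  refine Prod.ext ?_ ?_
  · ext k; fin_cases k <;> simp
  · ext k; fin_cases k <;> simp

/-- Checked on a basis of ℝ⁴. Entries with a u-direction vanish because the u-derivatives vanish
near z, and by symmetry. -/
theorem fderiv_fderiv_eq_zero {G : Total → ℝ} {g : SmoothFn Total} {z : Total}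
    (hG : G =ᶠ[𝓝 z] (g : Total → ℝ))
    (hu : ∀ᶠ y in 𝓝 z, ∀ b, evalAt y (tdu b g) = 0)
    (hx : ∀ i j, evalAt z (tdx i (tdx j g)) = 0) : fderiv ℝ (fderiv ℝ G) z = 0 := by
  rw [hG.fderiv.fderiv_eq]
  have h1 : ∀ e b, fderiv ℝ (fderiv ℝ (g : Total → ℝ)) z e ((0, Pi.single b 1) : Total) = 0 := by
    intro e b
    have : ∀ᶠ y in 𝓝 z, evalAt y (tdu b g) = evalAt y 0 := hu.mono fun y hy => by rw [hy, map_zero]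
    have := (eventually_evalAt_dirDeriv_congr this e).self_of_nhds
    rw [map_zero, map_zero] at this
    rw [← dirDeriv_dirDeriv_apply]; exact this
  have h2 : ∀ e b, fderiv ℝ (fderiv ℝ (g : Total → ℝ)) z ((0, Pi.single b 1) : Total) e = 0 := by
    intro e b
    rw [← dirDeriv_dirDeriv_apply, dirDeriv_comm, dirDeriv_dirDeriv_apply, h1]
  have h3 : ∀ i j, fderiv ℝ (fderiv ℝ (g : Total → ℝ)) z ((Pi.single i 1, 0) : Total)
      ((Pi.single j 1, 0) : Total) = 0 := fun i j => by
    rw [← dirDeriv_dirDeriv_apply]; exact hx i j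
  refine ContinuousLinearMap.ext fun e => ContinuousLinearMap.ext fun e' => ?_
  rw [total_decomp e, total_decomp e']
  simp only [map_add, map_smul, add_apply, smul_apply, h1, h2, h3]
  simp

/-- Connectedness is used twice: for the derivative, and for the difference from its linear part. -/
theorem exists_affine {M : Set Total} (hM : IsOpen M) (hc : IsConnected M) {G : Total → ℝ}
    (hG : ContDiffOn ℝ ∞ G M) (h : ∀ z ∈ M, fderiv ℝ (fderiv ℝ G) z = 0) :
    ∃ (l : Total →L[ℝ] ℝ) (c : ℝ), ∀ z ∈ M, fderiv ℝ G z = l ∧ G z = l z + c := by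
  obtain ⟨l, hl⟩ := hM.exists_is_const_of_fderiv_eq_zero hc.isPreconnected (f := fderiv ℝ G)
    ((hG.fderiv_of_isOpen hM (m := ∞) (by simp)).differentiableOn (by simp)) h
  have hd : DifferentiableOn ℝ G M := hG.differentiableOn (by simp)
  obtain ⟨c, hc⟩ := hM.exists_is_const_of_fderiv_eq_zero hc.isPreconnected
    (f := fun z => G z - l z) (hd.sub l.differentiable.differentiableOn) (fun z hz => by
      rw [fderiv_fun_sub (hd.differentiableAt (hM.mem_nhds hz)) l.differentiableAt, hl z hz,
        ContinuousLinearMap.fderiv]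
      exact sub_self _)
  exact ⟨l, c, fun z hz => ⟨hl z hz, by rw [← hc z hz]; ring⟩⟩

/-- Each stage differentiates the conclusions of the one before, so all are drawn on a
neighbourhood, where the cut-off field still agrees with `X`. -/
theorem AdmitsField.eventually_affineAt {D E h : ℝ} (hD : 0 < D) (hE : 0 < E) (hh : 0 < h)
    {P K : Plane → ℝ} {M : Set Total} (hM : IsOpen M) (hP : ∀ z ∈ M, DifferentiableAt ℝ P z.1)
    (hK : ∀ z ∈ M, DifferentiableAt ℝ K z.1) {X : Total → Total} (hX : ContDiffOn ℝ ∞ X M)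
    (H : AdmitsField (karmanSystem D E h P K) M X) {z : Total} (hz : z ∈ M) :
    ∃ ξ η : Fin 2 → SmoothFn Total, X =ᶠ[𝓝 z] fieldOf ξ η ∧ ∀ᶠ y in 𝓝 z, AffineAt ξ η y := by
  obtain ⟨X', hX', hXX'⟩ := exists_contDiff_eventuallyEq hM hX hz
  refine ⟨compnt hX'.fst, compnt hX'.snd, hXX'.symm, ?_⟩
  set ξ := compnt hX'.fst
  set η := compnt hX'.snd
  have hk : 1 / (E * h) ≠ 0 := by positivity
  have L : ∀ᶠ y in 𝓝 z, ∃ P₀ K₀ p' k' : ℝ, LinAdmits D (1 / (E * h)) P₀ K₀ p' k' ξ η y.1 y.2 := by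
    filter_upwards [hM.mem_nhds hz, hXX'.eventuallyEq_nhds] with y hy hy'
    exact ⟨_, _, _, _, (admitsFieldAt_karmanSystem_iff (hP y hy) (hK y hy)
      (ξ := ξ) (η := η) hy'.symm).1 (admitsField_iff.1 H y hy)⟩
  have hξ : ∀ᶠ y in 𝓝 z, ConformalAt ξ y := L.mono fun y hy => by
    obtain ⟨_, _, _, _, hy⟩ := hy; exact hy.conformalAt hD.ne' hk
  have hη : ∀ᶠ y in 𝓝 z, QuasilinearAt ξ η y := by
    filter_upwards [L, hξ.eventually_nhds] with y hy hy'
    obtain ⟨_, _, _, _, hy⟩ := hy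
    exact hy.quasilinearAt hD.ne' hk (conformalNear hy')
  filter_upwards [L, hξ.eventually_nhds, hη.eventually_nhds] with y hy h1 h2
  obtain ⟨_, _, _, _, hy⟩ := hy
  exact hy.affineAt hD.ne' hk h1 h2

/-- The components are affine on all of `M`, so their coefficients can be read off at one point;
there the Cauchy-Riemann relations leave two constants for the linear part of ξ. -/
theorem exists_affine_field {D E h : ℝ} (hD : 0 < D) (hE : 0 < E) (hh : 0 < h)
    {P K : Plane → ℝ} {M : Set Total} (hM : IsOpen M) (hc : IsConnected M)
    (hP : ∀ z ∈ M, DifferentiableAt ℝ P z.1)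
    (hK : ∀ z ∈ M, DifferentiableAt ℝ K z.1) {X : Total → Total} (hX : ContDiffOn ℝ ∞ X M)
    (H : AdmitsField (karmanSystem D E h P K) M X) :
    ∃ (C : Fin 4 → ℝ) (A B : Fin 3 → ℝ),
      ∀ z ∈ M, X z = planeField (homothety C) z + kernelField A B z := by
  have loc := fun z hz => AdmitsField.eventually_affineAt hD hE hh hM hP hK hX H (z := z) hz
  have hX1 : ∀ i, ContDiffOn ℝ ∞ (fun z => (X z).1 i) M := fun i =>
    contDiffOn_pi.1 hX.fst i
  have hX2 : ∀ a, ContDiffOn ℝ ∞ (fun z => (X z).2 a) M := fun a =>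
    contDiffOn_pi.1 hX.snd a
  have e1 : ∀ {z ξ η}, X =ᶠ[𝓝 z] fieldOf ξ η → ∀ i, (fun z => (X z).1 i) =ᶠ[𝓝 z] (ξ i : Total → ℝ) :=
    fun hz i => hz.mono fun y hy => by simp only [hy]; rfl
  have e2 : ∀ {z ξ η}, X =ᶠ[𝓝 z] fieldOf ξ η → ∀ a, (fun z => (X z).2 a) =ᶠ[𝓝 z] (η a : Total → ℝ) :=
    fun hz i => hz.mono fun y hy => by simp only [hy]; rfl
  have a1 := fun i => exists_affine hM hc (hX1 i) fun z hz => by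
    obtain ⟨ξ, η, hX', ha⟩ := loc z hz
    exact fderiv_fderiv_eq_zero (e1 hX' i) (ha.mono fun y hy => hy.tdu_left i)
      (ha.self_of_nhds.tdx_left i)
  have a2 := fun a => exists_affine hM hc (hX2 a) fun z hz => by
    obtain ⟨ξ, η, hX', ha⟩ := loc z hz
    exact fderiv_fderiv_eq_zero (e2 hX' a) (ha.mono fun y hy => hy.tdu_right a)
      (ha.self_of_nhds.tdx_right a)
  choose l c hl using a1
  choose m d hm using a2
  obtain ⟨z₀, hz₀⟩ := hc.nonempty
  obtain ⟨ξ, η, hX', ha⟩ := loc z₀ hz₀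
  have ha := ha.self_of_nhds
  have fl : ∀ i e, l i e = evalAt z₀ (dirDeriv e (ξ i)) := fun i e => by
    rw [← (hl i z₀ hz₀).1, (e1 hX' i).fderiv_eq]; rfl
  have fm : ∀ a e, m a e = evalAt z₀ (dirDeriv e (η a)) := fun a e => by
    rw [← (hm a z₀ hz₀).1, (e2 hX' a).fderiv_eq]; rfl
  refine ⟨![evalAt z₀ (tdx 0 (ξ 0)), evalAt z₀ (tdx 1 (ξ 0)), c 0, c 1],
    ![m 0 (Pi.single 0 1, 0), m 0 (Pi.single 1 1, 0), d 0],
    ![m 1 (Pi.single 0 1, 0), m 1 (Pi.single 1 1, 0), d 1], fun z hz => ?_⟩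
  have q1 : ∀ i, (X z).1 i = z.1 0 * evalAt z₀ (tdx 0 (ξ i)) + z.1 1 * evalAt z₀ (tdx 1 (ξ i)) + c i :=
    fun i => by
      rw [(hl i z hz).2]
      conv_lhs => rw [total_decomp z]
      simp only [map_add, map_smul]
      simp only [fl, ha.tdu_left, smul_eq_mul]
      ring
  have q2 : ∀ a, (X z).2 a = z.1 0 * m a (Pi.single 0 1, 0) + z.1 1 * m a (Pi.single 1 1, 0) + d a :=
    fun a => by
      rw [(hm a z hz).2]
      conv_lhs => rw [total_decomp z]
      have : ∀ b, m a (0, Pi.single b 1) = 0 := fun b => by rw [fm]; exact ha.tdu_right a b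
      simp only [map_add, map_smul, this, smul_eq_mul]
      ring
  refine Prod.ext (funext fun i => ?_) (funext fun a => ?_)
  · rw [q1]
    fin_cases i
    · simp [planeField, kernelField, homothety]; ring
    · simp [planeField, kernelField, homothety, ← ha.diag, ha.skew]; ring
  · rw [q2]
    fin_cases a <;> simp [planeField, kernelField] <;> ring

theorem admitsField_karmanSystem_iff {D E h : ℝ} (hD : 0 < D) (hE : 0 < E) (hh : 0 < h)
    {P K : Plane → ℝ} {M : Set Total} (hM : IsOpen M) (hP : ∀ z ∈ M, DifferentiableAt ℝ P z.1)
    (hK : ∀ z ∈ M, DifferentiableAt ℝ K z.1) {X : Total → Total} {C : Fin 4 → ℝ}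
    {A B : Fin 3 → ℝ} (hX : ∀ z ∈ M, X z = planeField (homothety C) z + kernelField A B z) :
    AdmitsField (karmanSystem D E h P K) M X ↔
      InvarianceCondition (homothety C) P (Prod.fst '' M) ∧
        InvarianceCondition (homothety C) K (Prod.fst '' M) := by
  rw [admitsField_iff]
  have : ∀ z ∈ M, (AdmitsFieldAt (karmanSystem D E h P K) X z ↔ _) := fun z hz =>
    admitsFieldAt_homothety_iff hD hE hh (hP z hz) (hK z hz) C A B
      (by filter_upwards [hM.mem_nhds hz] with y hy using hX y hy)
  rw [forall₂_congr this]
  simp only [InvarianceCondition, forall_mem_image]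
  exact ⟨fun H => ⟨fun z hz => (H z hz).1, fun z hz => (H z hz).2⟩,
    fun H z hz => ⟨H.1 hz, H.2 hz⟩⟩

/-! ### Reduction of Marguerre's equations to the von Kármán equations -/

section Geometry

variable {D : ℝ} {f p : Plane → ℝ} {x : Plane} {g : SmoothFn Plane}

theorem curvTensor_eq (hg : (g : Plane → ℝ) =ᶠ[𝓝 x] f) : curvTensor f x = hessS x g := by
  ext α β
  rw [curvTensor, ← (iterPd_congr hg [α, β]).self_of_nhds, iterPd_coe]; rfl

theorem gaussCurv_eq (hg : (g : Plane → ℝ) =ᶠ[𝓝 x] f) :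
    gaussCurv f x = 1 / 2 * bracket (hessS x g) (hessS x g) := by
  rw [gaussCurv, curvTensor_eq hg]

theorem meanCurv_eventuallyEq (hg : (g : Plane → ℝ) =ᶠ[𝓝 x] f) :
    meanCurv f =ᶠ[𝓝 x] ((1 / 2 : ℝ) • ∑ α, pdS α (pdS α g) : SmoothFn Plane) := by
  filter_upwards [hg.eventuallyEq_nhds] with y hy
  rw [meanCurv, curvTensor_eq hy]
  simp only [Fin.sum_univ_two]; rfl

theorem effLoad_eq (hg : (g : Plane → ℝ) =ᶠ[𝓝 x] f) :
    effLoad D f p x = D * evalAt x (bilapS g) + p x := by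
  have h : ∀ μ, iterPd [μ, μ] (meanCurv f) x
      = evalAt x (pdS μ (pdS μ ((1 / 2 : ℝ) • ∑ α, pdS α (pdS α g)))) := fun μ => by
    rw [(iterPd_congr (meanCurv_eventuallyEq hg) [μ, μ]).self_of_nhds, iterPd_coe]; rfl
  simp only [effLoad, h, Fin.sum_univ_two, Derivation.map_smul, map_add, map_smul, smul_eq_mul,
    bilapS_apply, pdS_comm]
  ring

theorem differentiableAt_effLoad (hg : (g : Plane → ℝ) =ᶠ[𝓝 x] f) (hp : DifferentiableAt ℝ p x) :
    DifferentiableAt ℝ (effLoad D f p) x := by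
  have e : effLoad D f p =ᶠ[𝓝 x] fun y => D * (bilapS g : Plane → ℝ) y + p y := by
    filter_upwards [hg.eventuallyEq_nhds] with y hy using effLoad_eq hy
  exact (((differentiable_coe (bilapS g) x).const_mul D).add hp).congr_of_eventuallyEq e

theorem differentiableAt_gaussCurv (hg : (g : Plane → ℝ) =ᶠ[𝓝 x] f) :
    DifferentiableAt ℝ (gaussCurv f) x := by
  have hd : ∀ α β, DifferentiableAt ℝ (fun y => hessS y g α β) x := fun α β =>
    differentiable_coe (pdS α (pdS β g)) x
  have e : gaussCurv f =ᶠ[𝓝 x] fun y => 1 / 2 * bracket (hessS y g) (hessS y g) := by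
    filter_upwards [hg.eventuallyEq_nhds] with y hy using gaussCurv_eq hy
  refine DifferentiableAt.congr_of_eventuallyEq ?_ e
  simp only [bracket_eq]
  fun_prop

end Geometry

theorem iterPdS_zero (J : List (Fin 2)) : iterPdS J 0 = 0 := by
  have := iterPdS_smul J 0 0
  rwa [zero_smul, zero_smul] at this

theorem bracket_add_left (a a' b : Fin 2 → Fin 2 → ℝ) :
    bracket (a + a') b = bracket a b + bracket a' b := by
  simp only [bracket_eq, Pi.add_apply]; ring

/-- The action on jets of the translation of `w` by a function. -/
noncomputable def shiftJet (g : SmoothFn Plane) (j : Jet) : Jet :=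
  (j.1, fun a J => j.2 a J + if a = 0 then evalAt j.1 (iterPdS J g) else 0)

/-- Expand the bilaplacian and the brackets of w + f: the terms in f alone are those absorbed by P,
since 2DΔH = DΔ²f, and by K. Only the germ of f at the base point enters. -/
theorem marguerreSystem_eq {D E h : ℝ} {f p : Plane → ℝ} {g : SmoothFn Plane} {j : Jet}
    (hg : (g : Plane → ℝ) =ᶠ[𝓝 j.1] f) :
    marguerreSystem D E h f p j
      = karmanSystem D E h (effLoad D f p) (gaussCurv f) (shiftJet g j) := by
  have h0 : hess (shiftJet g j) 0 = hess j 0 + hessS j.1 g := by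
    ext α β; rfl
  have h1 : hess (shiftJet g j) 1 = hess j 1 := by
    ext α β; simp [hess, shiftJet]
  have b0 : bilap (shiftJet g j) 0 = bilap j 0 + evalAt j.1 (bilapS g) := by
    simp only [bilap, shiftJet, Fin.sum_univ_two, if_true, bilapS_apply, map_add, iterPdS_cons,
      iterPdS_nil, pdS_comm, map_smul, smul_eq_mul]
    ring
  have b1 : bilap (shiftJet g j) 1 = bilap j 1 := by simp [bilap, shiftJet]
  have hx : (shiftJet g j).1 = j.1 := rfl
  ext k
  fin_cases k
  · simp only [marguerreSystem, karmanSystem, h0, h1, b0, hx, curvTensor_eq hg, effLoad_eq hg,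
      bracket_add_left]
    simp
    ring
  · simp only [marguerreSystem, karmanSystem, h0, b1, hx, curvTensor_eq hg, gaussCurv_eq hg,
      bracket_add_left, bracket_comm _ (hess j 0 + hessS j.1 g)]
    simp
    rw [bracket_comm (hess j 0) (hessS j.1 g)]
    ring

/-- The translation `(x, w, Φ) ↦ (x, w + f x, Φ)`. -/
def shear (f : Plane → ℝ) (z : Total) : Total := (z.1, ![z.2 0 + f z.1, z.2 1])

/-- The image of a vector field under `shear f`. -/
noncomputable def shearField (f : Plane → ℝ) (X : Total → Total) (z : Total) : Total :=
  ((X (shear (-f) z)).1, ![(X (shear (-f) z)).2 0 + fderiv ℝ f z.1 (X (shear (-f) z)).1,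
    (X (shear (-f) z)).2 1])

theorem shear_neg_shear (f : Plane → ℝ) (z : Total) : shear (-f) (shear f z) = z := by
  refine Prod.ext rfl (funext fun a => ?_)
  fin_cases a <;> simp [shear]

theorem shear_shear_neg (f : Plane → ℝ) (z : Total) : shear f (shear (-f) z) = z := by
  refine Prod.ext rfl (funext fun a => ?_)
  fin_cases a <;> simp [shear]

theorem shift_graph {f : Plane → ℝ} {g : SmoothFn Plane} {y : Plane} (hy : evalAt y g = f y)
    (w : Fin 2 → SmoothFn Plane) :
    ((y, fun b => evalAt y ((w + ![g, 0]) b)) : Total) = shear f (y, fun b => evalAt y (w b)) := by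
  refine Prod.ext rfl (funext fun b => ?_)
  fin_cases b
  · simp [shear, hy]
  · simp [shear]

theorem jet_shift (w : Fin 2 → SmoothFn Plane) (g : SmoothFn Plane) (x : Plane) :
    jet (fun y b => evalAt y ((w + ![g, 0]) b)) x = shiftJet g (jet (fun y b => evalAt y (w b)) x) := by
  refine Prod.ext rfl (funext fun a => funext fun J => ?_)
  rw [jet_snd]
  simp only [shiftJet, jet_snd, Pi.add_apply, iterPdS_add, map_add]
  fin_cases a
  · rfl
  · simp [iterPdS_zero]

/-- The characteristic is invariant: η^0 and ξ·∇w both gain ξ·∇f. The prolongations therefore differ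
only in the terms ξ^i u_{,Ji}. -/
theorem prolongation_shift {f : Plane → ℝ} {g : SmoothFn Plane} {x : Plane}
    (hg : (g : Plane → ℝ) =ᶠ[𝓝 x] f) (X : Total → Total) (w : Fin 2 → SmoothFn Plane) :
    prolongation (shearField f X) (fun y b => evalAt y ((w + ![g, 0]) b)) x
      = ((prolongation X (fun y b => evalAt y (w b)) x).1, fun a J =>
        (prolongation X (fun y b => evalAt y (w b)) x).2 a J + if a = 0 then
          fderiv ℝ (iterPdS J g : Plane → ℝ) x (prolongation X (fun y b => evalAt y (w b)) x).1
          else 0) := by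
  obtain ⟨W, hW⟩ : ∃ W, W = w + ![g, 0] := ⟨_, rfl⟩
  have hX : ∀ y, (g : Plane → ℝ) =ᶠ[𝓝 y] f →
      shearField f X (y, fun b => evalAt y (W b))
      = ((X (y, fun b => evalAt y (w b))).1, ![(X (y, fun b => evalAt y (w b))).2 0
        + fderiv ℝ (g : Plane → ℝ) y (X (y, fun b => evalAt y (w b))).1,
        (X (y, fun b => evalAt y (w b))).2 1]) := fun y hy => by
    rw [hW, shift_graph hy.self_of_nhds, shearField, shear_neg_shear, hy.fderiv_eq]; rfl
  have hf : ∀ (k : SmoothFn Plane) (y e : Plane), fderiv ℝ (k : Plane → ℝ) y e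
      = ∑ i, e i * evalAt y (pdS i k) := fun k y e =>
    (fieldDeriv_eq (fun _ => e) k y).symm
  have hpd : ∀ (k : SmoothFn Plane) (i : Fin 2) (y : Plane),
      pd i (fun y => evalAt y k) y = evalAt y (pdS i k) := fun k i y => rfl
  rw [← hW]
  have hchar : ∀ a, characteristic (shearField f X) (fun y b => evalAt y (W b)) a
      =ᶠ[𝓝 x] characteristic X (fun y b => evalAt y (w b)) a := fun a => by
    filter_upwards [hg.eventuallyEq_nhds] with y hy
    simp only [characteristic, hX y hy, hpd, Fin.sum_univ_two, hf]
    simp only [hW, Pi.add_apply, map_add]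
    fin_cases a
    · simp; ring
    · simp
  refine Prod.ext (show (shearField f X (x, fun b => evalAt x (W b))).1 = _ by rw [hX x hg]; rfl)
    (funext fun a => funext fun J => ?_)
  have h2 : ∀ (k : SmoothFn Plane) i, iterPd (i :: J) (fun y => evalAt y k) x
      = evalAt x (pdS i (iterPdS J k)) := fun k i => congrFun (iterPd_coe (i :: J) k) x
  simp only [prolongation, (iterPd_congr (hchar a) J).self_of_nhds, hX x hg, h2, hf,
    Fin.sum_univ_two]
  simp only [hW, Pi.add_apply, iterPdS_add, map_add]
  fin_cases a
  · simp; ring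
  · simp [iterPdS_zero]

theorem admitsFieldAt_marguerreSystem_iff {D E h : ℝ} {f p : Plane → ℝ} {X : Total → Total}
    {z : Total} {g : SmoothFn Plane} (hg : (g : Plane → ℝ) =ᶠ[𝓝 z.1] f)
    (hp : DifferentiableAt ℝ p z.1) :
    AdmitsFieldAt (marguerreSystem D E h f p) X z ↔
      AdmitsFieldAt (karmanSystem D E h (effLoad D f p) (gaussCurv f)) (shearField f X)
        (shear f z) := by
  have hP := differentiableAt_effLoad (D := D) hg hp
  have hK := differentiableAt_gaussCurv hg
  have key : ∀ w : Fin 2 → SmoothFn Plane,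
      ((marguerreSystem D E h f p (jet (fun y b => evalAt y (w b)) z.1) = 0 →
        ∀ k, HasDerivAt (fun ε : ℝ => marguerreSystem D E h f p
          (jet (fun y b => evalAt y (w b)) z.1
            + ε • prolongation X (fun y b => evalAt y (w b)) z.1) k) 0 0) ↔
      (karmanSystem D E h (effLoad D f p) (gaussCurv f)
          (jet (fun y b => evalAt y ((w + ![g, 0]) b)) z.1) = 0 →
        ∀ k, HasDerivAt (fun ε : ℝ => karmanSystem D E h (effLoad D f p) (gaussCurv f)
          (jet (fun y b => evalAt y ((w + ![g, 0]) b)) z.1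
            + ε • prolongation (shearField f X)
              (fun y b => evalAt y ((w + ![g, 0]) b)) z.1) k) 0 0)) := by
    intro w
    rw [jet_shift, ← marguerreSystem_eq (j := jet (fun y b => evalAt y (w b)) z.1) hg]
    refine imp_congr_right fun _ => forall_congr' fun k => ?_
    set j := jet (fun y b => evalAt y (w b)) z.1 with hj
    set v := prolongation X (fun y b => evalAt y (w b)) z.1 with hv
    have hjz : j.1 = z.1 := rfl
    have h1 : HasDerivAt (fun ε : ℝ => j.1 + ε • v.1) v.1 0 := by
      simpa using ((hasDerivAt_id (0 : ℝ)).smul_const v.1).const_add j.1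
    have hline : Tendsto (fun ε : ℝ => j.1 + ε • v.1) (𝓝 0) (𝓝 z.1) := by
      simpa [hjz] using h1.continuousAt.tendsto
    have e : (fun ε : ℝ => marguerreSystem D E h f p (j + ε • v) k) =ᶠ[𝓝 0]
        fun ε => karmanSystem D E h (effLoad D f p) (gaussCurv f) (shiftJet g (j + ε • v)) k := by
      filter_upwards [hline.eventually hg.eventuallyEq_nhds] with ε hε
      rw [marguerreSystem_eq hε]
    have hs : shiftJet g (j + (0 : ℝ) • v) = shiftJet g j := by rw [zero_smul, add_zero]
    -- The translated line is a curve whose velocity at 0 is the prolongation of the image field.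
    -- `B` below concerns the straight line with the same velocity, and both derivatives have the
    -- same value.
    have A := hasDerivAt_karmanSystem (D := D) (E := E) (h := h) (P := effLoad D f p)
      (K := gaussCurv f) (c := fun ε : ℝ => shiftJet g (j + ε • v))
      (v := prolongation (shearField f X) (fun y b => evalAt y ((w + ![g, 0]) b)) z.1)
      (by simp only [hs]; exact hP) (by simp only [hs]; exact hK)
      (by rw [prolongation_shift hg]; exact h1) (fun a J => by
        rw [prolongation_shift hg]
        have h2 : HasDerivAt (fun ε : ℝ => j.2 a J + ε * v.2 a J) (v.2 a J) 0 := by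
          simpa using ((hasDerivAt_id (0 : ℝ)).mul_const (v.2 a J)).const_add (j.2 a J)
        by_cases ha : a = 0
        · simp only [shiftJet, ha, if_true]
          have h0 : j.1 + (0 : ℝ) • v.1 = z.1 := by rw [zero_smul, add_zero, hjz]
          have h3 : HasFDerivAt (iterPdS J g : Plane → ℝ)
              (fderiv ℝ (iterPdS J g : Plane → ℝ) z.1) (j.1 + (0 : ℝ) • v.1) := by
            rw [h0]; exact (differentiable_coe _ _).hasFDerivAt
          subst ha
          exact h2.add (h3.comp_hasDerivAt (0 : ℝ) h1)
        · simp only [shiftJet, ha, if_false, add_zero]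
          exact h2) k
    simp only [hs] at A
    have B := hasDerivAt_karmanSystem_line (D := D) (E := E) (h := h) (P := effLoad D f p)
      (K := gaussCurv f) (j := shiftJet g j)
      (prolongation (shearField f X) (fun y b => evalAt y ((w + ![g, 0]) b)) z.1) hP hK k
    rw [e.hasDerivAt_iff]
    exact ⟨fun H => (A.unique H) ▸ B, fun H => (B.unique H) ▸ A⟩
  constructor
  · intro H u hu hz
    have hu' : (fun y b => evalAt y (((fun a => compnt hu a) - ![g, 0] + ![g, 0]) b)) = u := by
      rw [sub_add_cancel]; rfl
    have hz' : (fun b => evalAt z.1 (((fun a => compnt hu a) - ![g, 0]) b)) = z.2 := by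
      have e1 : ∀ b, evalAt z.1 (compnt hu b) = ![z.2 0 + f z.1, z.2 1] b := fun b => congrFun hz b
      have e2 : evalAt z.1 g = f z.1 := hg.self_of_nhds
      funext b
      rw [Pi.sub_apply, map_sub, e1]
      fin_cases b
      · simp [e2]
      · simp
    have := (key ((fun a => compnt hu a) - ![g, 0])).1 (H _ (contDiff_evalAt _) hz')
    rw [hu'] at this
    exact this
  · intro H u hu hz
    refine (key (compnt hu)).2 (H _ (contDiff_evalAt _) ?_)
    have := congrArg Prod.snd (shift_graph (f := f) hg.self_of_nhds (compnt hu))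
    refine this.trans ?_
    rw [show (fun b => evalAt z.1 (compnt hu b)) = z.2 from hz]

/-! ### Classification for Marguerre's equations -/

section Classification

variable {D E h : ℝ} {Ω : Set Plane} {f p : Plane → ℝ}

theorem exists_smoothFn_eventuallyEq (hΩ : IsOpen Ω) (hf : ContDiffOn ℝ ∞ f Ω) {x : Plane}
    (hx : x ∈ Ω) : ∃ g : SmoothFn Plane, (g : Plane → ℝ) =ᶠ[𝓝 x] f := by
  obtain ⟨k, hk, hkf⟩ := exists_contDiff_eventuallyEq hΩ hf hx
  exact ⟨⟨k, hk⟩, hkf⟩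

theorem admitsField_marguerreSystem_iff_shear (hΩ : IsOpen Ω) (hf : ContDiffOn ℝ ∞ f Ω)
    (hp : ContDiffOn ℝ ∞ p Ω) {M : Set Total} (hM : M ⊆ Ω ×ˢ univ) (X : Total → Total) :
    AdmitsField (marguerreSystem D E h f p) M X ↔
      AdmitsField (karmanSystem D E h (effLoad D f p) (gaussCurv f)) (shear f '' M)
        (shearField f X) := by
  rw [admitsField_iff, admitsField_iff, forall_mem_image]
  refine forall₂_congr fun z hz => ?_
  obtain ⟨g, hg⟩ := exists_smoothFn_eventuallyEq hΩ hf (hM hz).1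
  exact admitsFieldAt_marguerreSystem_iff hg
    ((hp.contDiffAt (hΩ.mem_nhds (hM hz).1)).differentiableAt (by simp))

theorem contDiffOn_shear (hf : ContDiffOn ℝ ∞ f Ω) : ContDiffOn ℝ ∞ (shear f) (Ω ×ˢ univ) := by
  have h1 : ContDiffOn ℝ ∞ (fun z : Total => f z.1) (Ω ×ˢ univ) :=
    hf.comp contDiffOn_fst fun z hz => hz.1
  refine contDiffOn_fst.prodMk (contDiffOn_pi.2 fun a => ?_)
  fin_cases a
  · exact ((contDiff_pi.1 contDiff_snd 0).contDiffOn).add h1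
  · exact (contDiff_pi.1 contDiff_snd 1).contDiffOn

theorem shear_image_eq {M : Set Total} (hM : M ⊆ Ω ×ˢ univ) :
    shear f '' M = (Ω ×ˢ univ) ∩ shear (-f) ⁻¹' M := by
  ext z
  constructor
  · rintro ⟨y, hy, rfl⟩
    exact ⟨⟨(hM hy).1, trivial⟩, by rw [mem_preimage, shear_neg_shear]; exact hy⟩
  · rintro ⟨-, hz⟩
    exact ⟨_, hz, shear_shear_neg f z⟩

theorem isOpen_shear_image (hΩ : IsOpen Ω) (hf : ContDiffOn ℝ ∞ f Ω) {M : Set Total}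
    (hM : M ⊆ Ω ×ˢ univ) (hMo : IsOpen M) : IsOpen (shear f '' M) := by
  rw [shear_image_eq hM]
  exact (contDiffOn_shear hf.neg).continuousOn.isOpen_inter_preimage (hΩ.prod isOpen_univ) hMo

theorem contDiffOn_shearField (hΩ : IsOpen Ω) (hf : ContDiffOn ℝ ∞ f Ω) {M : Set Total}
    (hM : M ⊆ Ω ×ˢ univ) {X : Total → Total} (hX : ContDiffOn ℝ ∞ X M) :
    ContDiffOn ℝ ∞ (shearField f X) (shear f '' M) := by
  have hsub : shear f '' M ⊆ Ω ×ˢ univ := by rw [shear_image_eq hM]; exact inter_subset_left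
  have h1 : ContDiffOn ℝ ∞ (fun z => X (shear (-f) z)) (shear f '' M) :=
    hX.comp ((contDiffOn_shear hf.neg).mono hsub) fun z hz => by
      rw [shear_image_eq hM] at hz; exact hz.2
  have h2 : ContDiffOn ℝ ∞ (fun z : Total => fderiv ℝ f z.1) (shear f '' M) :=
    (hf.fderiv_of_isOpen hΩ (m := ∞) (by simp)).comp contDiffOn_fst fun z hz => (hsub hz).1
  have h3 := contDiffOn_pi.1 h1.snd
  refine h1.fst.prodMk (contDiffOn_pi.2 fun a => ?_)
  fin_cases a
  · exact (h3 0).add (h2.clm_apply h1.fst)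
  · exact h3 1

/-- The translation adds ξ·∇f to the w-component, cancelling that of `shellField`; kernel fields
depend on x only and are unaffected. -/
theorem shearField_eq_iff (ξ : Plane → Plane) (A B : Fin 3 → ℝ) (X : Total → Total) (z : Total) :
    shearField f X (shear f z) = planeField ξ (shear f z) + kernelField A B (shear f z) ↔
      X z = shellField f ξ z + kernelField A B z := by
  have F : ∀ v w : Fin 2 → ℝ, v = w ↔ v 0 = w 0 ∧ v 1 = w 1 := fun v w => by
    rw [funext_iff, Fin.forall_fin_two]
  rw [shearField, shear_neg_shear, Prod.ext_iff, Prod.ext_iff]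
  simp only [planeField, kernelField, shellField, shear, fieldDeriv_eq, Prod.fst_add, Prod.snd_add,
    add_zero, zero_add]
  refine and_congr_right fun h1 => ?_
  rw [h1, F, F]
  simp only [Pi.add_apply, Matrix.cons_val_zero, Matrix.cons_val_one, zero_add]
  refine and_congr_left fun _ => ?_
  constructor <;> intro h <;> linarith

theorem differentiableAt_data (hΩ : IsOpen Ω) (hf : ContDiffOn ℝ ∞ f Ω)
    (hp : ContDiffOn ℝ ∞ p Ω) {x : Plane} (hx : x ∈ Ω) :
    DifferentiableAt ℝ (effLoad D f p) x ∧ DifferentiableAt ℝ (gaussCurv f) x := by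
  obtain ⟨g, hg⟩ := exists_smoothFn_eventuallyEq hΩ hf hx
  exact ⟨differentiableAt_effLoad hg
    ((hp.contDiffAt (hΩ.mem_nhds hx)).differentiableAt (by simp)), differentiableAt_gaussCurv hg⟩

theorem admitsField_marguerreSystem_iff (hD : 0 < D) (hE : 0 < E) (hh : 0 < h) (hΩ : IsOpen Ω)
    (hf : ContDiffOn ℝ ∞ f Ω) (hp : ContDiffOn ℝ ∞ p Ω) {M : Set Total} (hMo : IsOpen M)
    (hM : M ⊆ Ω ×ˢ univ) {X : Total → Total} {C : Fin 4 → ℝ} {A B : Fin 3 → ℝ}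
    (hX : ∀ z ∈ M, X z = shellField f (homothety C) z + kernelField A B z) :
    AdmitsField (marguerreSystem D E h f p) M X ↔
      InvarianceCondition (homothety C) (effLoad D f p) (Prod.fst '' M) ∧
        InvarianceCondition (homothety C) (gaussCurv f) (Prod.fst '' M) := by
  have hd : ∀ z ∈ shear f '' M, _ := fun z hz => by
    rw [shear_image_eq hM] at hz; exact differentiableAt_data (D := D) hΩ hf hp hz.1.1
  rw [admitsField_marguerreSystem_iff_shear hΩ hf hp hM, admitsField_karmanSystem_iff hD hE hh
    (isOpen_shear_image hΩ hf hM hMo) (fun z hz => (hd z hz).1) (fun z hz => (hd z hz).2)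
    (C := C) (A := A) (B := B)
    (forall_mem_image.2 fun z hz => (shearField_eq_iff _ _ _ _ _).2 (hX z hz)), image_image]
  rfl

theorem marguerre_classification (hD : 0 < D) (hE : 0 < E) (hh : 0 < h) (hΩ : IsOpen Ω)
    (hf : ContDiffOn ℝ ∞ f Ω) (hp : ContDiffOn ℝ ∞ p Ω) {M : Set Total} (hMo : IsOpen M)
    (hMc : IsConnected M) (hM : M ⊆ Ω ×ˢ univ) {X : Total → Total} (hX : ContDiffOn ℝ ∞ X M) :
    AdmitsField (marguerreSystem D E h f p) M X ↔
      ∃ (C : Fin 4 → ℝ) (A B : Fin 3 → ℝ),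
        (∀ z ∈ M, X z = shellField f (homothety C) z + kernelField A B z) ∧
        InvarianceCondition (homothety C) (effLoad D f p) (Prod.fst '' M) ∧
        InvarianceCondition (homothety C) (gaussCurv f) (Prod.fst '' M) := by
  constructor
  · intro H
    have hd : ∀ z ∈ shear f '' M, _ := fun z hz => by
      rw [shear_image_eq hM] at hz; exact differentiableAt_data (D := D) hΩ hf hp hz.1.1
    obtain ⟨C, A, B, hC⟩ := exists_affine_field hD hE hh (isOpen_shear_image hΩ hf hM hMo)
      (hMc.image _ ((contDiffOn_shear hf).continuousOn.mono hM)) (fun z hz => (hd z hz).1)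
      (fun z hz => (hd z hz).2) (contDiffOn_shearField hΩ hf hM hX)
      ((admitsField_marguerreSystem_iff_shear hΩ hf hp hM X).1 H)
    have hX' : ∀ z ∈ M, X z = shellField f (homothety C) z + kernelField A B z := fun z hz =>
      (shearField_eq_iff _ _ _ _ _).1 (hC _ (mem_image_of_mem _ hz))
    exact ⟨C, A, B, hX', (admitsField_marguerreSystem_iff hD hE hh hΩ hf hp hMo hM hX').1 H⟩
  · rintro ⟨C, A, B, hX', H⟩
    exact (admitsField_marguerreSystem_iff hD hE hh hΩ hf hp hMo hM hX').2 H

theorem kernelField_zero (z : Total) : kernelField 0 0 z = 0 := by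
  refine Prod.ext rfl (funext fun a => ?_)
  fin_cases a <;> simp [kernelField]

end Classification

/-! ### The group of homothetic motions -/

/-- The real part of `exp ((C₁ + i C₂) t)`. -/
noncomputable def homCos (C : Fin 4 → ℝ) (t : ℝ) : ℝ := Real.exp (C 0 * t) * Real.cos (C 1 * t)

/-- The imaginary part of `exp ((C₁ + i C₂) t)`. -/
noncomputable def homSin (C : Fin 4 → ℝ) (t : ℝ) : ℝ := Real.exp (C 0 * t) * Real.sin (C 1 * t)

/-- The flow of an infinitesimal homothety. -/
noncomputable def homFlow (C : Fin 4 → ℝ) (t : ℝ) (x : Plane) : Plane :=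
  ![homCos C t * x 0 + homSin C t * x 1 + (∫ s in (0 : ℝ)..t, homCos C s) * C 2
      + (∫ s in (0 : ℝ)..t, homSin C s) * C 3,
    -homSin C t * x 0 + homCos C t * x 1 - (∫ s in (0 : ℝ)..t, homSin C s) * C 2
      + (∫ s in (0 : ℝ)..t, homCos C s) * C 3]

section Flow

variable (C : Fin 4 → ℝ)

theorem hasDerivAt_homCos (t : ℝ) :
    HasDerivAt (homCos C) (C 0 * homCos C t - C 1 * homSin C t) t := by
  have h0 : HasDerivAt (fun t => C 0 * t) (C 0) t := by
    simpa using (hasDerivAt_id t).const_mul (C 0)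
  have h1 : HasDerivAt (fun t => C 1 * t) (C 1) t := by
    simpa using (hasDerivAt_id t).const_mul (C 1)
  exact (h0.exp.mul h1.cos).congr_deriv (by rw [homCos, homSin]; ring)

theorem hasDerivAt_homSin (t : ℝ) :
    HasDerivAt (homSin C) (C 0 * homSin C t + C 1 * homCos C t) t := by
  have h0 : HasDerivAt (fun t => C 0 * t) (C 0) t := by
    simpa using (hasDerivAt_id t).const_mul (C 0)
  have h1 : HasDerivAt (fun t => C 1 * t) (C 1) t := by
    simpa using (hasDerivAt_id t).const_mul (C 1)
  exact (h0.exp.mul h1.sin).congr_deriv (by rw [homCos, homSin]; ring)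

theorem continuous_homCos : Continuous (homCos C) :=
  continuous_iff_continuousAt.2 fun t => (hasDerivAt_homCos C t).continuousAt

theorem continuous_homSin : Continuous (homSin C) :=
  continuous_iff_continuousAt.2 fun t => (hasDerivAt_homSin C t).continuousAt

theorem homCos_sq_add_homSin_sq (t : ℝ) :
    homCos C t ^ 2 + homSin C t ^ 2 = Real.exp (2 * C 0 * t) := by
  rw [homCos, homSin, mul_pow, mul_pow, ← mul_add, Real.cos_sq_add_sin_sq, mul_one, ← Real.exp_nat_mul]
  congr 1; push_cast; ring

/-- With `integral_homSin`, this is exp(ct) = 1 + c ∫ exp(cs) ds for c = `C 0` + i `C 1`. Keeping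
the translation part of the flow in integral form avoids a separate case c = 0. -/
theorem integral_homCos (t : ℝ) : C 0 * (∫ s in (0 : ℝ)..t, homCos C s)
    - C 1 * (∫ s in (0 : ℝ)..t, homSin C s) + 1 = homCos C t := by
  have h := intervalIntegral.integral_eq_sub_of_hasDerivAt (a := 0) (b := t)
    (fun s _ => hasDerivAt_homCos C s)
    ((((continuous_homCos C).const_mul (C 0)).sub ((continuous_homSin C).const_mul (C 1))).intervalIntegrable _ _)
  rw [intervalIntegral.integral_sub (((continuous_homCos C).const_mul _).intervalIntegrable _ _)
    (((continuous_homSin C).const_mul _).intervalIntegrable _ _),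
    intervalIntegral.integral_const_mul, intervalIntegral.integral_const_mul] at h
  rw [h]; simp [homCos]

theorem integral_homSin (t : ℝ) : C 0 * (∫ s in (0 : ℝ)..t, homSin C s)
    + C 1 * (∫ s in (0 : ℝ)..t, homCos C s) = homSin C t := by
  have h := intervalIntegral.integral_eq_sub_of_hasDerivAt (a := 0) (b := t)
    (fun s _ => hasDerivAt_homSin C s)
    ((((continuous_homSin C).const_mul (C 0)).add ((continuous_homCos C).const_mul (C 1))).intervalIntegrable _ _)
  rw [intervalIntegral.integral_add (((continuous_homSin C).const_mul _).intervalIntegrable _ _)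
    (((continuous_homCos C).const_mul _).intervalIntegrable _ _),
    intervalIntegral.integral_const_mul, intervalIntegral.integral_const_mul] at h
  rw [h]; simp [homSin]

theorem hasDerivAt_homFlow (x : Plane) (t : ℝ) :
    HasDerivAt (fun t => homFlow C t x) (homothety C (homFlow C t x)) t := by
  have hc := hasDerivAt_homCos C t
  have hs := hasDerivAt_homSin C t
  have ic : HasDerivAt (fun t => ∫ s in (0 : ℝ)..t, homCos C s) (homCos C t) t :=
    (continuous_homCos C).integral_hasStrictDerivAt 0 t |>.hasDerivAt
  have is : HasDerivAt (fun t => ∫ s in (0 : ℝ)..t, homSin C s) (homSin C t) t :=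
    (continuous_homSin C).integral_hasStrictDerivAt 0 t |>.hasDerivAt
  have e1 := integral_homCos C t
  have e2 := integral_homSin C t
  rw [hasDerivAt_pi]
  intro i
  fin_cases i
  · refine ((((hc.mul_const (x 0)).add (hs.mul_const (x 1))).add (ic.mul_const (C 2))).add
      (is.mul_const (C 3))).congr_deriv ?_
    simp [homothety, homFlow]
    linear_combination (-C 2) * e1 - C 3 * e2
  · refine ((((hs.neg.mul_const (x 0)).add (hc.mul_const (x 1))).sub (is.mul_const (C 2))).add
      (ic.mul_const (C 3))).congr_deriv ?_
    simp [homothety, homFlow]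
    linear_combination (-C 3) * e1 + C 2 * e2

@[simp] theorem homFlow_zero (x : Plane) : homFlow C 0 x = x := by
  ext i; fin_cases i <;> simp [homFlow, homCos, homSin]

theorem continuous_homFlow : Continuous fun q : ℝ × Plane => homFlow C q.1 q.2 := by
  have hc := continuous_homCos C
  have hs := continuous_homSin C
  have ic : Continuous fun t => ∫ s in (0 : ℝ)..t, homCos C s :=
    continuous_iff_continuousAt.2 fun t =>
      ((continuous_homCos C).integral_hasStrictDerivAt 0 t).hasDerivAt.continuousAt
  have is : Continuous fun t => ∫ s in (0 : ℝ)..t, homSin C s :=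
    continuous_iff_continuousAt.2 fun t =>
      ((continuous_homSin C).integral_hasStrictDerivAt 0 t).hasDerivAt.continuousAt
  refine continuous_pi fun i => ?_
  fin_cases i <;> simp [homFlow] <;> fun_prop

theorem eq_of_hasDerivWithinAt_zero {N : ℝ → ℝ} {t : ℝ}
    (h : ∀ s ∈ uIcc 0 t, HasDerivWithinAt N 0 (uIcc 0 t) s) {s : ℝ} (hs : s ∈ uIcc 0 t) :
    N s = N 0 := by
  have := (convex_uIcc (0 : ℝ) t).norm_image_sub_le_of_norm_hasDerivWithin_le (C := 0) h
    (fun _ _ => by simp) left_mem_uIcc hs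
  rw [zero_mul, norm_le_zero_iff, sub_eq_zero] at this
  exact this

variable {C}

/-- The linear part of ξ is `C 0` times the identity plus a skew matrix, so the squared distance of
two integral curves is exactly proportional to exp(2 `C 0` s). The weighted distance is constant and
starts at zero. -/
theorem eq_homFlow {γ : ℝ → Plane} {t : ℝ}
    (h : ∀ s ∈ uIcc 0 t, HasDerivWithinAt γ (homothety C (γ s)) (uIcc 0 t) s) {s : ℝ}
    (hs : s ∈ uIcc 0 t) : γ s = homFlow C s (γ 0) := by
  have hN := eq_of_hasDerivWithinAt_zero (t := t) (N := fun s => Real.exp (-2 * C 0 * s) *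
    ((γ s 0 - homFlow C s (γ 0) 0) ^ 2 + (γ s 1 - homFlow C s (γ 0) 1) ^ 2)) (fun s hs => by
      have h1 := hasDerivWithinAt_pi.1 (h s hs)
      have h2 := hasDerivAt_pi.1 (hasDerivAt_homFlow C (γ 0) s)
      have h3 : HasDerivAt (fun s => -2 * C 0 * s) (-2 * C 0) s := by
        simpa using (hasDerivAt_id s).const_mul (-2 * C 0)
      have h4 := fun i => ((h1 i).sub (h2 i).hasDerivWithinAt).pow 2
      refine (h3.exp.hasDerivWithinAt.mul ((h4 0).add (h4 1))).congr_deriv ?_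
      simp [homothety]
      ring) hs
  simp only [homFlow_zero, sub_self] at hN
  have hpos := Real.exp_pos (-2 * C 0 * s)
  have h0 : (γ s 0 - homFlow C s (γ 0) 0) ^ 2 + (γ s 1 - homFlow C s (γ 0) 1) ^ 2 = 0 := by
    rcases mul_eq_zero.1 (hN.trans (by simp)) with h | h
    · exact absurd h hpos.ne'
    · exact h
  have e0 : γ s 0 = homFlow C s (γ 0) 0 := sub_eq_zero.1 (pow_eq_zero_iff two_ne_zero |>.1
    (le_antisymm (by linarith [sq_nonneg (γ s 1 - homFlow C s (γ 0) 1)]) (sq_nonneg _)))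
  have e1 : γ s 1 = homFlow C s (γ 0) 1 := sub_eq_zero.1 (pow_eq_zero_iff two_ne_zero |>.1
    (le_antisymm (by linarith [sq_nonneg (γ s 0 - homFlow C s (γ 0) 0)]) (sq_nonneg _)))
  exact funext (Fin.forall_fin_two.2 ⟨e0, e1⟩)

theorem flowsTo_homothety_iff {S : Set Plane} {t : ℝ} {x y : Plane} :
    FlowsTo (homothety C) S t x y ↔ y = homFlow C t x ∧ ∀ s ∈ uIcc 0 t, homFlow C s x ∈ S := by
  constructor
  · rintro ⟨γ, h0, h1, h⟩
    have e := fun s hs => eq_homFlow (fun s hs => (h s hs).2) (s := s) hs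
    rw [h0] at e
    exact ⟨by rw [← h1, e t right_mem_uIcc], fun s hs => by rw [← e s hs]; exact (h s hs).1⟩
  · rintro ⟨rfl, h⟩
    exact ⟨fun s => homFlow C s x, homFlow_zero C x, rfl, fun s hs =>
      ⟨h s hs, (hasDerivAt_homFlow C x s).hasDerivWithinAt⟩⟩

theorem homFlow_neg_homFlow (t : ℝ) (x : Plane) : homFlow C (-t) (homFlow C t x) = x := by
  have h : FlowsTo (homothety C) univ (-t) (homFlow C t x) x := by
    refine ⟨fun s => homFlow C (t + s) x, by simp, by simp, fun s _ => ⟨trivial, ?_⟩⟩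
    have := (hasDerivAt_homFlow C x (t + s)).scomp s ((hasDerivAt_id s).const_add t)
    rw [one_smul] at this
    exact this.hasDerivWithinAt
  exact (flowsTo_homothety_iff.1 h).1.symm

theorem homFlow_homFlow_neg (t : ℝ) (x : Plane) : homFlow C t (homFlow C (-t) x) = x := by
  simpa using homFlow_neg_homFlow (C := C) (-t) x

/-- By joint continuity, whole orbit segments of nearby points stay in `Ω` for short times. -/
theorem eventually_flowsTo {Ω : Set Plane} (hΩ : IsOpen Ω) {x : Plane} (hx : x ∈ Ω) :
    ∀ᶠ t in 𝓝 (0 : ℝ), ∀ᶠ x' in 𝓝 x, FlowsTo (homothety C) Ω t x' (homFlow C t x') := by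
  have h : ∀ᶠ q in 𝓝 ((0, x) : ℝ × Plane), homFlow C q.1 q.2 ∈ Ω :=
    (continuous_homFlow C).continuousAt.eventually_mem (hΩ.mem_nhds (by simpa using hx))
  obtain ⟨r, hr, hB⟩ := Metric.eventually_nhds_iff_ball.1 h
  filter_upwards [Metric.ball_mem_nhds (0 : ℝ) hr] with t ht
  filter_upwards [Metric.ball_mem_nhds x hr] with x' hx'
  refine flowsTo_homothety_iff.2 ⟨rfl, fun s hs => hB (s, x') ?_⟩
  rw [← ball_prod_same]
  refine ⟨?_, hx'⟩
  have := (convex_ball (0 : ℝ) r).ordConnected.uIcc_subset (Metric.mem_ball_self hr) ht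
  exact this hs

/-! ### Conditions on the load and the curvature -/

/-- `2 g ξ^μ_{,μ} + ξ^μ g_{,μ} = 0` along the orbits. -/
theorem InvarianceCondition.eq_exp {Ω : Set Plane} {g : Plane → ℝ}
    (hg : ∀ x ∈ Ω, DifferentiableAt ℝ g x) (H : InvarianceCondition (homothety C) g Ω) {t : ℝ}
    {x y : Plane} (hxy : FlowsTo (homothety C) Ω t x y) : g y = Real.exp (-4 * C 0 * t) * g x := by
  obtain ⟨γ, h0, h1, h⟩ := hxy
  have hN := eq_of_hasDerivWithinAt_zero (t := t) (N := fun s => Real.exp (4 * C 0 * s) * g (γ s))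
    (fun s hs => by
      have h3 : HasDerivAt (fun s => 4 * C 0 * s) (4 * C 0) s := by
        simpa using (hasDerivAt_id s).const_mul (4 * C 0)
      have h4 := (hg _ (h s hs).1).hasFDerivAt.comp_hasDerivWithinAt s (h s hs).2
      refine (h3.exp.hasDerivWithinAt.mul h4).congr_deriv ?_
      have := H _ (h s hs).1
      rw [divergence_homothety, fieldDeriv_eq] at this
      simp only [Function.comp_apply]
      linear_combination Real.exp (4 * C 0 * s) * this) right_mem_uIcc
  simp only [h0, h1, mul_zero, Real.exp_zero, one_mul] at hN
  rw [← hN, ← mul_assoc, ← Real.exp_add]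
  simp

theorem invarianceCondition_of_eventually {Ω : Set Plane} {g : Plane → ℝ}
    (hg : ∀ x ∈ Ω, DifferentiableAt ℝ g x)
    (H : ∀ x ∈ Ω, ∀ᶠ t in 𝓝 (0 : ℝ), g (homFlow C t x) = Real.exp (-4 * C 0 * t) * g x) :
    InvarianceCondition (homothety C) g Ω := by
  intro x hx
  have h1 : HasFDerivAt g (fderiv ℝ g x) (homFlow C 0 x) := by
    rw [homFlow_zero]; exact (hg x hx).hasFDerivAt
  have h2 := h1.comp_hasDerivAt (0 : ℝ) (hasDerivAt_homFlow C x 0)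
  have h3 : HasDerivAt (fun t => -4 * C 0 * t) (-4 * C 0) (0 : ℝ) := by
    simpa using (hasDerivAt_id (0 : ℝ)).const_mul (-4 * C 0)
  have h4 := (h3.exp.mul_const (g x)).congr_of_eventuallyEq (H x hx)
  have := h2.unique h4
  rw [homFlow_zero] at this
  rw [divergence_homothety, fieldDeriv_eq, this]
  simp; ring

theorem invarianceCondition_iff_eigenfunction {Ω : Set Plane} {g : Plane → ℝ} :
    InvarianceCondition (homothety C) g Ω ↔ IsEigenfunctionOn (homothety C) (-4 * C 0) g Ω := by
  refine forall₂_congr fun x _ => ?_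
  rw [divergence_homothety]
  constructor <;> intro h <;> linarith

theorem invarianceCondition_iff_isInvariantOn {Ω : Set Plane} (hΩ : IsOpen Ω) {g : Plane → ℝ}
    (hg : ∀ x ∈ Ω, DifferentiableAt ℝ g x) (hC : C 0 = 0) :
    InvarianceCondition (homothety C) g Ω ↔ IsInvariantOn (homothety C) g Ω := by
  constructor
  · intro H t x y hxy
    simpa [hC] using H.eq_exp hg hxy
  · intro H
    refine invarianceCondition_of_eventually hg fun x hx => ?_
    filter_upwards [eventually_flowsTo (C := C) hΩ hx] with t ht
    simpa [hC] using H t x _ ht.self_of_nhds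

end Flow

/-! ### Transformation of jets by homothetic motions -/

section Pull

variable {C : Fin 4 → ℝ}

theorem hasFDerivAt_homFlow (C : Fin 4 → ℝ) (t : ℝ) (x : Plane) :
    HasFDerivAt (homFlow C t) (ContinuousLinearMap.pi (![
      homCos C t • ContinuousLinearMap.proj 0 + homSin C t • ContinuousLinearMap.proj 1,
      -homSin C t • ContinuousLinearMap.proj 0 + homCos C t • ContinuousLinearMap.proj 1] :
        Fin 2 → Plane →L[ℝ] ℝ)) x := by
  have h : ∀ i : Fin 2, HasFDerivAt (fun x : Plane => x i)
      (ContinuousLinearMap.proj (R := ℝ) (φ := fun _ : Fin 2 => ℝ) i) x := fun i =>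
    (ContinuousLinearMap.proj (R := ℝ) (φ := fun _ : Fin 2 => ℝ) i).hasFDerivAt
  rw [hasFDerivAt_pi']
  intro i
  fin_cases i
  · exact ((((h 0).const_mul _).add ((h 1).const_mul _)).add_const _).add_const _
  · exact ((((h 0).const_mul _).add ((h 1).const_mul _)).sub_const _).add_const _

theorem contDiff_homFlow (C : Fin 4 → ℝ) (t : ℝ) : ContDiff ℝ ∞ (homFlow C t) := by
  rw [contDiff_pi]
  intro i
  fin_cases i <;> simp [homFlow] <;> fun_prop

/-- The composition with a homothetic motion. -/
noncomputable def pullS (C : Fin 4 → ℝ) (t : ℝ) : SmoothFn Plane →ₗ[ℝ] SmoothFn Plane where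
  toFun g := ⟨fun x => g.1 (homFlow C t x), (contDiff_coe g).comp (contDiff_homFlow C t)⟩
  map_add' _ _ := rfl
  map_smul' _ _ := rfl

theorem evalAt_pullS (t : ℝ) (g : SmoothFn Plane) (x : Plane) :
    evalAt x (pullS C t g) = evalAt (homFlow C t x) g := rfl

theorem fderiv_pullS (t : ℝ) (g : SmoothFn Plane) (x e : Plane) :
    fderiv ℝ (pullS C t g : Plane → ℝ) x e
      = (homCos C t * e 0 + homSin C t * e 1) * evalAt (homFlow C t x) (pdS 0 g)
        + (-homSin C t * e 0 + homCos C t * e 1) * evalAt (homFlow C t x) (pdS 1 g) := by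
  have h := (differentiable_coe g (homFlow C t x)).hasFDerivAt.comp x (hasFDerivAt_homFlow C t x)
  have e1 : fderiv ℝ (pullS C t g : Plane → ℝ) x = _ := h.fderiv
  rw [e1, ContinuousLinearMap.comp_apply]
  refine (fieldDeriv_eq (fun _ => _) (g : Plane → ℝ) (homFlow C t x)).symm.trans ?_
  rw [fieldDeriv, Fin.sum_univ_two]
  rfl

theorem pdS_zero_pullS (t : ℝ) (g : SmoothFn Plane) :
    pdS 0 (pullS C t g) = pullS C t (homCos C t • pdS 0 g - homSin C t • pdS 1 g) := by
  ext x
  refine (fderiv_pullS t g x _).trans ?_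
  change _ = homCos C t * evalAt (homFlow C t x) (pdS 0 g)
    - homSin C t * evalAt (homFlow C t x) (pdS 1 g)
  simp
  ring

theorem pdS_one_pullS (t : ℝ) (g : SmoothFn Plane) :
    pdS 1 (pullS C t g) = pullS C t (homSin C t • pdS 0 g + homCos C t • pdS 1 g) := by
  ext x
  refine (fderiv_pullS t g x _).trans ?_
  change _ = homSin C t * evalAt (homFlow C t x) (pdS 0 g)
    + homCos C t * evalAt (homFlow C t x) (pdS 1 g)
  simp

/-- The motion has a conformal linear part of determinant exp(2 `C 0` t). The Laplacian scales by
this determinant, the bilaplacian by its square. -/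
theorem bilapS_pullS (t : ℝ) (g : SmoothFn Plane) :
    bilapS (pullS C t g) = Real.exp (4 * C 0 * t) • pullS C t (bilapS g) := by
  have e : Real.exp (4 * C 0 * t) = (homCos C t ^ 2 + homSin C t ^ 2) ^ 2 := by
    rw [homCos_sq_add_homSin_sq, ← Real.exp_nat_mul]; congr 1; push_cast; ring
  rw [e]
  simp only [bilapS_apply, pdS_zero_pullS, pdS_one_pullS, map_add, map_sub, Derivation.map_smul,
    map_smul, pdS_comm]
  module

/-- The bracket polarizes twice the Hessian determinant, which scales by the squared determinant of
the linear part. -/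
theorem bracket_hessS_pullS (t : ℝ) (g k : SmoothFn Plane) (x : Plane) :
    bracket (hessS x (pullS C t g)) (hessS x (pullS C t k))
      = Real.exp (4 * C 0 * t) * bracket (hessS (homFlow C t x) g) (hessS (homFlow C t x) k) := by
  have e : Real.exp (4 * C 0 * t) = (homCos C t ^ 2 + homSin C t ^ 2) ^ 2 := by
    rw [homCos_sq_add_homSin_sq, ← Real.exp_nat_mul]; congr 1; push_cast; ring
  rw [e]
  simp only [bracket_eq, hessS, pdS_zero_pullS, pdS_one_pullS, map_add, map_sub,
    Derivation.map_smul, map_smul, smul_eq_mul, evalAt_pullS, pdS_comm]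
  ring

theorem karmanSystem_pullS {D E h : ℝ} {P K : Plane → ℝ} (t : ℝ) (w : Fin 2 → SmoothFn Plane)
    (x : Plane) :
    karmanSystem D E h P K (jet (fun y b => evalAt y (pullS C t (w b))) x)
      = Real.exp (4 * C 0 * t) •
          karmanSystem D E h P K (jet (fun y b => evalAt y (w b)) (homFlow C t x))
        + ![Real.exp (4 * C 0 * t) * P (homFlow C t x) - P x,
          Real.exp (4 * C 0 * t) * K (homFlow C t x) - K x] := by
  have hj := jet_snd (fun b => pullS C t (w b)) x
  have hj' := jet_snd w (homFlow C t x)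
  simp only [karmanSystem, bilap_eq (hj _), hess_eq (hj _), bilap_eq (hj' _), hess_eq (hj' _)]
  simp only [bilapS_pullS, bracket_hessS_pullS, map_smul, evalAt_pullS, smul_eq_mul]
  ext k
  fin_cases k <;> simp [jet] <;> ring

end Pull

/-! ### The groups generated by the fields of the classification -/

section Group

/-- The functions w + f and Φ are first integrals, and they determine the lift of an orbit of ξ. -/
theorem flowsTo_shellField_iff {f : Plane → ℝ} {Ω : Set Plane}
    (hf : ∀ x ∈ Ω, DifferentiableAt ℝ f x) {ξ : Plane → Plane} {t : ℝ} {z z' : Total} :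
    FlowsTo (shellField f ξ) (Ω ×ˢ univ) t z z' ↔
      FlowsTo ξ Ω t z.1 z'.1 ∧ z.2 0 + f z.1 = z'.2 0 + f z'.1 ∧ z.2 1 = z'.2 1 := by
  constructor
  · rintro ⟨γ, rfl, rfl, h⟩
    have h1 : ∀ s ∈ uIcc 0 t, HasDerivWithinAt (fun s => (γ s).1) (ξ (γ s).1) (uIcc 0 t) s :=
      fun s hs => (hasFDerivAt_fst (𝕜 := ℝ) (p := γ s)).comp_hasDerivWithinAt s (h s hs).2
    have h2 : ∀ s ∈ uIcc 0 t, HasDerivWithinAt (fun s => (γ s).2)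
        ![-fieldDeriv ξ f (γ s).1, 0] (uIcc 0 t) s :=
      fun s hs => (hasFDerivAt_snd (𝕜 := ℝ) (p := γ s)).comp_hasDerivWithinAt s (h s hs).2
    refine ⟨⟨fun s => (γ s).1, rfl, rfl, fun s hs => ⟨(h s hs).1.1, h1 s hs⟩⟩, ?_, ?_⟩
    · refine (eq_of_hasDerivWithinAt_zero (N := fun s => (γ s).2 0 + f (γ s).1) (fun s hs => ?_)
        right_mem_uIcc).symm
      refine ((hasDerivWithinAt_pi.1 (h2 s hs) 0).add
        ((hf _ (h s hs).1.1).hasFDerivAt.comp_hasDerivWithinAt s (h1 s hs))).congr_deriv ?_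
      rw [fieldDeriv_eq]; simp
    · exact (eq_of_hasDerivWithinAt_zero (N := fun s => (γ s).2 1)
        (fun s hs => hasDerivWithinAt_pi.1 (h2 s hs) 1) right_mem_uIcc).symm
  · rintro ⟨⟨γ, h0, h1, h⟩, e0, e1⟩
    refine ⟨fun s => (γ s, ![z.2 0 + f z.1 - f (γ s), z.2 1]), ?_, ?_, fun s hs =>
      ⟨⟨(h s hs).1, trivial⟩, (h s hs).2.prodMk ?_⟩⟩
    · refine Prod.ext h0 (funext (Fin.forall_fin_two.2 ⟨?_, rfl⟩))
      simp [h0]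
    · refine Prod.ext h1 (funext (Fin.forall_fin_two.2 ⟨?_, e1⟩))
      simp [h1, e0]
    · rw [hasDerivWithinAt_pi, Fin.forall_fin_two]
      refine ⟨?_, hasDerivWithinAt_const _ _ _⟩
      refine (((hf _ (h s hs).1).hasFDerivAt.comp_hasDerivWithinAt s (h s hs).2).const_sub
        (z.2 0 + f z.1)).congr_deriv ?_
      simp [fieldDeriv_eq]

variable {D E h : ℝ} {P K f : Plane → ℝ} {Ω : Set Plane} {C : Fin 4 → ℝ} {F : DiffSystem}

theorem FlowsTo.mem {V : Type*} [NormedAddCommGroup V] [NormedSpace ℝ V] {X : V → V} {M : Set V}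
    {t : ℝ} {z z' : V} (H : FlowsTo X M t z z') : z ∈ M ∧ z' ∈ M := by
  obtain ⟨γ, rfl, rfl, h⟩ := H
  exact ⟨(h _ left_mem_uIcc).1, (h _ right_mem_uIcc).1⟩

theorem jet_congr {u v : Plane → Fin 2 → ℝ} {x : Plane} (h : u =ᶠ[𝓝 x] v) : jet u x = jet v x := by
  refine Prod.ext rfl (funext fun a => funext fun J => ?_)
  exact (iterPd_congr (h.mono fun y hy => congrFun hy a) J).self_of_nhds

theorem tendsto_homFlow (t : ℝ) (x : Plane) : Tendsto (homFlow C t) (𝓝 x) (𝓝 (homFlow C t x)) :=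
  (contDiff_homFlow C t).continuous.continuousAt

/-- A system that becomes the von Kármán system under the translation of `w` by `f` admits the
group of the homothety, transformed accordingly, if and only if the right-hand sides satisfy the
invariance conditions. -/
theorem admitsGroup_shellField_iff (hD : 0 < D) (hE : 0 < E) (hh : 0 < h) (hΩ : IsOpen Ω)
    (hP : ∀ x ∈ Ω, DifferentiableAt ℝ P x) (hK : ∀ x ∈ Ω, DifferentiableAt ℝ K x)
    (hF : ∀ x ∈ Ω, ∃ g : SmoothFn Plane, (g : Plane → ℝ) =ᶠ[𝓝 x] f ∧
      ∀ w : Fin 2 → SmoothFn Plane, F (jet (fun y b => evalAt y (w b)) x)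
        = karmanSystem D E h P K (jet (fun y b => evalAt y ((w + ![g, 0]) b)) x)) :
    AdmitsGroup F (Ω ×ˢ univ) (shellField f (homothety C)) ↔
      InvarianceCondition (homothety C) P Ω ∧ InvarianceCondition (homothety C) K Ω := by
  have hf : ∀ x ∈ Ω, DifferentiableAt ℝ f x := fun x hx => by
    obtain ⟨g, hg, -⟩ := hF x hx
    exact (differentiable_coe g x).congr_of_eventuallyEq hg.symm
  constructor
  · intro H
    have key : ∀ x ∈ Ω, ∀ᶠ t in 𝓝 (0 : ℝ),
        P (homFlow C t x) = Real.exp (-4 * C 0 * t) * P x ∧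
          K (homFlow C t x) = Real.exp (-4 * C 0 * t) * K x := by
      intro x hx
      filter_upwards [eventually_flowsTo (C := C) hΩ hx] with t ht
      obtain ⟨g, hg, hFg⟩ := hF x hx
      obtain ⟨k, hk, hFk⟩ := hF _ ht.self_of_nhds.mem.2
      -- A von Kármán solution at x: its translate by -f satisfies `F = 0` there, so the transported
      -- functions must do so at the image point, which is the scaling law for P and K.
      obtain ⟨w, hw⟩ : ∃ w, w = flatS x 0 0 ![P x / D, K x / (1 / (E * h))] := ⟨_, rfl⟩
      have hw0 : karmanSystem D E h P K (jet (fun y b => evalAt y (w b)) x) = 0 := by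
        have hb : ∀ a, evalAt x (bilapS (w a)) = ![P x / D, K x / (1 / (E * h))] a := fun a => by
          rw [hw, flatS, evalAt_bilapS_polyS]
        have h0 : ∀ a, hessS x (w a) = 0 := fun a => by rw [hw, hessS_flatS]
        simp only [karmanSystem, bilap_eq (jet_snd w x _), hess_eq (jet_snd w x _), hb, h0,
          bracket_zero_left]
        ext a
        fin_cases a <;> simp [jet] <;> field_simp <;> ring
      have hflow : ∀ᶠ x' in 𝓝 x, FlowsTo (shellField f (homothety C)) (Ω ×ˢ univ) t
          (x', fun b => evalAt x' ((w - ![g, 0]) b)) (homFlow C t x', fun b =>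
            evalAt (homFlow C t x') (((fun b => pullS C (-t) (w b)) - ![k, 0]) b)) := by
        filter_upwards [ht, hg, (tendsto_homFlow t x).eventually hk] with x' hx' hgx hkx
        refine (flowsTo_shellField_iff hf).2 ⟨hx', ?_, ?_⟩
        · have e1 : evalAt x' g = f x' := hgx
          have e2 : evalAt (homFlow C t x') k = f (homFlow C t x') := hkx
          simp [e1, e2, evalAt_pullS, homFlow_neg_homFlow]
        · simp [evalAt_pullS, homFlow_neg_homFlow]
      have := H t _ _ x _ (contDiff_evalAt _) (contDiff_evalAt _).contDiffAt hflow.self_of_nhds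
        (hflow.mono fun x' hx' => ⟨_, hx'⟩) (by rw [hFg, sub_add_cancel, hw0])
      rw [hFk, sub_add_cancel, karmanSystem_pullS, homFlow_neg_homFlow, hw0, smul_zero,
        zero_add] at this
      have e : 4 * C 0 * -t = -4 * C 0 * t := by ring
      rw [e] at this
      exact ⟨(sub_eq_zero.1 (congrFun this 0)).symm, (sub_eq_zero.1 (congrFun this 1)).symm⟩
    exact ⟨invarianceCondition_of_eventually hP fun x hx => (key x hx).mono fun t ht => ht.1,
      invarianceCondition_of_eventually hK fun x hx => (key x hx).mono fun t ht => ht.2⟩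
  · rintro ⟨HP, HK⟩ t u v x y hu - hxy hev hFu
    have hflow := (flowsTo_shellField_iff hf).1 hxy
    obtain ⟨g, hg, hFg⟩ := hF x hflow.1.mem.1
    obtain ⟨k, hk, hFk⟩ := hF y hflow.1.mem.2
    have hy : y = homFlow C t x := (flowsTo_homothety_iff.1 hflow.1).1
    have hx : homFlow C (-t) y = x := by rw [hy, homFlow_neg_homFlow]
    have hline : Tendsto (homFlow C (-t)) (𝓝 y) (𝓝 x) := by
      have := tendsto_homFlow (C := C) (-t) y
      rwa [hx] at this
    -- The flow condition determines the germ of v: carry the translate of u along the motion, then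
    -- undo the translation at the new point. The germs of f at x and y need separate
    -- representatives `g` and `k`.
    have hv : v =ᶠ[𝓝 y] fun y' b => evalAt y'
        (((fun b => pullS C (-t) ((compnt hu + ![g, 0]) b)) - ![k, 0]) b) := by
      filter_upwards [hline.eventually hev, hline.eventually hg, hk] with y' hy' hgy hky
      obtain ⟨y'', hy''⟩ := hy'
      obtain ⟨h1, h2, h3⟩ := (flowsTo_shellField_iff hf).1 hy''
      obtain rfl : y'' = y' :=
        (flowsTo_homothety_iff.1 h1).1.trans (homFlow_homFlow_neg t y')
      have e1 : evalAt (homFlow C (-t) y'') g = f (homFlow C (-t) y'') := hgy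
      have e2 : evalAt y'' k = f y'' := hky
      have e3 : ∀ b, evalAt (homFlow C (-t) y'') (compnt hu b) = u (homFlow C (-t) y'') b :=
        fun b => rfl
      refine funext (Fin.forall_fin_two.2 ⟨?_, ?_⟩)
      · simp only at h2
        simp [evalAt_pullS, e1, e2, e3, h2]
      · simp only at h3
        simp [evalAt_pullS, e3, h3]
    have e : 4 * C 0 * -t = -4 * C 0 * t := by ring
    have hu0 : karmanSystem D E h P K
        (jet (fun y b => evalAt y ((compnt hu + ![g, 0]) b)) x) = 0 := by
      rw [← hFg]; exact hFu
    -- What is left is exp(-4 `C 0` t) P(x) - P(y), and likewise for K; it vanishes by the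
    -- integrated invariance conditions.
    rw [jet_congr hv, hFk, sub_add_cancel, karmanSystem_pullS, hx, hu0, smul_zero, zero_add, e,
      ← HP.eq_exp hP hflow.1, ← HK.eq_exp hK hflow.1, sub_self, sub_self]
    ext a; fin_cases a <;> rfl

theorem shellField_zero (ξ : Plane → Plane) : shellField 0 ξ = planeField ξ := by
  funext z
  refine Prod.ext rfl (funext (Fin.forall_fin_two.2 ⟨?_, rfl⟩))
  simp [shellField, planeField, fieldDeriv_eq]

theorem admitsGroup_karmanSystem_iff (hD : 0 < D) (hE : 0 < E) (hh : 0 < h) (hΩ : IsOpen Ω)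
    (hP : ∀ x ∈ Ω, DifferentiableAt ℝ P x) (hK : ∀ x ∈ Ω, DifferentiableAt ℝ K x) :
    AdmitsGroup (karmanSystem D E h P K) (Ω ×ˢ univ) (planeField (homothety C)) ↔
      InvarianceCondition (homothety C) P Ω ∧ InvarianceCondition (homothety C) K Ω := by
  rw [← shellField_zero]
  refine admitsGroup_shellField_iff hD hE hh hΩ hP hK fun x _ => ⟨0, .rfl, fun w => ?_⟩
  have : ![(0 : SmoothFn Plane), 0] = 0 := funext (Fin.forall_fin_two.2 ⟨rfl, rfl⟩)
  rw [this, add_zero]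

theorem admitsGroup_marguerreSystem_iff {p : Plane → ℝ} (hD : 0 < D) (hE : 0 < E) (hh : 0 < h)
    (hΩ : IsOpen Ω) (hf : ContDiffOn ℝ ∞ f Ω) (hp : ContDiffOn ℝ ∞ p Ω) :
    AdmitsGroup (marguerreSystem D E h f p) (Ω ×ˢ univ) (shellField f (homothety C)) ↔
      InvarianceCondition (homothety C) (effLoad D f p) Ω ∧
        InvarianceCondition (homothety C) (gaussCurv f) Ω := by
  refine admitsGroup_shellField_iff hD hE hh hΩ
    (fun x hx => (differentiableAt_data hΩ hf hp hx).1)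
    (fun x hx => (differentiableAt_data (D := D) hΩ hf hp hx).2) fun x hx => ?_
  obtain ⟨g, hg⟩ := exists_smoothFn_eventuallyEq hΩ hf hx
  exact ⟨g, hg, fun w => by rw [jet_shift, ← marguerreSystem_eq hg]⟩

end Group

end Marguerre

/-! ### Assembly of the main theorem -/

open Marguerre in
theorem mainTheorem2 (D E h : ℝ) (hD : 0 < D) (hE : 0 < E) (hh : 0 < h)
    (Ω : Set Plane) (hΩ : IsOpen Ω) (f p : Plane → ℝ)
    (hf : ContDiffOn ℝ ∞ f Ω) (hp : ContDiffOn ℝ ∞ p Ω) :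
    (∀ M : Set Total, IsOpen M → IsConnected M → M ⊆ Ω ×ˢ univ →
      ∀ X : Total → Total, ContDiffOn ℝ ∞ X M →
        (AdmitsField (marguerreSystem D E h f p) M X ↔
          ∃ (C : Fin 4 → ℝ) (A B : Fin 3 → ℝ),
            (∀ z ∈ M, X z = shellField f (homothety C) z + kernelField A B z) ∧
            InvarianceCondition (homothety C) (effLoad D f p) (Prod.fst '' M) ∧
            InvarianceCondition (homothety C) (gaussCurv f) (Prod.fst '' M))) ∧
    (∀ C : Fin 4 → ℝ,
      List.TFAE [
        AdmitsField (marguerreSystem D E h f p) (Ω ×ˢ univ) (shellField f (homothety C)),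
        AdmitsGroup (marguerreSystem D E h f p) (Ω ×ˢ univ) (shellField f (homothety C)),
        AdmitsField (karmanSystem D E h (effLoad D f p) (gaussCurv f)) (Ω ×ˢ univ)
          (planeField (homothety C)),
        AdmitsGroup (karmanSystem D E h (effLoad D f p) (gaussCurv f)) (Ω ×ˢ univ)
          (planeField (homothety C)),
        InvarianceCondition (homothety C) (effLoad D f p) Ω ∧
          InvarianceCondition (homothety C) (gaussCurv f) Ω,
        (C 0 = 0 → IsInvariantOn (homothety C) (effLoad D f p) Ω ∧
            IsInvariantOn (homothety C) (gaussCurv f) Ω) ∧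
          (C 0 ≠ 0 → IsEigenfunctionOn (homothety C) (-4 * C 0) (effLoad D f p) Ω ∧
            IsEigenfunctionOn (homothety C) (-4 * C 0) (gaussCurv f) Ω)]) := by
  refine ⟨fun M hMo hMc hM X hX => marguerre_classification hD hE hh hΩ hf hp hMo hMc hM hX,
    fun C => ?_⟩
  have hP : ∀ x ∈ Ω, DifferentiableAt ℝ (effLoad D f p) x := fun x hx =>
    (differentiableAt_data hΩ hf hp hx).1
  have hK : ∀ x ∈ Ω, DifferentiableAt ℝ (gaussCurv f) x := fun x hx =>
    (differentiableAt_data (D := D) hΩ hf hp hx).2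
  have hproj : Prod.fst '' (Ω ×ˢ (univ : Set (Fin 2 → ℝ))) = Ω :=
    fst_image_prod Ω univ_nonempty
  have hopen : IsOpen (Ω ×ˢ (univ : Set (Fin 2 → ℝ))) := hΩ.prod isOpen_univ
  -- The invariance conditions on `Ω` are the hub of all equivalences; the criterion for fields is
  -- used with zero kernel part.
  tfae_have 1 ↔ 5 := by
    rw [admitsField_marguerreSystem_iff (C := C) (A := 0) (B := 0) hD hE hh hΩ hf hp hopen
      subset_rfl fun z _ => by rw [kernelField_zero, add_zero], hproj]
  tfae_have 2 ↔ 5 := admitsGroup_marguerreSystem_iff hD hE hh hΩ hf hp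
  tfae_have 3 ↔ 5 := by
    rw [admitsField_karmanSystem_iff (C := C) (A := 0) (B := 0) hD hE hh hopen
      (fun z hz => hP _ hz.1) (fun z hz => hK _ hz.1)
      fun z _ => by rw [kernelField_zero, add_zero], hproj]
  tfae_have 4 ↔ 5 := admitsGroup_karmanSystem_iff hD hE hh hΩ hP hK
  tfae_have 5 ↔ 6 := by
    by_cases hC : C 0 = 0
    · simp only [hC, ne_eq, not_true_eq_false, false_implies, and_true, true_implies,
        invarianceCondition_iff_isInvariantOn hΩ hP hC,
        invarianceCondition_iff_isInvariantOn hΩ hK hC]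
    · simp only [hC, ne_eq, not_false_eq_true, false_implies, true_and, true_implies,
        invarianceCondition_iff_eigenfunction]
  tfae_finish
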